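/- **Setting.** Let $\mathbb{R}^{4,2}$ be $\mathbb{R}^6$ with a symmetric bilinear form $(\cdot,\cdot)$ of signature $(4,2)$. For vectors $a,b$ of a pseudo-Euclidean space let $a\wedge b$ be the skew endomorphism $c\mapsto (a,c)b-(b,c)a$. All maps are smooth ($C^\infty$), and $\Gamma f$ denotes the (local) sections of a vector bundle $f$. *Legendre maps.* Let $\Omega$ be an open interval in $\mathbb{R}$ or a product $I_1\times I_2$ of open intervals, and let $V$ be respectively a pseudo-Euclidean space of signature $(3,2)$ or $(4,2)$. A Legendre map (for an interval: a Legendre curve) is a map $f$ from $\Omega$ to the null $2$-planes of $V$, viewed as a rank $2$ subbundle of $\Omega\times V$, such that $d\sigma$ takes values in $f^\perp$ for all $\sigma\in\Gamma f$, and such that a tangent vector $X$ at $x$ with $d_X\sigma\in f(x)$ for all $\sigma\in\Gamma f$ vanishes. A curvature sphere of $f$ at $x$ is a line $s\le f(x)$ such that, for some $X\ne0$, $d_X\sigma\in f(x)$ whenever $\sigma\in\Gamma f$ and $\sigma(x)\in s$; such an $X$ is a curvature direction. For $\Omega=I_1\times I_2$, $f$ is umbilic-free if no point has exactly one curvature sphere.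 It is regular if every smooth line bundle $s\le f$ consisting of curvature spheres is an immersion into the projective space of $\mathbb{R}^{4,2}$. *Lie applicability.* A gauge potential of $f$ is a $1$-form $\eta$ on $\Omega$ with values in $f\wedge f^\perp$ (the span of the $a\wedge b$ with $a\in f$, $b\in f^\perp$) such that $d\eta=0$, $[\eta\wedge\eta]=0$, and the quadratic differential $\mathcal{Q}^\eta(X,Y)=\operatorname{tr}(f\to f:\sigma\mapsto \eta(X)d_Y\sigma)$ is not identically zero. $f$ is Lie applicable if it has a gauge potential. *Constrained elastic curves.* Let $C:I\to$ {null $2$-planes of $V$} be a Legendre curve, with $V$ of signature $(3,2)$. A polarisation of $C$ is the class $[\xi]$ of a gauge potential $\xi$ of $C$ modulo $\xi\mapsto\xi-d\tau$, $\tau\in\Gamma(\wedge^2C)$. A linear conserved quantity of $d+t\xi$ is $p(t)=p_0+tp_1$ with $p_0,p_1:I\to V$, $p_1\in\Gamma C$, and $(d+t\xi)p(t)=0$ for all $t\in\mathbb{R}$; then $p(0)=p_0$ is constant. For a $3$-dimensional subspace $W_0\le V$, $C$ is a constrained elastic curve with respect to $W_0$ if for some polarisation $[\xi]$ there is a $3$-dimensional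 space $W$ of linear conserved quantities of $d+t\xi$ with $W(0)=W_0$. *Spherical curvature lines.* Let $f$ be a regular umbilic-free Legendre map on $I_1\times I_2$ and $T$ one of the two coordinate directions. The $T$-parameter lines are spherical curvature lines of $f$ if $T$ is everywhere a curvature direction and, for some $\mathfrak{p}\in\mathbb{R}^{4,2}$ with $(\mathfrak{p},\mathfrak{p})=-1$, there is a null line bundle $\nu$ on $I_1\times I_2$, constant along the $T$-parameter lines, such that $f\cap\mathfrak{p}^\perp\perp\nu$ (the point sphere map lies on the spheres $\nu$) and $(\nu\oplus\langle\mathfrak{p}\rangle)\cap f=\{0\}$ (the spheres meet the surface transversally). *Spherical evolution map.* Let $L$ be a map from an open interval $I_2$ to the set of spacelike lines of $\mathbb{R}^{4,2}$, let $v_0\in I_2$ and $L_0=L(v_0)$. Let $\mathcal{D}^L$ be the sum of the connections induced by the trivial connection $d$ on $L$ and $L^\perp$. The spherical evolution map along $L$ based at $v_0$ is the map $A:I_2\to \mathrm{O}(4,2)$ with $A\circ\mathcal{D}^L\circ A^{-1}=d$ and $A(v_0)=\mathrm{id}$. **Theorem.** Let $I_1,I_2\subseteq\mathbb{R}$ be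 non-empty open intervals, $v_0\in I_2$, $L$ a map from $I_2$ to the spacelike lines of $\mathbb{R}^{4,2}$, $A$ the spherical evolution map along $L$ based at $v_0$, and $C$ a Legendre curve on $I_1$ in $L_0^\perp\cong\mathbb{R}^{3,2}$. Suppose that $f(u,v)=A(v)^{-1}C(u)$ is a regular umbilic-free Legendre map on $I_1\times I_2$ (its $u$-parameter lines are then one family of spherical curvature lines, and its $v$-parameter lines are the other family of curvature lines). Then $f$ is Lie applicable if and only if at least one of the following holds: 1. the $v$-parameter lines are also spherical curvature lines of $f$; 2. there is a $3$-dimensional subspace $W_0\le L_0^\perp$ such that $L(v)\le L_0\oplus W_0$ for all $v\in I_2$ and $C$ is a constrained elastic curve with respect to $W_0$. -/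

import Mathlib

open scoped ContDiff Topology

namespace LieSphere

noncomputable section

/-! ### The pseudo-Euclidean space of signature (4,2) -/

/-- The vector space underlying the pseudo-Euclidean space `ℝ^{4,2}`. -/
abbrev R42 : Type := Fin 6 → ℝ

/-- The symmetric bilinear form of signature `(4,2)` on `ℝ^6`. -/
def lieForm : LinearMap.BilinForm ℝ R42 :=
  Matrix.toBilin' (Matrix.diagonal ![1, 1, 1, 1, -1, -1])

theorem lieForm_apply (x y : R42) :
    lieForm x y =
      x 0 * y 0 + x 1 * y 1 + x 2 * y 2 + x 3 * y 3 - x 4 * y 4 - x 5 * y 5 := by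
  simp [lieForm, Matrix.toBilin'_apply, Matrix.diagonal_apply, Fin.sum_univ_succ]
  ring

section General

variable {E V : Type*} [NormedAddCommGroup E] [NormedSpace ℝ E]
  [NormedAddCommGroup V] [NormedSpace ℝ V]

/-! ### Subbundles of a trivial bundle and their sections

The base is an open subset `Ω` of a normed space `E`; a subbundle of the trivial bundle `Ω × V` is a
map `f : E → Submodule ℝ V`, of which only the values on `Ω` are used. -/

/-- `f` is a smooth rank `k` subbundle of `Ω × V` (equivalently, a smooth map from `Ω` to the
Grassmannian of `k`-planes): near every point of `Ω` it has a smooth frame. -/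
def IsSmoothSubbundle (k : ℕ) (Ω : Set E) (f : E → Submodule ℝ V) : Prop :=
  ∀ x ∈ Ω, ∃ s : Fin k → E → V, ∀ᶠ y in 𝓝 x,
    (∀ i, ContDiffAt ℝ ∞ (s i) y) ∧ LinearIndependent ℝ (fun i => s i y) ∧
      f y = Submodule.span ℝ (Set.range fun i => s i y)

/-- `σ` is a smooth section of `f` on a neighbourhood of `x`. -/
def IsSectionNear (f : E → Submodule ℝ V) (x : E) (σ : E → V) : Prop :=
  ∀ᶠ y in 𝓝 x, ContDiffAt ℝ ∞ σ y ∧ σ y ∈ f y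

/-! ### Legendre maps -/

/-- `f` is a smooth map into the Grassmannian of null 2-planes of `(V, B)` such that derivatives
of sections of `f` are orthogonal to `f`, and such that a tangent vector `X` at `x` with
`d_X σ ∈ f x` for all sections `σ` of `f` vanishes. -/
structure IsLegendreMap (B : LinearMap.BilinForm ℝ V) (Ω : Set E) (f : E → Submodule ℝ V) :
    Prop where
  smooth : IsSmoothSubbundle 2 Ω f
  null : ∀ x ∈ Ω, ∀ a ∈ f x, ∀ b ∈ f x, B a b = 0
  contact : ∀ x ∈ Ω, ∀ σ, IsSectionNear f x σ → ∀ X : E, ∀ b ∈ f x, B (fderiv ℝ σ x X) b = 0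
  immersive : ∀ x ∈ Ω, ∀ X : E, (∀ σ, IsSectionNear f x σ → fderiv ℝ σ x X ∈ f x) → X = 0

/-- The curvature space of a subspace `s ≤ f x`: all `X` such that `d_X σ ∈ f x` for every section
`σ` of `f` with `σ x ∈ s`. -/
def curvatureSpace (f : E → Submodule ℝ V) (x : E) (s : Submodule ℝ V) : Submodule ℝ E where
  carrier := {X | ∀ σ, IsSectionNear f x σ → σ x ∈ s → fderiv ℝ σ x X ∈ f x}
  add_mem' := by
    intro X Y hX hY σ h1 h2
    rw [map_add]
    exact (f x).add_mem (hX σ h1 h2) (hY σ h1 h2)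
  zero_mem' := by
    intro σ _ _
    rw [map_zero]
    exact (f x).zero_mem
  smul_mem' := by
    intro c X hX σ h1 h2
    rw [map_smul]
    exact (f x).smul_mem c (hX σ h1 h2)

/-- `s` is a curvature sphere of `f` at `x`. -/
def IsCurvatureSphere (f : E → Submodule ℝ V) (x : E) (s : Submodule ℝ V) : Prop :=
  s ≤ f x ∧ Module.finrank ℝ s = 1 ∧ curvatureSpace f x s ≠ ⊥

/-- `X` is a (non-zero) curvature direction of `f` at `x`. -/
def IsCurvatureDirection (f : E → Submodule ℝ V) (x X : E) : Prop :=
  X ≠ 0 ∧ ∃ s, IsCurvatureSphere f x s ∧ X ∈ curvatureSpace f x s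

/-- No point of `Ω` is umbilic, that is, has exactly one curvature sphere. -/
def IsUmbilicFree (Ω : Set E) (f : E → Submodule ℝ V) : Prop :=
  ∀ x ∈ Ω, ¬ ∃! s, IsCurvatureSphere f x s

/-- The smooth map `s` into the projective space of `V` is an immersion on `Ω`; its differential
at `x` in the direction `X` is the map `s x → V ⧸ s x` induced by `σ ↦ d_X σ`. -/
def IsProjectiveImmersion (Ω : Set E) (s : E → Submodule ℝ V) : Prop :=
  ∀ x ∈ Ω, ∀ X : E, (∀ σ, IsSectionNear s x σ → fderiv ℝ σ x X ∈ s x) → X = 0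

/-- `f` is regular: every (smooth) curvature sphere congruence of `f` is an immersion. -/
def IsRegular (Ω : Set E) (f : E → Submodule ℝ V) : Prop :=
  ∀ s : E → Submodule ℝ V, IsSmoothSubbundle 1 Ω s → (∀ x ∈ Ω, IsCurvatureSphere f x (s x)) →
    IsProjectiveImmersion Ω s

/-! ### Spherical curvature lines -/

/-- The leaves of the (constant) direction field `X` are spherical curvature lines of `f`: they are
curvature lines and, in some Riemannian conformal geometry given by a unit timelike point sphere
complex `p`, there is a smooth sphere congruence `ν`, constant along these leaves, such that the
point sphere map `f ∩ p^⊥` lies on the spheres `ν` and meets them transversally.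
The null lines of `ν x ⊕ ⟨p⟩` are the two orientations of the sphere `ν x`, so transversality, that
is, that neither of them is in oriented contact with `f` at the point, says that this space meets
`f x` trivially. -/
def HasSphericalCurvatureLines (B : LinearMap.BilinForm ℝ V) (Ω : Set E) (f : E → Submodule ℝ V)
    (X : E) : Prop :=
  (∀ x ∈ Ω, IsCurvatureDirection f x X) ∧
  ∃ (p : V) (ν : E → Submodule ℝ V), B p p = -1 ∧
    IsSmoothSubbundle 1 Ω ν ∧
    (∀ x ∈ Ω, ∀ n ∈ ν x, B n n = 0) ∧
    (∀ x ∈ Ω, ∀ t : ℝ, segment ℝ x (x + t • X) ⊆ Ω → ν (x + t • X) = ν x) ∧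
    (∀ x ∈ Ω, ∀ a ∈ f x, B p a = 0 → ∀ n ∈ ν x, B n a = 0) ∧
    (∀ x ∈ Ω, (ν x ⊔ Submodule.span ℝ {p}) ⊓ f x = ⊥)

/-! ### Gauge potentials and Lie applicability -/

section Gauge

variable [FiniteDimensional ℝ V]

/-- The skew endomorphism `a ∧ b : c ↦ (a, c) b - (b, c) a`. -/
def wedge (B : LinearMap.BilinForm ℝ V) (a b : V) : V →L[ℝ] V :=
  LinearMap.toContinuousLinearMap ((B a).smulRight b - (B b).smulRight a)

theorem wedge_apply (B : LinearMap.BilinForm ℝ V) (a b c : V) :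
    wedge B a b c = B a c • b - B b c • a := by
  simp [wedge]

/-- The space `P ∧ Q` of skew endomorphisms spanned by `a ∧ b` with `a ∈ P`, `b ∈ Q`. -/
def wedgeSpace (B : LinearMap.BilinForm ℝ V) (P Q : Submodule ℝ V) : Submodule ℝ (V →L[ℝ] V) :=
  Submodule.span ℝ {T | ∃ a ∈ P, ∃ b ∈ Q, T = wedge B a b}

/-- `q` is the value at `x` on `(X, Y)` of the quadratic differential of `η`, the trace of the
endomorphism `σ ↦ η(X) d_Y σ` of the fibre `f x`. (When `η` takes values in `f ∧ f^⊥` and `f` is a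
Legendre map, this endomorphism exists and is unique.) -/
def IsQuadDiffValue (f : E → Submodule ℝ V) (η : E → E →L[ℝ] V →L[ℝ] V) (x X Y : E) (q : ℝ) :
    Prop :=
  ∃ M : f x →ₗ[ℝ] f x,
    (∀ σ, IsSectionNear f x σ → ∀ h : σ x ∈ f x, (M ⟨σ x, h⟩ : V) = η x X (fderiv ℝ σ x Y)) ∧
    LinearMap.trace ℝ (f x) M = q

/-- `η` is a gauge potential of `f`: a smooth 1-form with values in `f ∧ f^⊥` with `dη = 0` and
`[η ∧ η] = 0` whose quadratic differential is not identically zero. -/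
structure IsGaugePotential (B : LinearMap.BilinForm ℝ V) (Ω : Set E) (f : E → Submodule ℝ V)
    (η : E → E →L[ℝ] V →L[ℝ] V) : Prop where
  smooth : ContDiffOn ℝ ∞ η Ω
  mem : ∀ x ∈ Ω, ∀ X : E, η x X ∈ wedgeSpace B (f x) (B.orthogonal (f x))
  closed : ∀ x ∈ Ω, ∀ X Y : E, fderiv ℝ η x X Y = fderiv ℝ η x Y X
  comm : ∀ x ∈ Ω, ∀ X Y : E, (η x X).comp (η x Y) = (η x Y).comp (η x X)
  quad_ne_zero : ∃ x ∈ Ω, ∃ (X Y : E) (q : ℝ), IsQuadDiffValue f η x X Y q ∧ q ≠ 0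

/-- `f` is Lie applicable. -/
def IsLieApplicable (B : LinearMap.BilinForm ℝ V) (Ω : Set E) (f : E → Submodule ℝ V) : Prop :=
  ∃ η, IsGaugePotential B Ω f η

end Gauge

/-! ### Linear conserved quantities and constrained elastic curves -/

/-- The pair `p = (p₀, p₁)` represents the linear conserved quantity `p(t) = p₀ + t p₁` of `d + tξ`:
`(d + tξ) p(t) = 0` for all `t`, and the top coefficient `p₁` is a section of `C`. -/
structure IsLinearConservedQuantity (Ω : Set E) (C : E → Submodule ℝ V)
    (ξ : E → E →L[ℝ] V →L[ℝ] V) (p : (E → V) × (E → V)) : Prop where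
  smooth_zero : ContDiffOn ℝ ∞ p.1 Ω
  smooth_one : ContDiffOn ℝ ∞ p.2 Ω
  parallel : ∀ t : ℝ, ∀ x ∈ Ω, ∀ X : E,
    fderiv ℝ (fun y => p.1 y + t • p.2 y) x X + t • ξ x X (p.1 x + t • p.2 x) = 0
  top_mem : ∀ x ∈ Ω, p.2 x ∈ C x

/-- The Legendre curve `C` is a constrained elastic curve with respect to the 3-dimensional subspace
`W₀`: there are a polarisation of `C`, represented by a gauge potential `ξ`, and a 3-dimensional
space `W` of linear conserved quantities of `d + tξ` with `W(0) = W₀`. -/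
def IsConstrainedElastic [FiniteDimensional ℝ V] (B : LinearMap.BilinForm ℝ V) (I : Set ℝ)
    (C : ℝ → Submodule ℝ V) (W₀ : Submodule ℝ V) : Prop :=
  Module.finrank ℝ W₀ = 3 ∧
  ∃ ξ : ℝ → ℝ →L[ℝ] V →L[ℝ] V, IsGaugePotential B I C ξ ∧
    ∃ W : Submodule ℝ ((ℝ → V) × (ℝ → V)), Module.finrank ℝ W = 3 ∧
      (∀ p ∈ W, IsLinearConservedQuantity I C ξ p) ∧
      ∀ u ∈ I, {w : V | ∃ p ∈ W, p.1 u = w} = (W₀ : Set V)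

/-! ### Spherical evolution maps -/

/-- The orthogonal projection onto a subspace `U` with `V = U ⊕ U^⊥`. -/
def orthProj (B : LinearMap.BilinForm ℝ V) (U : Submodule ℝ V) : V →ₗ[ℝ] V :=
  open Classical in
  if h : IsCompl U (B.orthogonal U) then U.projection (B.orthogonal U) h else 0

/-- The connection `𝒟^L` in the direction of the parameter: the sum of the connections induced by
`d` on `L` and on `L^⊥`. -/
def splitConnection (B : LinearMap.BilinForm ℝ V) (L : ℝ → Submodule ℝ V) (σ : ℝ → V) (v : ℝ) : V :=
  orthProj B (L v) (deriv (fun w => orthProj B (L w) (σ w)) v) +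
    (deriv (fun w => σ w - orthProj B (L w) (σ w)) v -
      orthProj B (L v) (deriv (fun w => σ w - orthProj B (L w) (σ w)) v))

/-- `A` is the spherical evolution map along `L` based at `v₀`: a smooth map into the orthogonal
group of `(V, B)` with `A ∘ 𝒟^L ∘ A⁻¹ = d` and `A v₀ = id`. -/
structure IsSphericalEvolutionMap (B : LinearMap.BilinForm ℝ V) (I : Set ℝ)
    (L : ℝ → Submodule ℝ V) (v₀ : ℝ) (A : ℝ → V ≃L[ℝ] V) : Prop where
  smooth : ContDiffOn ℝ ∞ (fun v => (A v : V →L[ℝ] V)) I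
  orthogonal : ∀ v ∈ I, ∀ a b : V, B (A v a) (A v b) = B a b
  trivialises : ∀ σ : ℝ → V, ContDiffOn ℝ ∞ σ I → ∀ v ∈ I,
    deriv (fun w => A w (σ w)) v = A v (splitConnection B L σ v)
  base : A v₀ = ContinuousLinearEquiv.refl ℝ V

end General

/-- `L` is a smooth map from `I` into the Grassmannian of spacelike lines of `ℝ^{4,2}`. -/
def IsSpacelikeLineCurve (I : Set ℝ) (L : ℝ → Submodule ℝ R42) : Prop :=
  IsSmoothSubbundle 1 I L ∧ ∀ v ∈ I, ∀ l ∈ L v, l ≠ 0 → 0 < lieForm l l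

end

end LieSphere

/-!
Fix a unit vector `l` of `L v₀`, put `G v = (A v)⁻¹` and `E = l^⊥`. The defining property of the
spherical evolution map says that `G l` spans `L` and that `G' = G ∘ (l ∧ m)` for a curve `m` in `E`
(`exists_isEvolution`). In the moving frame `G` the surface is the fixed curve `C`, and everything
is a statement about the two curves `C` and `m`.

The hypotheses on `f` become non-degeneracy of this pair: `m v, m' v` restrict to a basis of
functionals on each plane `C u` (`eq_zero_of_orthogonal`), and there is a frame `h₁, h₂` of `C` dual
to `m v₀, m' v₀` with `h₂' = k`, `h₁' = -φ k`, where `k` is a spacelike normal of `C` and `φ' ≠ 0`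
(`exists_adaptedFrame`).

*Sufficiency.* If `ξ` is a gauge potential of `C` and for every `v` there is a section `p` of `C`
with `p' = -ξ m(v)`, then `ξ + (l ∧ p) dv`, read in the frame `G`, is a gauge potential of `f`
(`isLieApplicable_of_potential`). If `C` is constrained elastic with respect to `W₀` and `L` stays
in `L₀ ⊕ W₀`, then `m` stays in `W₀` (`m_mem_of_line_le`), and the top coefficients of the linear
conserved quantities supply `p`. If the `v`-lines are spherical, then by Joachimsthal's theorem
(`m_apply_k_eq_zero_of_spherical`) `k` is orthogonal to all `m v`, and `ξ = -(h₂ ∧ k) du` works with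
`p = (h₂, m) h₂`.

*Necessity.* Read in the frame `G`, a gauge potential of `f` has only a few non-zero coefficients,
and closedness is a system of differential equations for them (`exists_potentialCoefficients`). This
system can be integrated in the direction `v`: it provides functions `ρ, κ` of `u` alone and a curve
`D` in `E` such that all vectors `D' - κ h₂` are orthogonal to `M = span {m v}`
(`exists_curveData`). These vectors cannot stay in a line, so `dim M ≤ 3`
(`finrank_span_le_three`). If `dim M = 2`, then `k ⊥ M`, so `G` fixes `k` and the sphere congruence
determined by `k` makes the `v`-lines spherical. If `dim M = 3`, then
`ξ = (ρ h₂ ∧ k + κ h₁ ∧ h₂) du` and the conserved quantities built from `D` show that `C` is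
constrained elastic with respect to `W₀ = M`, while `L` stays in `L₀ ⊕ M`.
-/

namespace LieSphere

noncomputable section

/-! ### The Lie form -/

theorem lieForm_comm (x y : R42) : lieForm x y = lieForm y x := by
  simp only [lieForm_apply]; ring

theorem lieForm_isSymm : lieForm.IsSymm := ⟨fun x y => by simpa using lieForm_comm x y⟩

theorem lieForm_nondegenerate : lieForm.Nondegenerate := by
  rw [lieForm]
  refine LinearMap.BilinForm.nondegenerate_toBilin'_of_det_ne_zero' _ ?_
  rw [Matrix.det_diagonal]
  simp [Fin.prod_univ_succ]

/-- The signature is used only through this fact: a subspace on which the form is negative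
semidefinite has dimension at most two, as it meets the positive definite coordinate subspace of
dimension four trivially. -/
theorem finrank_le_two_of_nonpos (S : Submodule ℝ R42) (hS : ∀ x ∈ S, lieForm x x ≤ 0) :
    Module.finrank ℝ S ≤ 2 := by
  let T : S →ₗ[ℝ] (Fin 2 → ℝ) := LinearMap.pi ![(LinearMap.proj 4).comp S.subtype,
    (LinearMap.proj 5).comp S.subtype]
  have hT : Function.Injective T := by
    rw [← LinearMap.ker_eq_bot, LinearMap.ker_eq_bot']
    rintro ⟨x, hx⟩ h
    have h4 : x 4 = 0 := by simpa [T] using congrFun h 0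
    have h5 : x 5 = 0 := by simpa [T] using congrFun h 1
    have := hS x hx
    rw [lieForm_apply, h4, h5] at this
    have e0 : x 0 = 0 := by
      nlinarith [sq_nonneg (x 0), sq_nonneg (x 1), sq_nonneg (x 2), sq_nonneg (x 3)]
    have e1 : x 1 = 0 := by
      nlinarith [sq_nonneg (x 0), sq_nonneg (x 1), sq_nonneg (x 2), sq_nonneg (x 3)]
    have e2 : x 2 = 0 := by
      nlinarith [sq_nonneg (x 0), sq_nonneg (x 1), sq_nonneg (x 2), sq_nonneg (x 3)]
    have e3 : x 3 = 0 := by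
      nlinarith [sq_nonneg (x 0), sq_nonneg (x 1), sq_nonneg (x 2), sq_nonneg (x 3)]
    ext i
    fin_cases i <;> simp [*]
  simpa using LinearMap.finrank_le_finrank_of_injective hT

/-- A vector orthogonal to a null plane but not contained in it is spacelike. -/
theorem lieForm_self_pos_of_orthogonal (S : Submodule ℝ R42) (hr : Module.finrank ℝ S = 2)
    (hS : ∀ a ∈ S, ∀ b ∈ S, lieForm a b = 0) (x : R42) (hx : ∀ a ∈ S, lieForm a x = 0)
    (hxS : x ∉ S) : 0 < lieForm x x := by
  by_contra! hneg
  have hle := finrank_le_two_of_nonpos (S ⊔ Submodule.span ℝ {x}) (by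
    intro y hy
    obtain ⟨a, ha, b, hb, rfl⟩ := Submodule.mem_sup.1 hy
    obtain ⟨t, rfl⟩ := Submodule.mem_span_singleton.1 hb
    have h1 := hS a ha a ha
    have h2 := hx a ha
    have h3 : lieForm x a = 0 := by rw [lieForm_comm, h2]
    simp only [map_add, map_smul, LinearMap.add_apply, LinearMap.smul_apply, h1, h2, h3,
      smul_eq_mul]
    nlinarith [mul_self_nonneg t])
  have hlt : S < S ⊔ Submodule.span ℝ {x} := by
    refine lt_of_le_of_ne le_sup_left fun h => hxS ?_
    rw [h]
    exact Submodule.mem_sup_right (Submodule.mem_span_singleton_self x)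
  have := Submodule.finrank_lt_finrank_of_lt hlt
  omega

/-- The Lie form as a continuous bilinear map. -/
def lieCLM : R42 →L[ℝ] R42 →L[ℝ] ℝ := LinearMap.toContinuousBilinearMap lieForm

theorem lieCLM_apply (x y : R42) : lieCLM x y = lieForm x y := rfl

theorem _root_.HasDerivAt.lieForm {x y : ℝ → R42} {x' y' : R42} {t : ℝ} (hx : HasDerivAt x x' t)
    (hy : HasDerivAt y y' t) :
    HasDerivAt (fun s => LieSphere.lieForm (x s) (y s))
      (LieSphere.lieForm x' (y t) + LieSphere.lieForm (x t) y') t := by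
  have h := lieCLM.hasDerivAt_of_bilinear (fun _ => hx) (fun _ => hy)
  simp only [lieCLM_apply] at h
  rwa [add_comm] at h

section Smooth

variable {E : Type*} [NormedAddCommGroup E] [NormedSpace ℝ E]

theorem _root_.ContDiffAt.lieForm {x y : E → R42} {p : E} (hx : ContDiffAt ℝ ∞ x p)
    (hy : ContDiffAt ℝ ∞ y p) : ContDiffAt ℝ ∞ (fun s => LieSphere.lieForm (x s) (y s)) p := by
  have := (lieCLM.contDiff.contDiffAt.comp p hx).clm_apply hy
  exact this

theorem _root_.ContDiffOn.lieForm {x y : E → R42} {s : Set E} (hx : ContDiffOn ℝ ∞ x s)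
    (hy : ContDiffOn ℝ ∞ y s) : ContDiffOn ℝ ∞ (fun s => LieSphere.lieForm (x s) (y s)) s := by
  have := (lieCLM.contDiff.comp_contDiffOn hx).clm_apply hy
  exact this

variable {F : Type*} [NormedAddCommGroup F] [NormedSpace ℝ F]

theorem _root_.ContDiffOn.hasDerivAt {s : Set ℝ} {g : ℝ → F} (hg : ContDiffOn ℝ ∞ g s)
    (hs : IsOpen s) {t : ℝ} (ht : t ∈ s) : HasDerivAt g (deriv g t) t :=
  ((hg.contDiffAt (hs.mem_nhds ht)).differentiableAt (by simp)).hasDerivAt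

theorem contDiffOn_deriv {s : Set ℝ} {g : ℝ → F} (hg : ContDiffOn ℝ ∞ g s)
    (hs : IsOpen s) : ContDiffOn ℝ ∞ (deriv g) s :=
  hg.deriv_of_isOpen hs (by simp)

/-- A solution of a homogeneous linear differential equation that vanishes at one point of an
interval vanishes. -/
theorem eq_zero_of_linear_ode {I : Set ℝ} (hI : IsOpen I) (hI' : I.OrdConnected)
    {K : ℝ → F →L[ℝ] F} (hK : ContinuousOn K I) {y : ℝ → F}
    (hy : ∀ t ∈ I, HasDerivAt y (K t (y t)) t) {t₀ : ℝ} (ht₀ : t₀ ∈ I) (h0 : y t₀ = 0) :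
    ∀ t ∈ I, y t = 0 := by
  intro t ht
  obtain ⟨a, b, haI, hbI, h1, h2, h3, h4⟩ :
      ∃ a b, a ∈ I ∧ b ∈ I ∧ a < t₀ ∧ t₀ < b ∧ a < t ∧ t < b := by
    have hmin : min t₀ t ∈ I := by rcases min_choice t₀ t with h | h <;> rw [h] <;> assumption
    have hmax : max t₀ t ∈ I := by rcases max_choice t₀ t with h | h <;> rw [h] <;> assumption
    obtain ⟨a, ha, haI⟩ := (mem_nhdsLT_iff_exists_Ioo_subset.1
      (mem_nhdsWithin_of_mem_nhds (hI.mem_nhds hmin)) : _)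
    obtain ⟨b, hb, hbI⟩ := (mem_nhdsGT_iff_exists_Ioo_subset.1
      (mem_nhdsWithin_of_mem_nhds (hI.mem_nhds hmax)) : _)
    obtain ⟨a', ha'⟩ := exists_between (show a < _ from ha)
    obtain ⟨b', hb'⟩ := exists_between (show _ < b from hb)
    exact ⟨a', b', haI ⟨ha'.1, ha'.2⟩, hbI ⟨hb'.1, hb'.2⟩, (lt_min_iff.1 ha'.2).1,
      (max_lt_iff.1 hb'.1).1, (lt_min_iff.1 ha'.2).2, (max_lt_iff.1 hb'.1).2⟩
  have hsub : Set.Icc a b ⊆ I := hI'.out haI hbI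
  obtain ⟨c, hc⟩ := isCompact_Icc.exists_bound_of_continuousOn (hK.mono hsub)
  have key := ODE_solution_unique_of_mem_Ioo (v := fun s z => K s z) (s := fun _ => Set.univ)
    (K := c.toNNReal) (f := y) (g := fun _ => 0) (a := a) (b := b) (t₀ := t₀)
    (fun s hs => by
      have hle : ‖K s‖₊ ≤ c.toNNReal := by
        rw [← NNReal.coe_le_coe, coe_nnnorm]
        exact (hc s ⟨hs.1.le, hs.2.le⟩).trans (Real.le_coe_toNNReal c)
      exact ((K s).lipschitz.weaken hle).lipschitzOnWith)
    ⟨h1, h2⟩ (fun s hs => ⟨hy s (hsub ⟨hs.1.le, hs.2.le⟩), trivial⟩)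
    (fun s _ => ⟨by simpa using hasDerivAt_const s (0 : F), trivial⟩) h0
  exact key ⟨h3, h4⟩

theorem constant_of_hasDerivAt_zero {I : Set ℝ} (hI : IsOpen I) (hI' : I.OrdConnected) {y : ℝ → F}
    (hy : ∀ t ∈ I, HasDerivAt y 0 t) {s t : ℝ} (hs : s ∈ I) (ht : t ∈ I) : y s = y t :=
  hI.is_const_of_deriv_eq_zero hI'.isPreconnected
    (fun t ht => (hy t ht).differentiableAt.differentiableWithinAt) (fun t ht => (hy t ht).deriv)
    hs ht

/-! ### Functions of two variables -/

theorem hasDerivAt_fst_slice {σ : ℝ × ℝ → F} {u v : ℝ} (h : DifferentiableAt ℝ σ (u, v)) :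
    HasDerivAt (fun s => σ (s, v)) (fderiv ℝ σ (u, v) (1, 0)) u := by
  have h1 : HasDerivAt (fun s : ℝ => (s, v)) ((1 : ℝ), (0 : ℝ)) u :=
    (hasDerivAt_id u).prodMk (hasDerivAt_const u v)
  exact h.hasFDerivAt.comp_hasDerivAt u h1

theorem hasDerivAt_snd_slice {σ : ℝ × ℝ → F} {u v : ℝ} (h : DifferentiableAt ℝ σ (u, v)) :
    HasDerivAt (fun s => σ (u, s)) (fderiv ℝ σ (u, v) (0, 1)) v := by
  have h1 : HasDerivAt (fun s : ℝ => (u, s)) ((0 : ℝ), (1 : ℝ)) v :=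
    (hasDerivAt_const v u).prodMk (hasDerivAt_id v)
  exact h.hasFDerivAt.comp_hasDerivAt v h1

theorem clm_prod_apply (T : ℝ × ℝ →L[ℝ] F) (X : ℝ × ℝ) :
    T X = X.1 • T (1, 0) + X.2 • T (0, 1) := by
  rw [← map_smul, ← map_smul, ← map_add]
  congr 1
  ext <;> simp

theorem eventually_fst_slice {P : ℝ × ℝ → Prop} {u v : ℝ} (h : ∀ᶠ y in 𝓝 (u, v), P y) :
    ∀ᶠ s in 𝓝 u, P (s, v) :=
  (Continuous.tendsto (by fun_prop : Continuous fun s : ℝ => (s, v)) u).eventually h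

theorem eventually_snd_slice {P : ℝ × ℝ → Prop} {u v : ℝ} (h : ∀ᶠ y in 𝓝 (u, v), P y) :
    ∀ᶠ s in 𝓝 v, P (u, s) :=
  (Continuous.tendsto (by fun_prop : Continuous fun s : ℝ => (u, s)) v).eventually h

/-- The mixed partial derivatives of a smooth function agree. -/
theorem fderiv_fderiv_comm {g : ℝ × ℝ → F} {s : Set (ℝ × ℝ)} (hs : IsOpen s)
    (hg : ContDiffOn ℝ ∞ g s) {x : ℝ × ℝ} (hx : x ∈ s) (X Y : ℝ × ℝ) :
    fderiv ℝ (fun y => fderiv ℝ g y X) x Y = fderiv ℝ (fun y => fderiv ℝ g y Y) x X := by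
  have hgx := hg.contDiffAt (hs.mem_nhds hx)
  have hd : DifferentiableAt ℝ (fderiv ℝ g) x :=
    (hgx.fderiv_right (m := ∞) (by simp)).differentiableAt (by simp)
  have hX : ∀ Z : ℝ × ℝ, ∀ W,
      fderiv ℝ (fun y => fderiv ℝ g y Z) x W = fderiv ℝ (fderiv ℝ g) x W Z := by
    intro Z W
    have := (hd.hasFDerivAt.clm_apply (hasFDerivAt_const Z x)).fderiv
    rw [this]; simp
  rw [hX, hX]
  exact (hgx.isSymmSndFDerivAt (by
    rw [minSmoothness_of_isRCLikeNormedField]; exact WithTop.coe_le_coe.2 le_top)).eq Y X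

end Smooth

/-! ### Skew endomorphisms -/

theorem wedge_skew {V : Type*} [NormedAddCommGroup V] [NormedSpace ℝ V] [FiniteDimensional ℝ V]
    {B : LinearMap.BilinForm ℝ V} (hB : ∀ x y, B x y = B y x) (a b x y : V) :
    B (wedge B a b x) y = - B x (wedge B a b y) := by
  simp only [wedge_apply, map_sub, map_smul, LinearMap.sub_apply, LinearMap.smul_apply,
    smul_eq_mul, hB x]
  ring

section WedgeSpace

variable {V : Type*} [NormedAddCommGroup V] [NormedSpace ℝ V] [FiniteDimensional ℝ V]
  {B : LinearMap.BilinForm ℝ V} {P : Submodule ℝ V} {T : V →L[ℝ] V}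

theorem skew_of_mem_wedgeSpace (hB : ∀ x y, B x y = B y x) {Q : Submodule ℝ V}
    (hT : T ∈ wedgeSpace B P Q) (x y : V) : B (T x) y = - B x (T y) := by
  induction hT using Submodule.span_induction with
  | mem T h => obtain ⟨a, -, b, -, rfl⟩ := h; exact wedge_skew hB a b x y
  | zero => simp
  | add S T _ _ hS hT => simp [hS, hT]; ring
  | smul c T _ hT => simp [hT]

theorem apply_eq_zero_of_mem_wedgeSpace (hB : ∀ x y, B x y = B y x)
    (hP : ∀ a ∈ P, ∀ b ∈ P, B a b = 0) (hT : T ∈ wedgeSpace B P (B.orthogonal P)) {x : V}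
    (hx : x ∈ P) : T x = 0 := by
  induction hT using Submodule.span_induction with
  | mem T h =>
    obtain ⟨a, ha, b, hb, rfl⟩ := h
    rw [wedge_apply, hP a ha x hx, hB b x, hb x hx]; simp
  | zero => simp
  | add S T _ _ hS hT => simp [hS, hT]
  | smul c T _ hT => simp [hT]

theorem apply_mem_of_mem_wedgeSpace (hT : T ∈ wedgeSpace B P (B.orthogonal P)) {x : V}
    (hx : x ∈ B.orthogonal P) : T x ∈ P := by
  induction hT using Submodule.span_induction with
  | mem T h =>
    obtain ⟨a, ha, b, hb, rfl⟩ := h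
    rw [wedge_apply, hx a ha, zero_smul, zero_sub]
    exact P.neg_mem (P.smul_mem _ ha)
  | zero => simp
  | add S T _ _ hS hT => exact P.add_mem hS hT
  | smul c T _ hT => exact P.smul_mem _ hT

end WedgeSpace

/-- The trace of an endomorphism of a plane, computed in a frame with dual functionals. -/
theorem trace_eq_of_dual {V : Type*} [AddCommGroup V] [Module ℝ V] {P : Submodule ℝ V} {a b : V}
    (ha : a ∈ P) (hb : b ∈ P) (hP : ∀ x ∈ P, ∃ s t : ℝ, x = s • a + t • b) (α β : V →ₗ[ℝ] ℝ)
    (haa : α a = 1) (hab : α b = 0) (hba : β a = 0) (hbb : β b = 1) (T : P →ₗ[ℝ] P) :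
    LinearMap.trace ℝ P T = α (T ⟨a, ha⟩) + β (T ⟨b, hb⟩) := by
  have hli : LinearIndependent ℝ ![(⟨a, ha⟩ : P), ⟨b, hb⟩] := by
    rw [LinearIndependent.pair_iff]
    intro s t h
    have h' : s • a + t • b = 0 := congrArg Subtype.val h
    have h1 := congrArg α h'
    have h2 := congrArg β h'
    simp [haa, hab, hba, hbb] at h1 h2
    exact ⟨h1, h2⟩
  have hsp : ⊤ ≤ Submodule.span ℝ (Set.range ![(⟨a, ha⟩ : P), ⟨b, hb⟩]) := by
    rintro ⟨x, hx⟩ -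
    obtain ⟨s, t, rfl⟩ := hP x hx
    have : (⟨s • a + t • b, hx⟩ : P) = s • ⟨a, ha⟩ + t • ⟨b, hb⟩ := rfl
    rw [this]
    exact Submodule.add_mem _ (Submodule.smul_mem _ _ (Submodule.subset_span ⟨0, rfl⟩))
      (Submodule.smul_mem _ _ (Submodule.subset_span ⟨1, rfl⟩))
  let e := Module.Basis.mk hli hsp
  have he0 : e 0 = ⟨a, ha⟩ := by simp [e]
  have he1 : e 1 = ⟨b, hb⟩ := by simp [e]
  have hx : ∀ x : P, e.repr x 0 = α x ∧ e.repr x 1 = β x := by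
    intro x
    have h : (x : V) = e.repr x 0 • a + e.repr x 1 • b := by
      have := congrArg Subtype.val (e.sum_repr x)
      rw [Fin.sum_univ_two, he0, he1] at this
      exact this.symm
    constructor
    · conv_rhs => rw [h]
      simp [haa, hab]
    · conv_rhs => rw [h]
      simp [hba, hbb]
  rw [LinearMap.trace_eq_matrix_trace ℝ e, Matrix.trace_fin_two, LinearMap.toMatrix_apply,
    LinearMap.toMatrix_apply, he0, he1, (hx _).1, (hx _).2]

/-! ### The spherical evolution map -/

theorem orthProj_span_singleton {l : R42} (hl : lieForm l l ≠ 0) (x : R42) :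
    orthProj lieForm (Submodule.span ℝ {l}) x = (lieForm l x / lieForm l l) • l := by
  have h : IsCompl (Submodule.span ℝ {l}) (lieForm.orthogonal (Submodule.span ℝ {l})) :=
    LinearMap.BilinForm.isCompl_span_singleton_orthogonal hl
  rw [orthProj, dif_pos h]
  have hx : x = (lieForm l x / lieForm l l) • l + (x - (lieForm l x / lieForm l l) • l) := by abel
  have h1 : x - (lieForm l x / lieForm l l) • l ∈
      lieForm.orthogonal (Submodule.span ℝ {l}) := by
    intro n hn
    obtain ⟨t, rfl⟩ := Submodule.mem_span_singleton.1 hn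
    simp [hl]
  conv_lhs => rw [hx]
  rw [map_add, Submodule.projection_apply_of_mem_left _
    (Submodule.smul_mem _ _ (Submodule.mem_span_singleton_self l)),
    (Submodule.projection_apply_eq_zero_iff _).2 h1, add_zero]

/-- The data to which a spherical evolution map reduces. With `G v = A(v)⁻¹`, the unit section
`G l` of `L` has derivative `G m`, and `G' = G ∘ (l ∧ m)`; here `E = l^⊥`. -/
structure IsEvolution (I : Set ℝ) (v₀ : ℝ) (E : Submodule ℝ R42) (l : R42)
    (G : ℝ → R42 ≃L[ℝ] R42) (m : ℝ → E) : Prop where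
  isOpen : IsOpen I
  ordConnected : I.OrdConnected
  base_mem : v₀ ∈ I
  unit : lieForm l l = 1
  mem_iff : ∀ x, x ∈ E ↔ lieForm l x = 0
  smooth : ContDiffOn ℝ ∞ (fun v => (G v : R42 →L[ℝ] R42)) I
  smooth_symm : ContDiffOn ℝ ∞ (fun v => ((G v).symm : R42 →L[ℝ] R42)) I
  orthogonal : ∀ v ∈ I, ∀ a b, lieForm (G v a) (G v b) = lieForm a b
  base : G v₀ = ContinuousLinearEquiv.refl ℝ R42
  smooth_m : ContDiffOn ℝ ∞ m I
  hasDerivAt : ∀ v ∈ I, ∀ x : R42,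
    HasDerivAt (fun w => G w x) (G v (lieForm l x • (m v : R42) - lieForm (m v : R42) x • l)) v

theorem exists_local_section {I : Set ℝ} {L : ℝ → Submodule ℝ R42} (hL : IsSpacelikeLineCurve I L)
    {v : ℝ} (hv : v ∈ I) (hI : IsOpen I) : ∃ s : ℝ → R42, ∀ᶠ w in 𝓝 v,
      ContDiffAt ℝ ∞ s w ∧ L w = Submodule.span ℝ {s w} ∧ 0 < lieForm (s w) (s w) := by
  obtain ⟨s, hs⟩ := hL.1 v hv
  refine ⟨s 0, ?_⟩
  filter_upwards [hs, hI.mem_nhds hv] with w hw hwI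
  have hspan : L w = Submodule.span ℝ {s 0 w} := by
    rw [hw.2.2]; congr 1; ext x; simp [eq_comm]
  refine ⟨hw.1 0, hspan, hL.2 w hwI _ ?_ (hw.2.1.ne_zero 0)⟩
  rw [hspan]
  exact Submodule.mem_span_singleton_self _

/-- The orthogonal projection onto `L v`, as a continuous linear map. -/
def lineProj (L : ℝ → Submodule ℝ R42) (v : ℝ) : R42 →L[ℝ] R42 :=
  LinearMap.toContinuousLinearMap (orthProj lieForm (L v))

theorem lineProj_apply (L : ℝ → Submodule ℝ R42) (v : ℝ) (x : R42) :
    lineProj L v x = orthProj lieForm (L v) x := rfl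

theorem contDiffOn_lineProj {I : Set ℝ} {L : ℝ → Submodule ℝ R42} (hL : IsSpacelikeLineCurve I L)
    (hI : IsOpen I) : ContDiffOn ℝ ∞ (lineProj L) I := by
  intro v hv
  obtain ⟨s, hs⟩ := exists_local_section hL hv hI
  have hs0 := hs.self_of_nhds
  have h1 : ContDiffAt ℝ ∞ (fun w => ContinuousLinearMap.smulRightL ℝ R42 R42 (lieCLM (s w))
      ((lieForm (s w) (s w))⁻¹ • s w)) v := by
    refine ContDiffAt.clm_apply ?_ (((hs0.1.lieForm hs0.1).inv hs0.2.2.ne').smul hs0.1)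
    exact ContDiffAt.continuousLinearMap_comp _ (ContDiffAt.continuousLinearMap_comp _ hs0.1)
  refine (h1.congr_of_eventuallyEq ?_).contDiffWithinAt
  filter_upwards [hs] with w hw
  ext1 x
  rw [lineProj_apply, hw.2.1, orthProj_span_singleton hw.2.2.ne']
  simp [ContinuousLinearMap.smulRightL, lieCLM_apply, smul_smul, div_eq_mul_inv, mul_comm]

/-- The connection `𝒟^L` is trivialised by `A`, so `A⁻¹` maps `L v₀` to `L`: the component `y` of
`A⁻¹ l` orthogonal to `L` satisfies `y' = -π' y` for the projection `π` onto `L`. -/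
theorem symm_apply_mem {I : Set ℝ} (hI : IsOpen I) (hI' : I.OrdConnected) {v₀ : ℝ} (hv₀ : v₀ ∈ I)
    {L : ℝ → Submodule ℝ R42} (hL : IsSpacelikeLineCurve I L) {A : ℝ → R42 ≃L[ℝ] R42}
    (hA : IsSphericalEvolutionMap lieForm I L v₀ A)
    (hG : ContDiffOn ℝ ∞ (fun v => ((A v).symm : R42 →L[ℝ] R42)) I) {l : R42} (hl : l ∈ L v₀) :
    ∀ v ∈ I, (A v).symm l ∈ L v := by
  have hπ := contDiffOn_lineProj hL hI
  have hproj : ∀ v ∈ I, ∀ x, lineProj L v x ∈ L v ∧ (x ∈ L v → lineProj L v x = x) := by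
    intro v hv x
    obtain ⟨s, hs⟩ := exists_local_section hL hv hI
    obtain ⟨-, h1, h2⟩ := hs.self_of_nhds
    rw [lineProj_apply, h1, orthProj_span_singleton h2.ne']
    refine ⟨Submodule.smul_mem _ _ (Submodule.mem_span_singleton_self _), fun hx => ?_⟩
    obtain ⟨t, rfl⟩ := Submodule.mem_span_singleton.1 hx
    simp [h2.ne']
  set σ : ℝ → R42 := fun w => (A w).symm l with hσ
  have hσs : ContDiffOn ℝ ∞ σ I := hG.clm_apply contDiffOn_const
  have hπσ : ContDiffOn ℝ ∞ (fun w => lineProj L w (σ w)) I := hπ.clm_apply hσs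
  have hy : ContDiffOn ℝ ∞ (fun w => σ w - lineProj L w (σ w)) I := hσs.sub hπσ
  have hode : ∀ v ∈ I, HasDerivAt (fun w => σ w - lineProj L w (σ w))
      ((-deriv (lineProj L) v) (σ v - lineProj L v (σ v))) v := by
    intro v hv
    have hd := hy.hasDerivAt hI hv
    set y' := deriv (fun w => σ w - lineProj L w (σ w)) v
    have h0 : splitConnection lieForm L σ v = 0 := by
      have h := hA.trivialises σ hσs v hv
      have hc : (fun w => A w (σ w)) = fun _ => l := by
        funext w; exact (A w).apply_symm_apply l
      rw [hc, deriv_const] at h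
      exact (A v).map_eq_zero_iff.1 h.symm
    have h0' : lineProj L v (deriv (fun w => lineProj L w (σ w)) v) +
        (y' - lineProj L v y') = 0 := h0
    have h1 : y' = lineProj L v y' := by
      have := congrArg (lineProj L v) h0'
      rw [map_add, map_sub, (hproj v hv _).2 (hproj v hv y').1, sub_self, add_zero, map_zero,
        (hproj v hv _).2 (hproj v hv _).1] at this
      rw [this, zero_add] at h0'
      exact sub_eq_zero.1 h0'
    have h2 := (hπ.hasDerivAt hI hv).clm_apply hd
    have h3 : (fun w => lineProj L w (σ w - lineProj L w (σ w))) =ᶠ[𝓝 v] fun _ => 0 := by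
      filter_upwards [hI.mem_nhds hv] with w hw
      rw [map_sub, (hproj w hw _).2 (hproj w hw _).1, sub_self]
    have h4 := (h2.congr_of_eventuallyEq h3.symm).unique (hasDerivAt_const v 0)
    have h5 : (-deriv (lineProj L) v) (σ v - lineProj L v (σ v)) = y' := by
      rw [h1, neg_apply]
      exact (eq_neg_of_add_eq_zero_right h4).symm
    rw [h5]
    exact hd
  intro v hv
  have := eq_zero_of_linear_ode hI hI' (contDiffOn_deriv hπ hI).continuousOn.neg hode hv₀ (by
    have : σ v₀ = l := by simp [hσ, hA.base]
    change σ v₀ - lineProj L v₀ (σ v₀) = 0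
    rw [this, (hproj v₀ hv₀ l).2 hl, sub_self]) v hv
  rw [show (A v).symm l = lineProj L v (σ v) from sub_eq_zero.1 this]
  exact (hproj v hv _).1

/-- A spherical evolution map has the form `G⁻¹` for an evolution `G` along a unit section of
`L`. -/
theorem exists_isEvolution {I : Set ℝ} (hI : IsOpen I) (hI' : I.OrdConnected) {v₀ : ℝ}
    (hv₀ : v₀ ∈ I) {L : ℝ → Submodule ℝ R42} (hL : IsSpacelikeLineCurve I L)
    {A : ℝ → R42 ≃L[ℝ] R42} (hA : IsSphericalEvolutionMap lieForm I L v₀ A) :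
    ∃ (l : R42) (m : ℝ → lieForm.orthogonal (L v₀)),
      IsEvolution I v₀ (lieForm.orthogonal (L v₀)) l (fun v => (A v).symm) m ∧
      ∀ v ∈ I, L v = Submodule.span ℝ {(A v).symm l} := by
  have hG : ContDiffOn ℝ ∞ (fun v => ((A v).symm : R42 →L[ℝ] R42)) I := by
    intro v hv
    have h := (contDiffAt_map_inverse (n := ∞) (A v)).comp_contDiffWithinAt
      (f := fun w => (A w : R42 →L[ℝ] R42)) v (hA.smooth v hv)
    exact h.congr (fun w _ => (ContinuousLinearMap.inverse_equiv (A w)).symm)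
      (ContinuousLinearMap.inverse_equiv (A v)).symm
  have hGo : ∀ v ∈ I, ∀ a b, lieForm ((A v).symm a) ((A v).symm b) = lieForm a b := by
    intro v hv a b
    rw [← hA.orthogonal v hv, (A v).apply_symm_apply, (A v).apply_symm_apply]
  obtain ⟨s, hs⟩ := exists_local_section hL hv₀ hI
  obtain ⟨-, hs1, hs2⟩ := hs.self_of_nhds
  obtain ⟨l, hll, hlL⟩ : ∃ l, lieForm l l = 1 ∧ l ∈ L v₀ := by
    obtain ⟨r, hr0, hr⟩ : ∃ r : ℝ, r ≠ 0 ∧ r * r = lieForm (s v₀) (s v₀) :=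
      ⟨_, (Real.sqrt_pos.2 hs2).ne', Real.mul_self_sqrt hs2.le⟩
    refine ⟨r⁻¹ • s v₀, ?_, ?_⟩
    · rw [map_smul, map_smul, LinearMap.smul_apply, smul_eq_mul, smul_eq_mul, ← hr]
      field_simp
    · rw [hs1]; exact Submodule.smul_mem _ _ (Submodule.mem_span_singleton_self _)
  have hmem := symm_apply_mem hI hI' hv₀ hL hA hG hlL
  have hspan : ∀ v ∈ I, L v = Submodule.span ℝ {(A v).symm l} := by
    intro v hv
    obtain ⟨t, ht⟩ := exists_local_section hL hv hI
    obtain ⟨-, ht1, -⟩ := ht.self_of_nhds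
    have h1 := hmem v hv
    rw [ht1] at h1 ⊢
    obtain ⟨c, hc⟩ := Submodule.mem_span_singleton.1 h1
    rw [← hc]
    refine (Submodule.span_singleton_smul_eq (IsUnit.mk0 c ?_) _).symm
    rintro rfl
    have h2 := hGo v hv l l
    rw [← hc, hll] at h2
    simp at h2
  set ℓ : ℝ → R42 := fun w => (A w).symm l with hℓ
  have hℓs : ContDiffOn ℝ ∞ ℓ I := hG.clm_apply contDiffOn_const
  have hℓℓ : ∀ v ∈ I, lieForm (ℓ v) (ℓ v) = 1 := fun v hv => (hGo v hv l l).trans hll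
  have hℓ' : ∀ v ∈ I, lieForm (ℓ v) (deriv ℓ v) = 0 := by
    intro v hv
    have hd := hℓs.hasDerivAt hI hv
    have h := ((hd.lieForm hd).congr_of_eventuallyEq (f₁ := fun _ => (1 : ℝ)) (by
      filter_upwards [hI.mem_nhds hv] with w hw using (hℓℓ w hw).symm)).unique
      (hasDerivAt_const v 1)
    rw [lieForm_comm (deriv ℓ v)] at h
    linarith
  have hE : ∀ x, x ∈ lieForm.orthogonal (L v₀) ↔ lieForm l x = 0 := by
    intro x
    refine ⟨fun h => h l hlL, fun h n hn => ?_⟩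
    have := hspan v₀ hv₀
    rw [hA.base] at this
    rw [this] at hn
    obtain ⟨t, rfl⟩ := Submodule.mem_span_singleton.1 hn
    simp only [ContinuousLinearEquiv.refl_symm, ContinuousLinearEquiv.refl_apply]
    change lieForm (t • l) x = 0
    rw [map_smul, LinearMap.smul_apply, h, smul_zero]
  let P : R42 →L[ℝ] lieForm.orthogonal (L v₀) := LinearMap.toContinuousLinearMap
    ((LinearMap.id - (lieForm l).smulRight l).codRestrict _ (fun x => by
      rw [hE]; simp [hll]))
  have hP : ∀ x ∈ lieForm.orthogonal (L v₀), (P x : R42) = x := by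
    intro x hx
    have : (P x : R42) = x - lieForm l x • l := rfl
    rw [this, (hE x).1 hx, zero_smul, sub_zero]
  let m : ℝ → lieForm.orthogonal (L v₀) := fun v => P (A v (deriv ℓ v))
  have hm : ∀ v ∈ I, (m v : R42) = A v (deriv ℓ v) := by
    intro v hv
    refine hP _ ((hE _).2 ?_)
    rw [← hGo v hv, (A v).symm_apply_apply]
    exact hℓ' v hv
  refine ⟨l, m, ⟨hI, hI', hv₀, hll, hE, hG, hA.smooth, hGo, by rw [hA.base]; rfl, ?_, ?_⟩, hspan⟩
  · exact P.contDiff.comp_contDiffOn (hA.smooth.clm_apply (contDiffOn_deriv hℓs hI))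
  · intro v hv x
    have hoP : ∀ w ∈ I, ∀ y, orthProj lieForm (L w) y = lieForm (ℓ w) y • ℓ w := by
      intro w hw y
      rw [hspan w hw, orthProj_span_singleton (by rw [hGo w hw, hll]; exact one_ne_zero)]
      rw [show lieForm ((A w).symm l) ((A w).symm l) = 1 from hℓℓ w hw, div_one]
    have hd := hℓs.hasDerivAt hI hv
    -- the connection `𝒟^L` on a constant section
    have hsplit : ∀ y, splitConnection lieForm L (fun _ => y) v =
        lieForm (deriv ℓ v) y • ℓ v - lieForm (ℓ v) y • deriv ℓ v := by
      intro y
      have h1 : HasDerivAt (fun w => orthProj lieForm (L w) y)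
          (lieForm (ℓ v) y • deriv ℓ v + lieForm (deriv ℓ v) y • ℓ v) v := by
        have h2 := (hd.lieForm (hasDerivAt_const v y)).smul hd
        rw [map_zero, add_zero] at h2
        exact h2.congr_of_eventuallyEq (by
          filter_upwards [hI.mem_nhds hv] with w hw using hoP w hw y)
      have h2 := ((hasDerivAt_const v y).sub h1).deriv
      rw [splitConnection, h1.deriv]
      rw [show deriv (fun w => y - orthProj lieForm (L w) y) v = _ from h2]
      rw [hoP v hv, hoP v hv]
      simp only [map_add, map_smul, zero_sub, map_neg, hℓ' v hv, hℓℓ v hv, smul_eq_mul]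
      module
    have hAd := hA.smooth.hasDerivAt hI hv
    have hA' : ∀ y, deriv (fun w => (A w : R42 →L[ℝ] R42)) v y =
        A v (lieForm (deriv ℓ v) y • ℓ v - lieForm (ℓ v) y • deriv ℓ v) := by
      intro y
      have h1 := hA.trivialises (fun _ => y) contDiffOn_const v hv
      have h2 := (hAd.clm_apply (hasDerivAt_const v y)).deriv
      rw [map_zero, add_zero] at h2
      rw [← hsplit, ← h1]
      exact h2.symm
    have hgx : HasDerivAt (fun w => (A w).symm x) _ v :=
      (hG.clm_apply (contDiffOn_const (c := x))).hasDerivAt hI hv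
    set g := deriv (fun w => ((A w).symm : R42 →L[ℝ] R42) x) v
    have h5 := ((hAd.clm_apply hgx).congr_of_eventuallyEq (f₁ := fun _ => x) (by
      filter_upwards with w using ((A w).apply_symm_apply x).symm)).unique (hasDerivAt_const v x)
    rw [hA'] at h5
    change A v _ + A v g = 0 at h5
    rw [← map_add, (A v).map_eq_zero_iff] at h5
    convert hgx using 1
    rw [eq_neg_of_add_eq_zero_right h5, map_sub, map_smul, map_smul, hm v hv,
      (A v).symm_apply_apply, show lieForm (ℓ v) ((A v).symm x) = lieForm l x from hGo v hv l x]
    rw [show lieForm (deriv ℓ v) ((A v).symm x) = lieForm (A v (deriv ℓ v)) x by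
      rw [← hGo v hv (A v _), (A v).symm_apply_apply]]
    rw [neg_sub]

namespace IsEvolution

variable {I : Set ℝ} {v₀ : ℝ} {E : Submodule ℝ R42} {l : R42} {G : ℝ → R42 ≃L[ℝ] R42} {m : ℝ → E}

theorem l_apply (h : IsEvolution I v₀ E l G m) (x : E) : lieForm l x = 0 := (h.mem_iff x).1 x.2

theorem apply_l (h : IsEvolution I v₀ E l G m) (x : E) : lieForm x l = 0 := by
  rw [lieForm_comm, h.l_apply]

/-- The product rule for `G y`. -/
theorem hasDerivAt_apply (h : IsEvolution I v₀ E l G m) {v : ℝ} (hv : v ∈ I) {y : ℝ → R42}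
    {y' : R42} (hy : HasDerivAt y y' v) :
    HasDerivAt (fun w => G w (y w))
      (G v (y' + lieForm l (y v) • (m v : R42) - lieForm (m v : R42) (y v) • l)) v := by
  have hG := h.smooth.hasDerivAt h.isOpen hv
  have h1 := hG.clm_apply hy
  have h2 := ((hG.clm_apply (hasDerivAt_const v (y v))).unique (h.hasDerivAt v hv (y v)))
  rw [map_zero, add_zero] at h2
  rw [h2] at h1
  rw [ContinuousLinearEquiv.coe_coe, ← map_add, add_comm, ← add_sub_assoc] at h1
  exact h1

theorem hasDerivAt_apply_mem (h : IsEvolution I v₀ E l G m) {v : ℝ} (hv : v ∈ I) (x : E) :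
    HasDerivAt (fun w => G w x) (-lieForm (m v) x • G v l) v := by
  have := h.hasDerivAt v hv x
  rw [h.l_apply] at this
  simpa using this

theorem hasDerivAt_m (h : IsEvolution I v₀ E l G m) {v : ℝ} (hv : v ∈ I) :
    HasDerivAt (fun w => (m w : R42)) (deriv m v : E) v :=
  E.subtypeL.hasFDerivAt.comp_hasDerivAt v (h.smooth_m.hasDerivAt h.isOpen hv)

theorem smooth_coe_m (h : IsEvolution I v₀ E l G m) : ContDiffOn ℝ ∞ (fun w => (m w : R42)) I :=
  E.subtypeL.contDiff.comp_contDiffOn h.smooth_m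

/-- If `x ∈ E` is orthogonal to all `m v`, then `G` fixes `x`. -/
theorem apply_eq_self (h : IsEvolution I v₀ E l G m) {x : E}
    (hx : ∀ v ∈ I, lieForm (m v) x = 0) {v : ℝ} (hv : v ∈ I) : G v x = x := by
  have := constant_of_hasDerivAt_zero h.isOpen h.ordConnected (y := fun w => G w x) (fun w hw => by
    simpa [hx w hw] using h.hasDerivAt_apply_mem hw x) hv h.base_mem
  rw [this]
  simp [h.base]

end IsEvolution

/-- A smooth curve of vectors of a subspace has its derivative in that subspace. -/
theorem mem_of_hasDerivAt {V : Type*} [NormedAddCommGroup V] [NormedSpace ℝ V]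
    [FiniteDimensional ℝ V] {S : Submodule ℝ V} {y : ℝ → V} {y' : V} {t : ℝ}
    (hy : HasDerivAt y y' t) (hS : ∀ᶠ s in 𝓝 t, y s ∈ S) : y' ∈ S := by
  obtain ⟨q, hq⟩ := S.exists_isCompl
  let T : V →L[ℝ] V := LinearMap.toContinuousLinearMap (q.projection S hq.symm)
  have hT : ∀ x, T x = 0 ↔ x ∈ S := fun x => Submodule.projection_apply_eq_zero_iff hq.symm
  rw [← hT]
  have h1 := T.hasFDerivAt.comp_hasDerivAt t hy
  exact (h1.congr_of_eventuallyEq (f₁ := fun _ => 0) (by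
    filter_upwards [hS] with s hs using ((hT _).2 hs).symm)).unique (hasDerivAt_const t 0)

/-! ### Surfaces evolved from a Legendre curve -/

/-- The surface `f (u, v) = G v (C u)` swept out by a Legendre curve `C` in `E`. -/
structure IsEvolvedSurface (I₁ I₂ : Set ℝ) (v₀ : ℝ) (E : Submodule ℝ R42) (l : R42)
    (G : ℝ → R42 ≃L[ℝ] R42) (m : ℝ → E) (C : ℝ → Submodule ℝ E) (f : ℝ × ℝ → Submodule ℝ R42) :
    Prop where
  evol : IsEvolution I₂ v₀ E l G m
  isOpen : IsOpen I₁
  ordConnected : I₁.OrdConnected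
  curve : IsLegendreMap (lieForm.restrict E) I₁ C
  fibre : ∀ u ∈ I₁, ∀ v ∈ I₂, f (u, v) =
    ((C u).map E.subtype).map ((G v).toLinearEquiv : R42 →ₗ[ℝ] R42)
  legendre : IsLegendreMap lieForm (I₁ ×ˢ I₂) f
  umbilicFree : IsUmbilicFree (I₁ ×ˢ I₂) f
  regular : IsRegular (I₁ ×ˢ I₂) f

namespace IsEvolvedSurface

variable {I₁ I₂ : Set ℝ} {v₀ : ℝ} {E : Submodule ℝ R42} {l : R42} {G : ℝ → R42 ≃L[ℝ] R42}
  {m : ℝ → E} {C : ℝ → Submodule ℝ E} {f : ℝ × ℝ → Submodule ℝ R42} {u v : ℝ}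

theorem isOpen_prod (h : IsEvolvedSurface I₁ I₂ v₀ E l G m C f) : IsOpen (I₁ ×ˢ I₂) :=
  h.isOpen.prod h.evol.isOpen

theorem null (h : IsEvolvedSurface I₁ I₂ v₀ E l G m C f) (hu : u ∈ I₁) {a b : E} (ha : a ∈ C u)
    (hb : b ∈ C u) : lieForm a b = 0 := h.curve.null u hu a ha b hb

theorem mem_fibre (h : IsEvolvedSurface I₁ I₂ v₀ E l G m C f) (hu : u ∈ I₁) (hv : v ∈ I₂)
    {x : R42} : x ∈ f (u, v) ↔ ∃ c ∈ C u, G v (c : R42) = x := by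
  rw [h.fibre u hu v hv]
  constructor
  · rintro ⟨_, ⟨c, hc, rfl⟩, rfl⟩
    exact ⟨c, hc, rfl⟩
  · rintro ⟨c, hc, rfl⟩
    exact ⟨_, ⟨c, hc, rfl⟩, rfl⟩

theorem apply_mem_fibre (h : IsEvolvedSurface I₁ I₂ v₀ E l G m C f) (hu : u ∈ I₁) (hv : v ∈ I₂)
    {c : E} (t : ℝ) : G v (c + t • l) ∈ f (u, v) ↔ c ∈ C u ∧ t = 0 := by
  rw [h.mem_fibre hu hv]
  constructor
  · rintro ⟨d, hd, hdc⟩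
    have h1 := (G v).injective hdc
    have h2 := congrArg (lieForm l) h1
    rw [map_add, map_smul, h.evol.l_apply, h.evol.l_apply, h.evol.unit] at h2
    have ht : t = 0 := by simpa using h2.symm
    rw [ht, zero_smul, add_zero] at h1
    exact ⟨Subtype.ext h1 ▸ hd, ht⟩
  · rintro ⟨hc, rfl⟩
    exact ⟨c, hc, by simp⟩

theorem exists_frame (h : IsEvolvedSurface I₁ I₂ v₀ E l G m C f) (hu : u ∈ I₁) :
    ∃ g₁ g₂ : ℝ → E, ∀ᶠ s in 𝓝 u, ContDiffAt ℝ ∞ g₁ s ∧ ContDiffAt ℝ ∞ g₂ s ∧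
      (∀ a b : ℝ, a • g₁ s + b • g₂ s = 0 → a = 0 ∧ b = 0) ∧
      ∀ c : E, c ∈ C s ↔ ∃ a b : ℝ, a • g₁ s + b • g₂ s = c := by
  obtain ⟨g, hg⟩ := h.curve.smooth u hu
  refine ⟨g 0, g 1, ?_⟩
  filter_upwards [hg] with s hs
  refine ⟨hs.1 0, hs.1 1, ?_, ?_⟩
  · have := hs.2.1
    rw [show (fun i => g i s) = ![g 0 s, g 1 s] by ext i; fin_cases i <;> rfl,
      LinearIndependent.pair_iff] at this
    exact this
  · intro c
    rw [hs.2.2, show (Set.range fun i => g i s) = {g 0 s, g 1 s} by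
      ext x; simp [eq_comm], Submodule.mem_span_pair]

theorem finrank_curve (h : IsEvolvedSurface I₁ I₂ v₀ E l G m C f) (hu : u ∈ I₁) :
    Module.finrank ℝ (C u) = 2 := by
  obtain ⟨g, hg⟩ := h.curve.smooth u hu
  obtain ⟨-, h1, h2⟩ := hg.self_of_nhds
  rw [h2, finrank_span_eq_card h1, Fintype.card_fin]

/-- Along a `v`-parameter line, `σ = G τ` for a section `σ` of `f`, with `τ` in the fixed plane
`C u`. -/
theorem exists_slice (h : IsEvolvedSurface I₁ I₂ v₀ E l G m C f) (hu : u ∈ I₁) (hv : v ∈ I₂)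
    {σ : ℝ × ℝ → R42} (hσ : IsSectionNear f (u, v) σ) :
    ∃ (τ : ℝ → R42) (τ' : E), HasDerivAt τ τ' v ∧ τ' ∈ C u ∧
      (∀ᶠ w in 𝓝 v, w ∈ I₂ ∧ σ (u, w) = G w (τ w) ∧ ∃ c ∈ C u, (c : R42) = τ w) ∧
      fderiv ℝ σ (u, v) (0, 1) = G v (τ' - lieForm (m v) (τ v) • l) := by
  have hσd := hσ.self_of_nhds.1.differentiableAt (by simp)
  have hτ := ((h.evol.smooth_symm.hasDerivAt h.evol.isOpen hv).clm_apply
    (hasDerivAt_snd_slice hσd))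
  have hmem : ∀ᶠ w in 𝓝 v, w ∈ I₂ ∧ ∃ c ∈ C u, (c : R42) = (G w).symm (σ (u, w)) := by
    filter_upwards [eventually_snd_slice hσ, h.evol.isOpen.mem_nhds hv] with w hw hwI
    obtain ⟨c, hc, hcx⟩ := (h.mem_fibre hu hwI).1 hw.2
    exact ⟨hwI, c, hc, by rw [← hcx]; simp⟩
  obtain ⟨τ', hτ', hτe⟩ := Submodule.mem_map.1 (mem_of_hasDerivAt hτ
    (S := (C u).map E.subtype) (by
      filter_upwards [hmem] with w hw
      obtain ⟨-, c, hc, hcx⟩ := hw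
      exact ⟨c, hc, hcx⟩))
  change (τ' : R42) = _ at hτe
  rw [← hτe] at hτ
  refine ⟨fun w => (G w).symm (σ (u, w)), τ', hτ, hτ', ?_, ?_⟩
  · filter_upwards [hmem] with w hw
    exact ⟨hw.1, by simp, hw.2⟩
  · have h1 := h.evol.hasDerivAt_apply hv hτ
    have h2 : (fun w => G w ((G w).symm (σ (u, w)))) = fun w => σ (u, w) := by ext1 w; simp
    simp only [ContinuousLinearEquiv.coe_coe] at h1
    rw [h2] at h1
    rw [(hasDerivAt_snd_slice hσd).unique h1]
    obtain ⟨c, -, hc⟩ := hmem.self_of_nhds.2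
    rw [show lieForm l ((G v).symm (σ (u, v))) = 0 by rw [← hc, h.evol.l_apply]]
    simp

/-- As the immersion `f` is not stationary in the direction `∂/∂v`, the functional `m v` does not
vanish on `C u`. -/
theorem m_ne_zero (h : IsEvolvedSurface I₁ I₂ v₀ E l G m C f) (hu : u ∈ I₁) (hv : v ∈ I₂)
    (hm : ∀ c ∈ C u, lieForm (m v) c = 0) : False := by
  have := h.legendre.immersive (u, v) ⟨hu, hv⟩ (0, 1) (fun σ hσ => by
    obtain ⟨τ, τ', -, hτ', hτ, hd⟩ := h.exists_slice hu hv hσ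
    obtain ⟨c, hc, hcx⟩ := hτ.self_of_nhds.2.2
    rw [hd, ← hcx, hm c hc, zero_smul, sub_zero, h.mem_fibre hu hv]
    exact ⟨τ', hτ', rfl⟩)
  simp at this

/-- The curvature sphere congruence of `f` whose curvature direction is `∂/∂v`. -/
def vSphere (G : ℝ → R42 ≃L[ℝ] R42) (m : ℝ → E) (f : ℝ × ℝ → Submodule ℝ R42) (x : ℝ × ℝ) :
    Submodule ℝ R42 :=
  f x ⊓ LinearMap.ker (lieForm (G x.2 (m x.2)))

theorem mem_vSphere (h : IsEvolvedSurface I₁ I₂ v₀ E l G m C f) (hu : u ∈ I₁) (hv : v ∈ I₂)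
    {x : R42} : x ∈ vSphere G m f (u, v) ↔ ∃ c ∈ C u, lieForm (m v) c = 0 ∧ G v (c : R42) = x := by
  rw [vSphere, Submodule.mem_inf, h.mem_fibre hu hv, LinearMap.mem_ker]
  constructor
  · rintro ⟨⟨c, hc, rfl⟩, h2⟩
    rw [h.evol.orthogonal v hv] at h2
    exact ⟨c, hc, h2, rfl⟩
  · rintro ⟨c, hc, h2, rfl⟩
    exact ⟨⟨c, hc, rfl⟩, by rw [h.evol.orthogonal v hv, h2]⟩

theorem smooth_vSphere (h : IsEvolvedSurface I₁ I₂ v₀ E l G m C f) :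
    IsSmoothSubbundle 1 (I₁ ×ˢ I₂) (vSphere G m f) := by
  rintro ⟨u, v⟩ ⟨hu, hv⟩
  obtain ⟨g₁, g₂, hg⟩ := h.exists_frame hu
  let z : ℝ × ℝ → E := fun y =>
    lieForm (m y.2) (g₂ y.1) • g₁ y.1 - lieForm (m y.2) (g₁ y.1) • g₂ y.1
  refine ⟨fun _ y => G y.2 (z y), ?_⟩
  have h1 : ∀ᶠ y : ℝ × ℝ in 𝓝 (u, v), y.1 ∈ I₁ ∧ y.2 ∈ I₂ :=
    h.isOpen_prod.mem_nhds ⟨hu, hv⟩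
  have h2 := (continuous_fst.tendsto (u, v)).eventually hg
  filter_upwards [h1, h2] with ⟨s, t⟩ ⟨hs, ht⟩ ⟨hg1, hg2, hli, hC⟩
  have hne : ∀ a b : ℝ, a * lieForm (m t) (g₁ s) + b * lieForm (m t) (g₂ s) = 0 →
      ∃ r : ℝ, a = r * lieForm (m t) (g₂ s) ∧ b = -(r * lieForm (m t) (g₁ s)) := by
    intro a b hab
    by_cases h0 : lieForm (m t) (g₁ s) = 0
    · have h00 : lieForm (m t) (g₂ s) ≠ 0 := fun h00 => h.m_ne_zero hs ht fun c hc => by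
        obtain ⟨a, b, rfl⟩ := (hC c).1 hc
        simp [h0, h00]
      rw [h0, mul_zero, zero_add] at hab
      exact ⟨a / lieForm (m t) (g₂ s), by field_simp, by
        rw [h0]; simpa using (mul_eq_zero.1 hab).resolve_right h00⟩
    · refine ⟨-b / lieForm (m t) (g₁ s), ?_, by field_simp⟩
      field_simp
      linarith
  have hz0 : z (s, t) ≠ 0 := by
    intro h0
    have := hli (lieForm (m t) (g₂ s)) (-(lieForm (m t) (g₁ s))) (by
      rw [← h0]; simp only [z]; module)
    exact h.m_ne_zero hs ht fun c hc => by
      obtain ⟨a, b, rfl⟩ := (hC c).1 hc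
      simp [this.1, neg_eq_zero.1 this.2]
  refine ⟨fun _ => ?_, ?_, ?_⟩
  · have hG : ContDiffAt ℝ ∞ (fun y : ℝ × ℝ => (G y.2 : R42 →L[ℝ] R42)) (s, t) :=
      ContDiffAt.comp (s, t) (h.evol.smooth.contDiffAt (h.evol.isOpen.mem_nhds ht)) contDiffAt_snd
    have hm : ContDiffAt ℝ ∞ (fun y : ℝ × ℝ => (m y.2 : R42)) (s, t) :=
      ContDiffAt.comp (g := fun w => (m w : R42)) (s, t)
        (h.evol.smooth_coe_m.contDiffAt (h.evol.isOpen.mem_nhds ht))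
        contDiffAt_snd
    have hg1' : ContDiffAt ℝ ∞ (fun y : ℝ × ℝ => (g₁ y.1 : R42)) (s, t) :=
      E.subtypeL.contDiff.contDiffAt.comp (s, t) (ContDiffAt.comp (s, t) hg1 contDiffAt_fst)
    have hg2' : ContDiffAt ℝ ∞ (fun y : ℝ × ℝ => (g₂ y.1 : R42)) (s, t) :=
      E.subtypeL.contDiff.contDiffAt.comp (s, t) (ContDiffAt.comp (s, t) hg2 contDiffAt_fst)
    exact hG.clm_apply (((hm.lieForm hg2').smul hg1').sub ((hm.lieForm hg1').smul hg2'))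
  · refine LinearIndependent.of_subsingleton 0 ?_
    simpa using hz0
  · ext x
    rw [h.mem_vSphere hs ht, Set.range_const, Submodule.mem_span_singleton]
    constructor
    · rintro ⟨c, hc, hc0, rfl⟩
      obtain ⟨a, b, rfl⟩ := (hC c).1 hc
      obtain ⟨r, ha, hb⟩ := hne a b (by simpa using hc0)
      refine ⟨r, ?_⟩
      rw [← map_smul, ha, hb]
      congr 1
      simp [z, mul_smul, sub_eq_add_neg]
    · rintro ⟨r, rfl⟩
      refine ⟨r • z (s, t), (C s).smul_mem _ ((C s).sub_mem ((C s).smul_mem _ ?_)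
        ((C s).smul_mem _ ?_)), ?_, by simp⟩
      · exact (hC _).2 ⟨1, 0, by simp⟩
      · exact (hC _).2 ⟨0, 1, by simp⟩
      · simp [z, mul_comm]

theorem finrank_of_isSmoothSubbundle_one {V F : Type*} [NormedAddCommGroup F] [NormedSpace ℝ F]
    [NormedAddCommGroup V] [NormedSpace ℝ V] {Ω : Set F} {s : F → Submodule ℝ V}
    (hs : IsSmoothSubbundle 1 Ω s) {x : F} (hx : x ∈ Ω) : Module.finrank ℝ (s x) = 1 := by
  obtain ⟨g, hg⟩ := hs x hx
  obtain ⟨-, h1, h2⟩ := hg.self_of_nhds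
  rw [h2, finrank_span_eq_card h1, Fintype.card_fin]

theorem mem_curvatureSpace_vSphere (h : IsEvolvedSurface I₁ I₂ v₀ E l G m C f) (hu : u ∈ I₁)
    (hv : v ∈ I₂) : ((0, 1) : ℝ × ℝ) ∈ curvatureSpace f (u, v) (vSphere G m f (u, v)) := by
  intro σ hσ hσs
  obtain ⟨τ, τ', -, hτ', hτ, hd⟩ := h.exists_slice hu hv hσ
  obtain ⟨-, hσv, c, hc, hcx⟩ := hτ.self_of_nhds
  obtain ⟨d, hd1, hd2, hd3⟩ := (h.mem_vSphere hu hv).1 hσs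
  rw [hσv] at hd3
  rw [hd, ← (G v).injective hd3, hd2, zero_smul, sub_zero, h.mem_fibre hu hv]
  exact ⟨τ', hτ', rfl⟩

theorem isCurvatureSphere_vSphere (h : IsEvolvedSurface I₁ I₂ v₀ E l G m C f) (hu : u ∈ I₁)
    (hv : v ∈ I₂) : IsCurvatureSphere f (u, v) (vSphere G m f (u, v)) := by
  refine ⟨inf_le_left, finrank_of_isSmoothSubbundle_one h.smooth_vSphere ⟨hu, hv⟩, fun h0 => ?_⟩
  have := h.mem_curvatureSpace_vSphere hu hv
  rw [h0] at this
  simp at this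

theorem isCurvatureDirection_v (h : IsEvolvedSurface I₁ I₂ v₀ E l G m C f) (hu : u ∈ I₁)
    (hv : v ∈ I₂) : IsCurvatureDirection f (u, v) (0, 1) :=
  ⟨by simp, _, h.isCurvatureSphere_vSphere hu hv, h.mem_curvatureSpace_vSphere hu hv⟩

/-- Regularity of the curvature spheres along the `v`-parameter lines says that `m v` and its
derivative restrict to independent functionals on every plane `C u`. -/
theorem eq_zero_of_orthogonal (h : IsEvolvedSurface I₁ I₂ v₀ E l G m C f) (hu : u ∈ I₁)
    (hv : v ∈ I₂) {c : E} (hc : c ∈ C u) (h1 : lieForm (m v) c = 0)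
    (h2 : lieForm (deriv m v : E) c = 0) : c = 0 := by
  by_contra hc0
  have hsp := finrank_of_isSmoothSubbundle_one h.smooth_vSphere (x := (u, v)) ⟨hu, hv⟩
  have hcs : G v (c : R42) ∈ vSphere G m f (u, v) := (h.mem_vSphere hu hv).2 ⟨c, hc, h1, rfl⟩
  have hall : ∀ d ∈ C u, lieForm (m v) d = 0 → ∃ r : ℝ, d = r • c := by
    intro d hd hd0
    have hds : G v (d : R42) ∈ vSphere G m f (u, v) := (h.mem_vSphere hu hv).2 ⟨d, hd, hd0, rfl⟩
    obtain ⟨r, hr⟩ := (finrank_eq_one_iff_of_nonzero' (⟨_, hcs⟩ : vSphere G m f (u, v)) (by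
      simpa using hc0)).1 hsp ⟨_, hds⟩
    refine ⟨r, Subtype.ext ((G v).injective ?_)⟩
    rw [Submodule.coe_smul, map_smul]
    exact (congrArg Subtype.val hr).symm
  have := h.regular _ h.smooth_vSphere (fun x hx => h.isCurvatureSphere_vSphere hx.1 hx.2) (u, v)
    ⟨hu, hv⟩ (0, 1) (fun σ hσ => by
      have hσf : IsSectionNear f (u, v) σ := hσ.mono fun y hy => ⟨hy.1, hy.2.1⟩
      obtain ⟨τ, τ', hτd, hτ', hτ, hd⟩ := h.exists_slice hu hv hσf
      have hm0 : ∀ᶠ w in 𝓝 v, lieForm (m w) (τ w) = 0 := by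
        filter_upwards [hτ, eventually_snd_slice hσ] with w hw hws
        obtain ⟨d, -, hd0, hdx⟩ := (h.mem_vSphere hu hw.1).1 hws.2
        rw [hw.2.1] at hdx
        rw [← (G w).injective hdx, hd0]
      have hder := (((h.evol.hasDerivAt_m hv).lieForm hτd).congr_of_eventuallyEq
        (f₁ := fun _ => (0 : ℝ)) (hm0.mono fun w hw => hw.symm)).unique (hasDerivAt_const v 0)
      obtain ⟨d, hdC, hdx⟩ := hτ.self_of_nhds.2.2
      obtain ⟨r, hr⟩ := hall d hdC (by rw [hdx]; exact hm0.self_of_nhds)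
      rw [← hdx, hr, Submodule.coe_smul, map_smul, h2, smul_zero, zero_add] at hder
      rw [hd, hm0.self_of_nhds, zero_smul, sub_zero]
      exact (h.mem_vSphere hu hv).2 ⟨τ', hτ', hder, rfl⟩)
  simp at this

end IsEvolvedSurface

/-! ### An adapted frame of the Legendre curve -/

/-- A frame `h₁, h₂` of the Legendre curve `C` that is dual to two fixed vectors `a, b`. -/
structure IsDualFrame {E : Submodule ℝ R42} (I₁ : Set ℝ) (C : ℝ → Submodule ℝ E) (a b : E)
    (h₁ h₂ : ℝ → E) : Prop where
  smooth₁ : ContDiffOn ℝ ∞ h₁ I₁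
  smooth₂ : ContDiffOn ℝ ∞ h₂ I₁
  mem₁ : ∀ u ∈ I₁, h₁ u ∈ C u
  mem₂ : ∀ u ∈ I₁, h₂ u ∈ C u
  dual₁₁ : ∀ u ∈ I₁, lieForm a (h₁ u) = 1
  dual₁₂ : ∀ u ∈ I₁, lieForm a (h₂ u) = 0
  dual₂₁ : ∀ u ∈ I₁, lieForm b (h₁ u) = 0
  dual₂₂ : ∀ u ∈ I₁, lieForm b (h₂ u) = 1

/-- A dual frame whose derivatives are multiples of a spacelike normal `k` of `C` orthogonal to
`a, b`. The section `h₁ + φ h₂` spans the curvature sphere congruence of `C`; it is an immersion as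
`φ' ≠ 0`, and by `m_apply_ne` it is never a curvature sphere in the other direction. -/
structure IsAdaptedFrame {E : Submodule ℝ R42} (I₁ I₂ : Set ℝ) (m : ℝ → E)
    (C : ℝ → Submodule ℝ E) (a b : E) (h₁ h₂ k : ℝ → E) (φ : ℝ → ℝ) : Prop
    extends IsDualFrame I₁ C a b h₁ h₂ where
  smooth_k : ContDiffOn ℝ ∞ k I₁
  smooth_φ : ContDiffOn ℝ ∞ φ I₁
  a_k : ∀ u ∈ I₁, lieForm a (k u) = 0
  b_k : ∀ u ∈ I₁, lieForm b (k u) = 0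
  orth_k : ∀ u ∈ I₁, ∀ c ∈ C u, lieForm c (k u) = 0
  k_pos : ∀ u ∈ I₁, 0 < lieForm (k u) (k u)
  hasDerivAt₁ : ∀ u ∈ I₁, HasDerivAt h₁ (-φ u • k u) u
  hasDerivAt₂ : ∀ u ∈ I₁, HasDerivAt h₂ (k u) u
  deriv_φ_ne : ∀ u ∈ I₁, deriv φ u ≠ 0
  m_apply_ne : ∀ u ∈ I₁, ∀ v ∈ I₂, lieForm (m v) (h₁ u + φ u • h₂ u : E) ≠ 0

theorem pairing_deriv_eq_zero {E : Submodule ℝ R42} {I₁ : Set ℝ} (hI : IsOpen I₁) {g : ℝ → E}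
    {z : E} {r : ℝ} (hg : ContDiffOn ℝ ∞ g I₁) (hr : ∀ u ∈ I₁, lieForm z (g u) = r) {u : ℝ}
    (hu : u ∈ I₁) : lieForm z (deriv g u : E) = 0 := by
  have h1 := (hasDerivAt_const u (z : R42)).lieForm
    (E.subtypeL.hasFDerivAt.comp_hasDerivAt u (hg.hasDerivAt hI hu))
  have h2 := (h1.congr_of_eventuallyEq (f₁ := fun _ => r) (by
    filter_upwards [hI.mem_nhds hu] with s hs using (hr s hs).symm)).unique
    (hasDerivAt_const u r)
  simpa using h2

namespace IsEvolvedSurface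

variable {I₁ I₂ : Set ℝ} {v₀ : ℝ} {E : Submodule ℝ R42} {l : R42} {G : ℝ → R42 ≃L[ℝ] R42}
  {m : ℝ → E} {C : ℝ → Submodule ℝ E} {f : ℝ × ℝ → Submodule ℝ R42} {u v : ℝ}

theorem eq_of_pairing_eq (h : IsEvolvedSurface I₁ I₂ v₀ E l G m C f) (hu : u ∈ I₁) {c d : E}
    (hc : c ∈ C u) (hd : d ∈ C u) (h1 : lieForm (m v₀) c = lieForm (m v₀) d)
    (h2 : lieForm (deriv m v₀ : E) c = lieForm (deriv m v₀ : E) d) : c = d := by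
  rw [← sub_eq_zero]
  refine h.eq_zero_of_orthogonal hu h.evol.base_mem ((C u).sub_mem hc hd) ?_ ?_
  · simp [h1]
  · simp [h2]

theorem exists_dual_section (h : IsEvolvedSurface I₁ I₂ v₀ E l G m C f) (α β : ℝ) :
    ∃ g : ℝ → E, ContDiffOn ℝ ∞ g I₁ ∧ ∀ u ∈ I₁, g u ∈ C u ∧ lieForm (m v₀) (g u) = α ∧
      lieForm (deriv m v₀ : E) (g u) = β := by
  have hloc : ∀ u ∈ I₁, ∃ g : ℝ → E, ∀ᶠ s in 𝓝 u, ContDiffAt ℝ ∞ g s ∧ g s ∈ C s ∧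
      lieForm (m v₀) (g s) = α ∧ lieForm (deriv m v₀ : E) (g s) = β := by
    intro u hu
    obtain ⟨g₁, g₂, hg⟩ := h.exists_frame hu
    set a := m v₀
    set b := deriv m v₀
    let D : ℝ → ℝ := fun s =>
      lieForm a (g₁ s) * lieForm b (g₂ s) - lieForm a (g₂ s) * lieForm b (g₁ s)
    refine ⟨fun s => (D s)⁻¹ • ((α * lieForm b (g₂ s) - β * lieForm a (g₂ s)) • g₁ s +
      (β * lieForm a (g₁ s) - α * lieForm b (g₁ s)) • g₂ s), ?_⟩
    filter_upwards [hg, h.isOpen.mem_nhds hu] with s ⟨hg1, hg2, hli, hC⟩ hs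
    have m1 : g₁ s ∈ C s := (hC _).2 ⟨1, 0, by simp⟩
    have m2 : g₂ s ∈ C s := (hC _).2 ⟨0, 1, by simp⟩
    have hz : ∀ x y : ℝ, lieForm a (x • g₁ s + y • g₂ s : E) = 0 →
        lieForm b (x • g₁ s + y • g₂ s : E) = 0 → x = 0 ∧ y = 0 := fun x y h1 h2 =>
      hli x y (h.eq_zero_of_orthogonal hs h.evol.base_mem
        ((C s).add_mem ((C s).smul_mem _ m1) ((C s).smul_mem _ m2)) h1 h2)
    have hD : D s ≠ 0 := by
      intro h0
      have e1 := hz (lieForm a (g₂ s)) (-(lieForm a (g₁ s))) (by simp; ring)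
        (by simp; simp only [D] at h0; linarith)
      have e2 := hz (lieForm b (g₂ s)) (-(lieForm b (g₁ s)))
        (by simp; simp only [D] at h0; linarith) (by simp; ring)
      have := hz 1 0 (by simpa using neg_eq_zero.1 e1.2) (by simpa using neg_eq_zero.1 e2.2)
      simp at this
    have hp : ∀ z : E, ContDiffAt ℝ ∞ (fun s => lieForm z (g₁ s)) s ∧
        ContDiffAt ℝ ∞ (fun s => lieForm z (g₂ s)) s := fun z =>
      ⟨contDiffAt_const.lieForm (E.subtypeL.contDiff.contDiffAt.comp s hg1),
        contDiffAt_const.lieForm (E.subtypeL.contDiff.contDiffAt.comp s hg2)⟩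
    refine ⟨?_, (C s).smul_mem _ ((C s).add_mem ((C s).smul_mem _ m1) ((C s).smul_mem _ m2)),
      ?_, ?_⟩
    · refine ContDiffAt.smul (ContDiffAt.inv ?_ hD) (ContDiffAt.add ?_ ?_)
      · exact ((hp a).1.mul (hp b).2).sub ((hp a).2.mul (hp b).1)
      · exact ((contDiffAt_const.mul (hp b).2).sub (contDiffAt_const.mul (hp a).2)).smul hg1
      · exact ((contDiffAt_const.mul (hp a).1).sub (contDiffAt_const.mul (hp b).1)).smul hg2
    · simp only [Submodule.coe_smul, Submodule.coe_add, map_smul, map_add, smul_eq_mul]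
      rw [inv_mul_eq_iff_eq_mul₀ hD]
      simp only [D]; ring
    · simp only [Submodule.coe_smul, Submodule.coe_add, map_smul, map_add, smul_eq_mul]
      rw [inv_mul_eq_iff_eq_mul₀ hD]
      simp only [D]; ring
  have hex : ∀ u, ∃ c : E, u ∈ I₁ → c ∈ C u ∧ lieForm (m v₀) c = α ∧
      lieForm (deriv m v₀ : E) c = β := by
    intro u
    by_cases hu : u ∈ I₁
    · obtain ⟨g, hg⟩ := hloc u hu
      exact ⟨g u, fun _ => hg.self_of_nhds.2⟩
    · exact ⟨0, fun h => absurd h hu⟩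
  choose g hg using hex
  refine ⟨g, fun u hu => ?_, hg⟩
  obtain ⟨g', hg'⟩ := hloc u hu
  refine (hg'.self_of_nhds.1.congr_of_eventuallyEq ?_).contDiffWithinAt
  filter_upwards [hg', h.isOpen.mem_nhds hu] with s hs hsI
  have h1 := hg s hsI
  exact h.eq_of_pairing_eq hsI h1.1 hs.2.1 (h1.2.1.trans hs.2.2.1.symm)
    (h1.2.2.trans hs.2.2.2.symm)

/-- The form induced on `C^⊥ / C` is definite of rank one. -/
theorem exists_eq_add_smul (h : IsEvolvedSurface I₁ I₂ v₀ E l G m C f) (hu : u ∈ I₁) {k z : E}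
    (hk : ∀ c ∈ C u, lieForm c k = 0) (hkC : k ∉ C u) (hz : ∀ c ∈ C u, lieForm c z = 0) :
    ∃ a ∈ C u, ∃ t : ℝ, z = a + t • k := by
  set S : Submodule ℝ R42 := (C u).map E.subtype with hS
  have hrS : Module.finrank ℝ S = 2 := by
    rw [hS, Submodule.finrank_map_subtype_eq]; exact h.finrank_curve hu
  have hrank : ∀ x ∉ S, 3 ≤ Module.finrank ℝ (S ⊔ Submodule.span ℝ {x} : Submodule ℝ R42) := by
    intro x hx
    have hlt : S < S ⊔ Submodule.span ℝ {x} := by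
      refine lt_of_le_of_ne le_sup_left fun h => hx ?_
      rw [h]
      exact Submodule.mem_sup_right (Submodule.mem_span_singleton_self x)
    have := Submodule.finrank_lt_finrank_of_lt hlt
    omega
  have hlS : l ∉ S := by
    rintro ⟨c, -, hc⟩
    have h1 := h.evol.unit
    rw [← hc] at h1
    have h2 := h.evol.apply_l c
    rw [← hc] at h2
    exact zero_ne_one (h2.symm.trans h1)
  have hkS : (k : R42) ∉ S := by
    rintro ⟨c, hc, hck⟩
    exact hkC (Subtype.ext hck ▸ hc)
  have hmem : ∀ x : E, (∀ c ∈ C u, lieForm c x = 0) →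
      (x : R42) ∈ lieForm.orthogonal (S ⊔ Submodule.span ℝ {l}) := by
    intro x hx n hn
    obtain ⟨_, ⟨c, hc, rfl⟩, b, hb, rfl⟩ := Submodule.mem_sup.1 hn
    obtain ⟨t, rfl⟩ := Submodule.mem_span_singleton.1 hb
    change lieForm ((c : R42) + t • l) x = 0
    rw [map_add, map_smul, LinearMap.add_apply, LinearMap.smul_apply, hx c hc, h.evol.l_apply]
    simp
  have hle : S ⊔ Submodule.span ℝ {(k : R42)} ≤ lieForm.orthogonal (S ⊔ Submodule.span ℝ {l}) := by
    refine sup_le ?_ ?_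
    · rintro _ ⟨c, hc, rfl⟩
      exact hmem c fun d hd => h.null hu hd hc
    · rw [Submodule.span_singleton_le_iff_mem]
      exact hmem k hk
  have heq := Submodule.eq_of_le_of_finrank_le hle (by
    rw [LinearMap.BilinForm.finrank_orthogonal lieForm_nondegenerate]
    have h1 := hrank l hlS
    have h2 := hrank k hkS
    have h3 : Module.finrank ℝ R42 = 6 := by simp
    omega)
  have hz' := hmem z hz
  rw [← heq] at hz'
  obtain ⟨_, ⟨c, hc, rfl⟩, b, hb, hcb⟩ := Submodule.mem_sup.1 hz'
  obtain ⟨t, rfl⟩ := Submodule.mem_span_singleton.1 hb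
  exact ⟨c, hc, t, Subtype.ext hcb.symm⟩

theorem smooth_evolve (h : IsEvolvedSurface I₁ I₂ v₀ E l G m C f) {y : ℝ → E}
    (hy : ContDiffOn ℝ ∞ y I₁) :
    ContDiffOn ℝ ∞ (fun x : ℝ × ℝ => G x.2 (y x.1)) (I₁ ×ˢ I₂) := by
  have h1 : ContDiffOn ℝ ∞ (fun x : ℝ × ℝ => (G x.2 : R42 →L[ℝ] R42)) (I₁ ×ˢ I₂) :=
    h.evol.smooth.comp contDiffOn_snd fun x hx => hx.2
  have h2 : ContDiffOn ℝ ∞ (fun x : ℝ × ℝ => (y x.1 : R42)) (I₁ ×ˢ I₂) :=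
    E.subtypeL.contDiff.comp_contDiffOn (hy.comp contDiffOn_fst fun x hx => hx.1)
  exact h1.clm_apply h2

theorem fderiv_evolve (h : IsEvolvedSurface I₁ I₂ v₀ E l G m C f) {y : ℝ → E}
    (hy : ContDiffOn ℝ ∞ y I₁) (hu : u ∈ I₁) (hv : v ∈ I₂) (X : ℝ × ℝ) :
    fderiv ℝ (fun x : ℝ × ℝ => G x.2 (y x.1)) (u, v) X =
      G v ((X.1 • deriv y u : E) + (-(X.2 * lieForm (m v) (y u))) • l) := by
  have hd : DifferentiableAt ℝ (fun x : ℝ × ℝ => G x.2 (y x.1)) (u, v) :=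
    ((h.smooth_evolve hy).contDiffAt (h.isOpen_prod.mem_nhds ⟨hu, hv⟩)).differentiableAt (by simp)
  have h1 := hasDerivAt_fst_slice hd
  have h2 := hasDerivAt_snd_slice hd
  have h3 : HasDerivAt (fun s => G v (y s)) (G v (deriv y u : E)) u :=
    ((G v : R42 →L[ℝ] R42).comp E.subtypeL).hasFDerivAt.comp_hasDerivAt u
      (hy.hasDerivAt h.isOpen hu)
  have h4 : HasDerivAt (fun w => G w (y u)) _ v := h2
  rw [clm_prod_apply, h1.unique h3, h4.unique (h.evol.hasDerivAt_apply_mem hv _)]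
  simp [mul_smul]

theorem isSectionNear_evolve (h : IsEvolvedSurface I₁ I₂ v₀ E l G m C f) {y : ℝ → E}
    (hy : ContDiffOn ℝ ∞ y I₁) (hyC : ∀ u ∈ I₁, y u ∈ C u) (hu : u ∈ I₁) (hv : v ∈ I₂) :
    IsSectionNear f (u, v) (fun x : ℝ × ℝ => G x.2 (y x.1)) := by
  filter_upwards [h.isOpen_prod.mem_nhds ⟨hu, hv⟩] with x hx
  exact ⟨(h.smooth_evolve hy).contDiffAt (h.isOpen_prod.mem_nhds hx),
    (h.mem_fibre hx.1 hx.2).2 ⟨_, hyC _ hx.1, rfl⟩⟩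

section Dual

variable {h₁ h₂ : ℝ → E}

theorem eq_dual_combination (h : IsEvolvedSurface I₁ I₂ v₀ E l G m C f)
    (hd : IsDualFrame I₁ C (m v₀) (deriv m v₀) h₁ h₂) (hu : u ∈ I₁) {c : E} (hc : c ∈ C u) :
    c = lieForm (m v₀) c • h₁ u + lieForm (deriv m v₀ : E) c • h₂ u := by
  refine h.eq_of_pairing_eq hu hc ((C u).add_mem ((C u).smul_mem _ (hd.mem₁ u hu))
    ((C u).smul_mem _ (hd.mem₂ u hu))) ?_ ?_
  · simp [hd.dual₁₁ u hu, hd.dual₁₂ u hu]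
  · simp [hd.dual₂₁ u hu, hd.dual₂₂ u hu]

/-- Sections of `f` along `u`-parameter lines, in terms of a dual frame. -/
theorem exists_slice_fst (h : IsEvolvedSurface I₁ I₂ v₀ E l G m C f)
    (hd : IsDualFrame I₁ C (m v₀) (deriv m v₀) h₁ h₂) (hu : u ∈ I₁) (hv : v ∈ I₂) {σ : ℝ × ℝ → R42}
    (hσ : IsSectionNear f (u, v) σ) :
    ∃ (a b : ℝ → ℝ) (a' b' : ℝ), HasDerivAt a a' u ∧ HasDerivAt b b' u ∧
      (∀ᶠ s in 𝓝 u, s ∈ I₁ ∧ σ (s, v) = G v (a s • h₁ s + b s • h₂ s : E)) ∧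
      fderiv ℝ σ (u, v) (1, 0) =
        G v (a' • h₁ u + b' • h₂ u + (a u • deriv h₁ u + b u • deriv h₂ u) : E) := by
  have hσd := hasDerivAt_fst_slice (hσ.self_of_nhds.1.differentiableAt (by simp))
  have hτ := ((G v).symm : R42 →L[ℝ] R42).hasFDerivAt.comp_hasDerivAt u hσd
  have ha := (hasDerivAt_const u (m v₀ : R42)).lieForm hτ
  have hb := (hasDerivAt_const u ((deriv m v₀ : E) : R42)).lieForm hτ
  have heq : ∀ᶠ s in 𝓝 u, s ∈ I₁ ∧ σ (s, v) = G v
      (lieForm (m v₀) ((G v).symm (σ (s, v))) • h₁ s +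
        lieForm (deriv m v₀ : E) ((G v).symm (σ (s, v))) • h₂ s : E) := by
    filter_upwards [eventually_fst_slice hσ, h.isOpen.mem_nhds hu] with s hs hsI
    obtain ⟨c, hc, hcx⟩ := (h.mem_fibre hsI hv).1 hs.2
    refine ⟨hsI, ?_⟩
    rw [← hcx, (G v).symm_apply_apply, ← h.eq_dual_combination hd hsI hc]
  refine ⟨_, _, _, _, ha, hb, heq, ?_⟩
  have h1 := ((ha.smul (hd.smooth₁.hasDerivAt h.isOpen hu)).add
    (hb.smul (hd.smooth₂.hasDerivAt h.isOpen hu)))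
  have h2 := ((G v : R42 →L[ℝ] R42).comp E.subtypeL).hasFDerivAt.comp_hasDerivAt u h1
  refine ((hσd.congr_of_eventuallyEq (heq.mono fun s hs => hs.2.symm)).unique h2).trans ?_
  have hkey : ∀ p q r s : E, (r + p) + (s + q) = p + q + (r + s) := fun p q r s => by abel
  exact congrArg (fun z : E => G v z) (hkey _ _ _ _)

theorem deriv_dual_ne_zero (h : IsEvolvedSurface I₁ I₂ v₀ E l G m C f)
    (hd : IsDualFrame I₁ C (m v₀) (deriv m v₀) h₁ h₂) (hu : u ∈ I₁) :
    ¬ (deriv h₁ u = 0 ∧ deriv h₂ u = 0) := by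
  rintro ⟨z1, z2⟩
  have := h.curve.immersive u hu 1 (fun σ hσ => by
    have hσd := (hσ.self_of_nhds.1.differentiableAt (by simp)).hasDerivAt
    have hc := E.subtypeL.hasFDerivAt.comp_hasDerivAt u hσd
    have ha := (hasDerivAt_const u (m v₀ : R42)).lieForm hc
    have hb := (hasDerivAt_const u ((deriv m v₀ : E) : R42)).lieForm hc
    have h1 := ((ha.smul (hd.smooth₁.hasDerivAt h.isOpen hu)).add
    (hb.smul (hd.smooth₂.hasDerivAt h.isOpen hu)))
    rw [z1, z2] at h1
    have heq := (hσd.congr_of_eventuallyEq (by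
      filter_upwards [hσ, h.isOpen.mem_nhds hu] with s hs hsI
      exact (h.eq_dual_combination hd hsI hs.2).symm)).unique h1
    rw [fderiv_eq_smul_deriv, one_smul, heq]
    simp only [smul_zero, zero_add]
    exact (C u).add_mem ((C u).smul_mem _ (hd.mem₁ u hu)) ((C u).smul_mem _ (hd.mem₂ u hu)))
  exact one_ne_zero this

/-- As `f` has no umbilics, a curvature sphere of `C` is not one in the direction `∂/∂v`. -/
theorem m_apply_ne_zero (h : IsEvolvedSurface I₁ I₂ v₀ E l G m C f)
    (hd : IsDualFrame I₁ C (m v₀) (deriv m v₀) h₁ h₂) (hu : u ∈ I₁) (hv : v ∈ I₂)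
    {a b : ℝ} (hab : a ≠ 0 ∨ b ≠ 0)
    (h0 : a • deriv h₁ u + b • deriv h₂ u = 0) :
    lieForm (m v) (a • h₁ u + b • h₂ u : E) ≠ 0 := by
  intro hm
  refine h.umbilicFree (u, v) ⟨hu, hv⟩ ⟨_, h.isCurvatureSphere_vSphere hu hv, ?_⟩
  rintro s ⟨hsf, hs1, hs0⟩
  obtain ⟨⟨d', hd's⟩, hd'0, hd'⟩ := finrank_eq_one_iff'.1 hs1
  obtain ⟨d, hdC, rfl⟩ := (h.mem_fibre hu hv).1 (hsf hd's)
  have hsp := h.isCurvatureSphere_vSphere hu hv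
  by_cases hmd : lieForm (m v) d = 0
  · refine Submodule.eq_of_le_of_finrank_eq (fun x hx => ?_) (hs1.trans hsp.2.1.symm)
    obtain ⟨r, hr⟩ := hd' ⟨x, hx⟩
    rw [← show r • G v (d : R42) = x from congrArg Subtype.val hr]
    exact Submodule.smul_mem _ _ ((h.mem_vSphere hu hv).2 ⟨d, hdC, hmd, rfl⟩)
  exfalso
  obtain ⟨X, hX, hX0⟩ := Submodule.exists_mem_ne_zero_of_ne_bot hs0
  set p := lieForm (m v₀) d
  set q := lieForm (deriv m v₀ : E) d
  have hdpq : d = p • h₁ u + q • h₂ u := h.eq_dual_combination hd hu hdC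
  have hy : ContDiffOn ℝ ∞ (fun s => p • h₁ s + q • h₂ s) I₁ :=
    (hd.smooth₁.const_smul p).add (hd.smooth₂.const_smul q)
  have hyd : deriv (fun s => p • h₁ s + q • h₂ s) u = p • deriv h₁ u + q • deriv h₂ u :=
    (((hd.smooth₁.hasDerivAt h.isOpen hu).const_smul p).add
      ((hd.smooth₂.hasDerivAt h.isOpen hu).const_smul q)).deriv
  have hcur := hX _ (h.isSectionNear_evolve hy (fun s hs => (C s).add_mem
    ((C s).smul_mem _ (hd.mem₁ s hs)) ((C s).smul_mem _ (hd.mem₂ s hs))) hu hv) (by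
      change G v ((p • h₁ u + q • h₂ u : E) : R42) ∈ s
      rw [← hdpq]; exact hd's)
  rw [h.fderiv_evolve hy hu hv, h.apply_mem_fibre hu hv, hyd, ← hdpq] at hcur
  obtain ⟨e1, e2⟩ := hcur
  have hX2 : X.2 = 0 := by
    simpa [hmd] using e2
  have hX1 : X.1 ≠ 0 := fun h' => hX0 (Prod.ext h' hX2)
  have e3 : p • deriv h₁ u + q • deriv h₂ u ∈ C u := by
    have := (C u).smul_mem X.1⁻¹ e1
    rwa [smul_smul, inv_mul_cancel₀ hX1, one_smul] at this
  have e4 : p • deriv h₁ u + q • deriv h₂ u = 0 := by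
    refine h.eq_zero_of_orthogonal hu h.evol.base_mem e3 ?_ ?_
    · simp [pairing_deriv_eq_zero h.isOpen hd.smooth₁ hd.dual₁₁ hu,
        pairing_deriv_eq_zero h.isOpen hd.smooth₂ hd.dual₁₂ hu]
    · simp [pairing_deriv_eq_zero h.isOpen hd.smooth₁ hd.dual₂₁ hu,
        pairing_deriv_eq_zero h.isOpen hd.smooth₂ hd.dual₂₂ hu]
  have hdet : a * q - b * p ≠ 0 := by
    intro hdet
    apply hmd
    rw [hdpq]
    simp only [Submodule.coe_add, Submodule.coe_smul, map_add, map_smul, smul_eq_mul] at hm ⊢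
    rcases hab with ha | hb
    · have : a * (p * lieForm (m v) (h₁ u) + q * lieForm (m v) (h₂ u)) = 0 := by
        linear_combination p * hm + lieForm (m v) (h₂ u) * hdet
      exact (mul_eq_zero.1 this).resolve_left ha
    · have : b * (p * lieForm (m v) (h₁ u) + q * lieForm (m v) (h₂ u)) = 0 := by
        linear_combination q * hm - lieForm (m v) (h₁ u) * hdet
      exact (mul_eq_zero.1 this).resolve_left hb
  refine h.deriv_dual_ne_zero hd hu ⟨?_, ?_⟩
  · have : (a * q - b * p) • deriv h₁ u = 0 := by
      have := congrArg₂ (fun x y => q • x - b • y) h0 e4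
      simp only [smul_zero, sub_zero] at this
      rw [← this]; module
    exact (smul_eq_zero.1 this).resolve_left hdet
  · have : (a * q - b * p) • deriv h₂ u = 0 := by
      have := congrArg₂ (fun x y => a • y - p • x) h0 e4
      simp only [smul_zero, sub_zero] at this
      rw [← this]; module
    exact (smul_eq_zero.1 this).resolve_left hdet

end Dual

/-- Every curve of an evolved surface has an adapted frame, dual to `m v₀` and `m' v₀`. -/
theorem exists_adaptedFrame (h : IsEvolvedSurface I₁ I₂ v₀ E l G m C f) :
    ∃ (h₁ h₂ k : ℝ → E) (φ : ℝ → ℝ),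
      IsAdaptedFrame I₁ I₂ m C (m v₀) (deriv m v₀) h₁ h₂ k φ := by
  obtain ⟨h₁, hs₁, hd₁⟩ := h.exists_dual_section 1 0
  obtain ⟨h₂, hs₂, hd₂⟩ := h.exists_dual_section 0 1
  have hd : IsDualFrame I₁ C (m v₀) (deriv m v₀) h₁ h₂ :=
    ⟨hs₁, hs₂, fun u hu => (hd₁ u hu).1, fun u hu => (hd₂ u hu).1, fun u hu => (hd₁ u hu).2.1,
      fun u hu => (hd₂ u hu).2.1, fun u hu => (hd₁ u hu).2.2, fun u hu => (hd₂ u hu).2.2⟩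
  have hp11 : ∀ u ∈ I₁, lieForm (m v₀) (deriv h₁ u : E) = 0 := fun u hu =>
    pairing_deriv_eq_zero h.isOpen hs₁ hd.dual₁₁ hu
  have hp12 : ∀ u ∈ I₁, lieForm (m v₀) (deriv h₂ u : E) = 0 := fun u hu =>
    pairing_deriv_eq_zero h.isOpen hs₂ hd.dual₁₂ hu
  have hp21 : ∀ u ∈ I₁, lieForm (deriv m v₀ : E) (deriv h₁ u : E) = 0 := fun u hu =>
    pairing_deriv_eq_zero h.isOpen hs₁ hd.dual₂₁ hu
  have hp22 : ∀ u ∈ I₁, lieForm (deriv m v₀ : E) (deriv h₂ u : E) = 0 := fun u hu =>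
    pairing_deriv_eq_zero h.isOpen hs₂ hd.dual₂₂ hu
  have horth : ∀ g : ℝ → E, ContDiffOn ℝ ∞ g I₁ → (∀ u ∈ I₁, g u ∈ C u) → ∀ u ∈ I₁,
      ∀ c ∈ C u, lieForm c (deriv g u : E) = 0 := by
    intro g hg hgC u hu c hc
    have := h.curve.contact u hu g (by
      filter_upwards [h.isOpen.mem_nhds hu] with s hs
      exact ⟨hg.contDiffAt (h.isOpen.mem_nhds hs), hgC s hs⟩) 1 c hc
    rw [fderiv_eq_smul_deriv, one_smul] at this
    rw [lieForm_comm]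
    exact this
  have hk0 : ∀ u ∈ I₁, deriv h₂ u ≠ 0 := by
    intro u hu h0
    refine h.m_apply_ne_zero hd hu h.evol.base_mem (a := 0) (b := 1) (by simp) (by simp [h0]) ?_
    simpa using hd.dual₁₂ u hu
  have hkC : ∀ u ∈ I₁, deriv h₂ u ∉ C u := by
    intro u hu hC
    exact hk0 u hu (h.eq_zero_of_orthogonal hu h.evol.base_mem hC (hp12 u hu) (hp22 u hu))
  have hkpos : ∀ u ∈ I₁, 0 < lieForm (deriv h₂ u : E) (deriv h₂ u : E) := by
    intro u hu
    refine lieForm_self_pos_of_orthogonal ((C u).map E.subtype) ?_ ?_ _ ?_ ?_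
    · rw [Submodule.finrank_map_subtype_eq]; exact h.finrank_curve hu
    · rintro _ ⟨a, ha, rfl⟩ _ ⟨b, hb, rfl⟩
      exact h.null hu ha hb
    · rintro _ ⟨a, ha, rfl⟩
      exact horth h₂ hs₂ hd.mem₂ u hu a ha
    · rintro ⟨a, ha, haa⟩
      exact hkC u hu (Subtype.ext haa ▸ ha)
  set φ : ℝ → ℝ := fun u =>
    -(lieForm (deriv h₁ u : E) (deriv h₂ u : E) / lieForm (deriv h₂ u : E) (deriv h₂ u : E))
    with hφ
  have hφs : ContDiffOn ℝ ∞ φ I₁ := by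
    have e1 : ContDiffOn ℝ ∞ (fun u => ((deriv h₁ u : E) : R42)) I₁ :=
      E.subtypeL.contDiff.comp_contDiffOn (contDiffOn_deriv hs₁ h.isOpen)
    have e2 : ContDiffOn ℝ ∞ (fun u => ((deriv h₂ u : E) : R42)) I₁ :=
      E.subtypeL.contDiff.comp_contDiffOn (contDiffOn_deriv hs₂ h.isOpen)
    exact ((e1.lieForm e2).div (e2.lieForm e2) fun u hu => (hkpos u hu).ne').neg
  have hd1 : ∀ u ∈ I₁, deriv h₁ u = -φ u • deriv h₂ u := by
    intro u hu
    obtain ⟨a, ha, t, hat⟩ := h.exists_eq_add_smul hu (horth h₂ hs₂ hd.mem₂ u hu) (hkC u hu)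
      (horth h₁ hs₁ hd.mem₁ u hu)
    have ha0 : a = 0 := by
      refine h.eq_zero_of_orthogonal hu h.evol.base_mem ha ?_ ?_
      · have := hp11 u hu
        rw [hat] at this
        simpa [hp12 u hu] using this
      · have := hp21 u hu
        rw [hat] at this
        simpa [hp22 u hu] using this
    rw [ha0, zero_add] at hat
    have hpos := (hkpos u hu).ne'
    rw [hφ]
    simp only [hat, Submodule.coe_smul, map_smul, LinearMap.smul_apply, smul_eq_mul, neg_neg]
    rw [mul_div_cancel_right₀ _ hpos]
  have hcs : ContDiffOn ℝ ∞ (fun u => h₁ u + φ u • h₂ u) I₁ := hs₁.add (hφs.smul hs₂)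
  have hcC : ∀ u ∈ I₁, h₁ u + φ u • h₂ u ∈ C u := fun u hu =>
    (C u).add_mem (hd.mem₁ u hu) ((C u).smul_mem _ (hd.mem₂ u hu))
  have hmc : ∀ u ∈ I₁, ∀ v ∈ I₂, lieForm (m v) (h₁ u + φ u • h₂ u : E) ≠ 0 := by
    intro u hu v hv
    have := h.m_apply_ne_zero hd hu hv (a := 1) (b := φ u) (by simp) (by
      rw [hd1 u hu]; module)
    rwa [one_smul] at this
  refine ⟨h₁, h₂, deriv h₂, φ, hd, contDiffOn_deriv hs₂ h.isOpen, hφs, hp12, hp22,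
    horth h₂ hs₂ hd.mem₂, hkpos, fun u hu => ?_, fun u hu => hs₂.hasDerivAt h.isOpen hu, ?_, hmc⟩
  · rw [← hd1 u hu]
    exact hs₁.hasDerivAt h.isOpen hu
  -- regularity of the curvature sphere congruence spanned by `h₁ + φ h₂`
  intro u hu hφ0
  set s : ℝ × ℝ → Submodule ℝ R42 := fun x =>
    Submodule.span ℝ {G x.2 (h₁ x.1 + φ x.1 • h₂ x.1 : E)} with hs
  have hc0 : ∀ u ∈ I₁, h₁ u + φ u • h₂ u ≠ 0 := fun u hu h0 =>
    hmc u hu v₀ h.evol.base_mem (by rw [h0]; simp)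
  have hsm : IsSmoothSubbundle 1 (I₁ ×ˢ I₂) s := by
    rintro x hx
    refine ⟨fun _ x => G x.2 (h₁ x.1 + φ x.1 • h₂ x.1 : E), ?_⟩
    filter_upwards [h.isOpen_prod.mem_nhds hx] with y hy
    refine ⟨fun _ => (h.smooth_evolve hcs).contDiffAt (h.isOpen_prod.mem_nhds hy), ?_, ?_⟩
    · refine LinearIndependent.of_subsingleton 0 ?_
      exact fun h0 => hc0 y.1 hy.1 (Subtype.ext ((G y.2).map_eq_zero_iff.1 h0))
    · rw [Set.range_const]
  have hsle : ∀ x ∈ I₁ ×ˢ I₂, s x ≤ f x := by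
    rintro ⟨u, v⟩ ⟨hu, hv⟩
    rw [hs, Submodule.span_singleton_le_iff_mem]
    exact (h.mem_fibre hu hv).2 ⟨_, hcC u hu, rfl⟩
  have hsec : ∀ u ∈ I₁, ∀ v ∈ I₂, ∀ a b : ℝ, G v (a • h₁ u + b • h₂ u : E) ∈ s (u, v) →
      b = φ u * a := by
    intro u hu v hv a b hab
    obtain ⟨r, hr⟩ := Submodule.mem_span_singleton.1 hab
    rw [← map_smul, ← Submodule.coe_smul] at hr
    have h1 : r • (h₁ u + φ u • h₂ u) = a • h₁ u + b • h₂ u := Subtype.ext ((G v).injective hr)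
    have h2 := congrArg (fun z : E => lieForm (m v₀) z) h1
    have h3 := congrArg (fun z : E => lieForm (deriv m v₀ : E) z) h1
    simp [hd.dual₁₁ u hu, hd.dual₁₂ u hu, hd.dual₂₁ u hu, hd.dual₂₂ u hu] at h2 h3
    rw [← h3, h2, mul_comm]
  have hcurv : ∀ x ∈ I₁ ×ˢ I₂, IsCurvatureSphere f x (s x) := by
    rintro ⟨u, v⟩ ⟨hu, hv⟩
    refine ⟨hsle _ ⟨hu, hv⟩, finrank_of_isSmoothSubbundle_one hsm ⟨hu, hv⟩, fun hbot => ?_⟩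
    have hmem : ((1, 0) : ℝ × ℝ) ∈ curvatureSpace f (u, v) (s (u, v)) := by
      intro σ hσ hσs
      obtain ⟨a, b, a', b', -, -, hab, hder⟩ := h.exists_slice_fst hd hu hv hσ
      rw [hab.self_of_nhds.2] at hσs
      have hb := hsec u hu v hv _ _ hσs
      rw [hder, h.mem_fibre hu hv]
      refine ⟨_, ?_, rfl⟩
      rw [hb, hd1 u hu, show a u • -φ u • deriv h₂ u + (φ u * a u) • deriv h₂ u = 0 by module,
        add_zero]
      exact (C u).add_mem ((C u).smul_mem _ (hd.mem₁ u hu)) ((C u).smul_mem _ (hd.mem₂ u hu))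
    rw [hbot] at hmem
    simp at hmem
  have := h.regular s hsm hcurv (u, v₀) ⟨hu, h.evol.base_mem⟩ (1, 0) (fun σ hσ => by
    have hσf : IsSectionNear f (u, v₀) σ := by
      filter_upwards [hσ, h.isOpen_prod.mem_nhds ⟨hu, h.evol.base_mem⟩] with x hx hxI
      exact ⟨hx.1, hsle x hxI hx.2⟩
    obtain ⟨a, b, a', b', ha, hb, hab, hder⟩ := h.exists_slice_fst hd hu h.evol.base_mem hσf
    have heq : ∀ᶠ t in 𝓝 u, b t = φ t * a t := by
      filter_upwards [hab, eventually_fst_slice hσ] with t ht hts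
      have := hts.2
      rw [ht.2] at this
      exact hsec t ht.1 v₀ h.evol.base_mem _ _ this
    have hb' := (((hφs.hasDerivAt h.isOpen hu).mul ha).congr_of_eventuallyEq heq).unique hb
    rw [hφ0, zero_mul, zero_add] at hb'
    rw [hder, heq.self_of_nhds, ← hb', hd1 u hu, show a' • h₁ u + (φ u * a') • h₂ u +
      (a u • -φ u • deriv h₂ u + (φ u * a u) • deriv h₂ u) = a' • (h₁ u + φ u • h₂ u) by module]
    rw [Submodule.coe_smul, map_smul]
    exact Submodule.smul_mem _ _ (Submodule.mem_span_singleton_self _))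
  simp at this

end IsEvolvedSurface

/-! ### Gauge potentials from potentials of the curve -/

theorem _root_.HasDerivAt.clm_of_apply {V F : Type*} [NormedAddCommGroup V] [NormedSpace ℝ V]
    [NormedAddCommGroup F] [NormedSpace ℝ F]
    {T : ℝ → V →L[ℝ] F} {D : V →L[ℝ] F} {t : ℝ} (hT : DifferentiableAt ℝ T t)
    (h : ∀ z, HasDerivAt (fun s => T s z) (D z) t) : HasDerivAt T D t := by
  refine hT.hasDerivAt.congr_deriv ?_
  ext1 z
  have h1 := hT.hasDerivAt.clm_apply (hasDerivAt_const t z)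
  rw [map_zero, add_zero] at h1
  exact h1.unique (h z)

section WedgeSmooth

variable {V : Type*} [NormedAddCommGroup V] [NormedSpace ℝ V] [FiniteDimensional ℝ V]

theorem _root_.ContDiffOn.wedge {F : Type*} [NormedAddCommGroup F] [NormedSpace ℝ F]
    (B : LinearMap.BilinForm ℝ V) {x y : F → V} {s : Set F} (hx : ContDiffOn ℝ ∞ x s)
    (hy : ContDiffOn ℝ ∞ y s) : ContDiffOn ℝ ∞ (fun t => wedge B (x t) (y t)) s := by
  let b : V →L[ℝ] V →L[ℝ] ℝ := LinearMap.toContinuousBilinearMap B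
  have h1 : ∀ {z : F → V}, ContDiffOn ℝ ∞ z s → ContDiffOn ℝ ∞ (fun t => b (z t)) s :=
    fun hz => b.contDiff.comp_contDiffOn hz
  have h2 := ((h1 hx).smulRight hy).sub ((h1 hy).smulRight hx)
  refine h2.congr fun t _ => ?_
  ext1 z
  simp [wedge_apply, b]

end WedgeSmooth

theorem restrict_comm (E : Submodule ℝ R42) (x y : E) :
    lieForm.restrict E x y = lieForm.restrict E y x := lieForm_comm x y

/-- The orthogonal projection onto `E = l^⊥`. -/
theorem IsEvolution.exists_proj {I : Set ℝ} {v₀ : ℝ} {E : Submodule ℝ R42} {l : R42}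
    {G : ℝ → R42 ≃L[ℝ] R42} {m : ℝ → E} (h : IsEvolution I v₀ E l G m) :
    ∃ π : R42 →L[ℝ] E, (∀ x, (π x : R42) = x - lieForm l x • l) ∧ (∀ x : E, π x = x) ∧
      π l = 0 ∧ ∀ (x : E) (y : R42), lieForm x (π y) = lieForm x y := by
  let π : R42 →L[ℝ] E := LinearMap.toContinuousLinearMap
    ((LinearMap.id - (lieForm l).smulRight l).codRestrict _ (fun x => by
      rw [h.mem_iff]; simp [h.unit]))
  have hπ : ∀ x, (π x : R42) = x - lieForm l x • l := fun x => rfl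
  refine ⟨π, hπ, fun x => Subtype.ext ?_, Subtype.ext ?_, fun x y => ?_⟩
  · rw [hπ, h.l_apply, zero_smul, sub_zero]
  · rw [hπ, h.unit, one_smul, sub_self]; rfl
  · rw [hπ, map_sub, map_smul, h.apply_l, smul_zero, sub_zero]

namespace IsEvolvedSurface

variable {I₁ I₂ : Set ℝ} {v₀ : ℝ} {E : Submodule ℝ R42} {l : R42} {G : ℝ → R42 ≃L[ℝ] R42}
  {m : ℝ → E} {C : ℝ → Submodule ℝ E} {f : ℝ × ℝ → Submodule ℝ R42} {u v : ℝ}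
  {ξ : ℝ → ℝ →L[ℝ] E →L[ℝ] E}

/-- The endomorphism of `R42` given, in the frame `G v`, by an endomorphism of `E`. -/
def conjEnd (G : ℝ → R42 ≃L[ℝ] R42) (π : R42 →L[ℝ] E) (T : ℝ → E →L[ℝ] E) (x : ℝ × ℝ) :
    R42 →L[ℝ] R42 :=
  (G x.2 : R42 →L[ℝ] R42).comp
    ((E.subtypeL.comp ((T x.1).comp π)).comp ((G x.2).symm : R42 →L[ℝ] R42))

theorem conjEnd_apply (π : R42 →L[ℝ] E) (T : ℝ → E →L[ℝ] E) (u v : ℝ) (y : R42) :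
    conjEnd G π T (u, v) (G v y) = G v (T u (π y) : E) := by
  simp [conjEnd]

theorem conj_mem_wedgeSpace (h : IsEvolvedSurface I₁ I₂ v₀ E l G m C f) (hu : u ∈ I₁) (hv : v ∈ I₂)
    {π : R42 →L[ℝ] E} (hπ : ∀ (x : E) (y : R42), lieForm x (π y) = lieForm x y) {T : E →L[ℝ] E}
    (hT : T ∈ wedgeSpace (lieForm.restrict E) (C u) ((lieForm.restrict E).orthogonal (C u))) :
    conjEnd G π (fun _ => T) (u, v) ∈
      wedgeSpace lieForm (f (u, v)) (lieForm.orthogonal (f (u, v))) := by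
  induction hT using Submodule.span_induction with
  | mem T hT =>
    obtain ⟨a, ha, b, hb, rfl⟩ := hT
    refine Submodule.subset_span ⟨G v a, (h.mem_fibre hu hv).2 ⟨a, ha, rfl⟩, G v b, ?_, ?_⟩
    · intro n hn
      obtain ⟨c, hc, rfl⟩ := (h.mem_fibre hu hv).1 hn
      change lieForm (G v c) (G v b) = 0
      rw [h.evol.orthogonal v hv]
      exact hb c hc
    · ext1 y
      obtain ⟨z, rfl⟩ := (G v).surjective y
      have e : ∀ x : E, lieForm.restrict E x (π z) = lieForm x z := fun x => hπ x z
      rw [conjEnd_apply]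
      simp only [wedge_apply, e, h.evol.orthogonal v hv, Submodule.coe_sub, Submodule.coe_smul,
        map_sub, map_smul]
  | zero =>
    convert Submodule.zero_mem _ using 1
    ext1 y; simp [conjEnd]
  | add S T _ _ hS hT =>
    convert Submodule.add_mem _ hS hT using 1
    ext1 y; simp [conjEnd]
  | smul c T _ hT =>
    convert Submodule.smul_mem _ c hT using 1
    ext1 y; simp [conjEnd]

/-- The 1-form `N du + R dv`. -/
def pairForm {F : Type*} [NormedAddCommGroup F] [NormedSpace ℝ F] (N R : ℝ × ℝ → F) (x : ℝ × ℝ) :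
    ℝ × ℝ →L[ℝ] F :=
  (ContinuousLinearMap.fst ℝ ℝ ℝ).smulRight (N x) + (ContinuousLinearMap.snd ℝ ℝ ℝ).smulRight (R x)

theorem pairForm_apply {F : Type*} [NormedAddCommGroup F] [NormedSpace ℝ F] (N R : ℝ × ℝ → F)
    (x X : ℝ × ℝ) : pairForm N R x X = X.1 • N x + X.2 • R x := rfl

theorem contDiffOn_pairForm {F : Type*} [NormedAddCommGroup F] [NormedSpace ℝ F] {N R : ℝ × ℝ → F}
    {Ω : Set (ℝ × ℝ)} (hN : ContDiffOn ℝ ∞ N Ω) (hR : ContDiffOn ℝ ∞ R Ω) :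
    ContDiffOn ℝ ∞ (pairForm N R) Ω :=
  ((ContinuousLinearMap.smulRightL ℝ (ℝ × ℝ) F
    (ContinuousLinearMap.fst ℝ ℝ ℝ)).contDiff.comp_contDiffOn hN).add
    ((ContinuousLinearMap.smulRightL ℝ (ℝ × ℝ) F
    (ContinuousLinearMap.snd ℝ ℝ ℝ)).contDiff.comp_contDiffOn hR)

theorem pairForm_closed {F : Type*} [NormedAddCommGroup F] [NormedSpace ℝ F] {N R : ℝ × ℝ → F}
    {Ω : Set (ℝ × ℝ)} (hΩ : IsOpen Ω) (hN : ContDiffOn ℝ ∞ N Ω) (hR : ContDiffOn ℝ ∞ R Ω)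
    {u v : ℝ} (hx : (u, v) ∈ Ω) {D : F} (hNd : HasDerivAt (fun t => N (u, t)) D v)
    (hRd : HasDerivAt (fun s => R (s, v)) D u) (X Y : ℝ × ℝ) :
    fderiv ℝ (pairForm N R) (u, v) X Y = fderiv ℝ (pairForm N R) (u, v) Y X := by
  have hd := ((contDiffOn_pairForm hN hR).contDiffAt (hΩ.mem_nhds hx)).differentiableAt (by simp)
  set T := fderiv ℝ (pairForm N R) (u, v)
  have h1 : T (1, 0) (0, 1) = D := by
    have e := (hasDerivAt_fst_slice hd).clm_apply (hasDerivAt_const u ((0, 1) : ℝ × ℝ))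
    simp only [pairForm_apply, zero_smul, one_smul, zero_add, add_zero, map_zero] at e
    exact e.unique hRd
  have h2 : T (0, 1) (1, 0) = D := by
    have e := (hasDerivAt_snd_slice hd).clm_apply (hasDerivAt_const v ((1, 0) : ℝ × ℝ))
    simp only [pairForm_apply, zero_smul, one_smul, add_zero, map_zero] at e
    exact e.unique hNd
  rw [clm_prod_apply T X, clm_prod_apply T Y]
  simp only [add_apply, smul_apply]
  rw [clm_prod_apply (T (1, 0)) X, clm_prod_apply (T (1, 0)) Y,
    clm_prod_apply (T (0, 1)) X, clm_prod_apply (T (0, 1)) Y, h1, h2]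
  module

theorem contDiffOn_conjEnd (h : IsEvolvedSurface I₁ I₂ v₀ E l G m C f) (π : R42 →L[ℝ] E)
    {T : ℝ → E →L[ℝ] E} (hT : ContDiffOn ℝ ∞ T I₁) :
    ContDiffOn ℝ ∞ (conjEnd G π T) (I₁ ×ˢ I₂) := by
  have hG : ContDiffOn ℝ ∞ (fun x : ℝ × ℝ => (G x.2 : R42 →L[ℝ] R42)) (I₁ ×ˢ I₂) :=
    h.evol.smooth.comp contDiffOn_snd fun x hx => hx.2
  have hG' : ContDiffOn ℝ ∞ (fun x : ℝ × ℝ => ((G x.2).symm : R42 →L[ℝ] R42)) (I₁ ×ˢ I₂) :=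
    h.evol.smooth_symm.comp contDiffOn_snd fun x hx => hx.2
  have h1 : ContDiffOn ℝ ∞ (fun x : ℝ × ℝ => T x.1) (I₁ ×ˢ I₂) :=
    hT.comp contDiffOn_fst fun x hx => hx.1
  exact hG.clm_comp ((contDiffOn_const.clm_comp (h1.clm_comp contDiffOn_const)).clm_comp hG')

/-- In the frame `G`, the covariant derivative of `T` in the direction `∂/∂v` is `[l ∧ m, T]`. -/
theorem hasDerivAt_conjEnd (h : IsEvolvedSurface I₁ I₂ v₀ E l G m C f) {π : R42 →L[ℝ] E}
    (hπE : ∀ x : E, π x = x) (hπl : π l = 0)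
    (hπp : ∀ (x : E) (y : R42), lieForm x (π y) = lieForm x y)
    {T : ℝ → E →L[ℝ] E} (hT : ContDiffOn ℝ ∞ T I₁) (hu : u ∈ I₁) (hv : v ∈ I₂)
    (hskew : ∀ x y : E, lieForm (T u x) y = -lieForm x (T u y)) :
    HasDerivAt (fun t => conjEnd G π T (u, t))
      (wedge lieForm (G v (T u (m v) : E)) (G v l)) v := by
  have hx := h.isOpen_prod.mem_nhds (show ((u, v) : ℝ × ℝ) ∈ I₁ ×ˢ I₂ from ⟨hu, hv⟩)
  have hd := hasDerivAt_snd_slice (((h.contDiffOn_conjEnd π hT).contDiffAt hx).differentiableAt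
    (by simp))
  refine hd.congr_deriv ?_
  ext1 z
  obtain ⟨y, rfl⟩ := (G v).surjective z
  have e4 : HasDerivAt (fun t => conjEnd G π T (u, t) (G t y)) _ v :=
    hd.clm_apply (h.evol.hasDerivAt v hv y)
  simp only [conjEnd_apply] at e4
  have e7 := e4.unique (h.evol.hasDerivAt_apply_mem hv (T u (π y)))
  rw [← eq_sub_iff_add_eq] at e7
  rw [e7, wedge_apply, h.evol.orthogonal v hv, h.evol.orthogonal v hv, ← hπp (m v),
    ← hπp (T u (m v)),
    hskew]
  simp only [map_sub, map_smul, hπl, hπE, smul_zero, sub_zero, Submodule.coe_smul]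

/-- A value of the quadratic differential of a form on the curve is one of any form on the surface
that extends it along the curve. -/
theorem isQuadDiffValue_conjEnd (h : IsEvolvedSurface I₁ I₂ v₀ E l G m C f) {π : R42 →L[ℝ] E}
    (hπE : ∀ x : E, π x = x) (R : ℝ × ℝ → R42 →L[ℝ] R42) (hu : u ∈ I₁) {X Y q : ℝ}
    (hq : IsQuadDiffValue C ξ u X Y q) :
    IsQuadDiffValue f (pairForm (conjEnd G π fun u => ξ u 1) R) (u, v₀) (X, 0) (Y, 0) q := by
  obtain ⟨M, hM, hMq⟩ := hq
  have hv := h.evol.base_mem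
  let e₀ : C u →ₗ[ℝ] f (u, v₀) := (((G v₀).toLinearEquiv : R42 →ₗ[ℝ] R42).comp
    (E.subtype.comp (C u).subtype)).codRestrict _ fun c =>
      (h.mem_fibre hu hv).2 ⟨c, c.2, rfl⟩
  let e : C u ≃ₗ[ℝ] f (u, v₀) := LinearEquiv.ofBijective e₀ (by
    constructor
    · intro c d hcd
      exact Subtype.ext (Subtype.ext ((G v₀).injective (congrArg Subtype.val hcd)))
    · rintro ⟨x, hx⟩
      obtain ⟨c, hc, rfl⟩ := (h.mem_fibre hu hv).1 hx
      exact ⟨⟨c, hc⟩, rfl⟩)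
  have he : ∀ c, (e c : R42) = G v₀ (c : E) := fun c => rfl
  refine ⟨e.conj M, fun σ hσ hσx => ?_, (LinearMap.trace_conj' M e).trans hMq⟩
  let T : R42 →L[ℝ] E := π.comp ((G v₀).symm : R42 →L[ℝ] R42)
  have hT : ∀ y, T (G v₀ y) = π y := fun y => by simp [T]
  have hmem : ∀ s ∈ I₁, σ (s, v₀) ∈ f (s, v₀) →
      T (σ (s, v₀)) ∈ C s ∧ G v₀ (T (σ (s, v₀)) : E) = σ (s, v₀) := by
    intro s hs hsσ
    obtain ⟨c, hc, hcx⟩ := (h.mem_fibre hs hv).1 hsσ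
    rw [← hcx, hT, hπE]
    exact ⟨hc, rfl⟩
  have hτ : IsSectionNear C u (fun s => T (σ (s, v₀))) := by
    filter_upwards [eventually_fst_slice hσ, h.isOpen.mem_nhds hu] with s hs hsI
    refine ⟨T.contDiff.contDiffAt.comp s (hs.1.comp s ?_), (hmem s hsI hs.2).1⟩
    exact contDiffAt_id.prodMk contDiffAt_const
  have hτC := hτ.self_of_nhds.2
  have hes : e.symm ⟨σ (u, v₀), hσx⟩ = ⟨T (σ (u, v₀)), hτC⟩ := by
    rw [LinearEquiv.symm_apply_eq]
    exact Subtype.ext (hmem u hu hσx).2.symm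
  have hd := T.hasFDerivAt.comp_hasDerivAt u
    (hasDerivAt_fst_slice (hσ.self_of_nhds.1.differentiableAt (by simp)))
  have hfd : fderiv ℝ (fun s => T (σ (s, v₀))) u Y = T (fderiv ℝ σ (u, v₀) (Y, 0)) := by
    rw [fderiv_eq_smul_deriv]
    rw [show deriv (fun s => T (σ (s, v₀))) u = _ from hd.deriv,
      clm_prod_apply (fderiv ℝ σ (u, v₀)) (Y, 0)]
    simp
  obtain ⟨y, hy⟩ := (G v₀).surjective (fderiv ℝ σ (u, v₀) (Y, 0))
  have hξX : ξ u X = X • ξ u 1 := by rw [← map_smul, smul_eq_mul, mul_one]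
  rw [LinearEquiv.conj_apply_apply, hes, he, hM _ hτ hτC, hfd, pairForm_apply, zero_smul, add_zero,
    ← hy, hT, smul_apply, conjEnd_apply, hξX, smul_apply, Submodule.coe_smul, map_smul]

/-- A gauge potential `ξ` of the curve extends to one of the surface as soon as, for every `v`,
there is a section `p` of the curve with `p' = -ξ m(v)`: in the frame `G` it is
`ξ + (l ∧ p) dv`. -/
theorem isLieApplicable_of_potential (h : IsEvolvedSurface I₁ I₂ v₀ E l G m C f)
    (hξ : IsGaugePotential (lieForm.restrict E) I₁ C ξ) {p : ℝ × ℝ → E}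
    (hp : ContDiffOn ℝ ∞ p (I₁ ×ˢ I₂)) (hpC : ∀ u ∈ I₁, ∀ v ∈ I₂, p (u, v) ∈ C u)
    (hpd : ∀ u ∈ I₁, ∀ v ∈ I₂, HasDerivAt (fun s => p (s, v)) (-ξ u 1 (m v)) u) :
    IsLieApplicable lieForm (I₁ ×ˢ I₂) f := by
  obtain ⟨π, -, hπE, hπl, hπp⟩ := h.evol.exists_proj
  set N := conjEnd G π fun u => ξ u 1 with hNdef
  let R : ℝ × ℝ → R42 →L[ℝ] R42 := fun x => -wedge lieForm (G x.2 (p x)) (G x.2 l)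
  have hR : ∀ u v, v ∈ I₂ → ∀ y, R (u, v) (G v y) =
      G v (lieForm l y • (p (u, v) : R42) - lieForm (p (u, v)) y • l) := fun u v hv y => by
    simp only [R, neg_apply, wedge_apply, h.evol.orthogonal v hv, map_sub, map_smul]
    abel
  have hG : ContDiffOn ℝ ∞ (fun x : ℝ × ℝ => (G x.2 : R42 →L[ℝ] R42)) (I₁ ×ˢ I₂) :=
    h.evol.smooth.comp contDiffOn_snd fun x hx => hx.2
  have hξ1 : ContDiffOn ℝ ∞ (fun u => ξ u 1) I₁ := hξ.smooth.clm_apply contDiffOn_const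
  have hNs : ContDiffOn ℝ ∞ N (I₁ ×ˢ I₂) := h.contDiffOn_conjEnd π hξ1
  have hRs : ContDiffOn ℝ ∞ R (I₁ ×ˢ I₂) :=
    (ContDiffOn.wedge lieForm (hG.clm_apply (E.subtypeL.contDiff.comp_contDiffOn hp))
      (hG.clm_apply contDiffOn_const)).neg
  have hskew : ∀ u ∈ I₁, ∀ x y : E, lieForm (ξ u 1 x) y = -lieForm x (ξ u 1 y) := fun u hu x y =>
    skew_of_mem_wedgeSpace (restrict_comm E) (hξ.mem u hu 1) x y
  have hker : ∀ u ∈ I₁, ∀ x ∈ C u, ξ u 1 x = 0 := fun u hu x hx =>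
    apply_eq_zero_of_mem_wedgeSpace (restrict_comm E) (h.curve.null u hu) (hξ.mem u hu 1) hx
  refine ⟨pairForm N R, contDiffOn_pairForm hNs hRs, ?_, ?_, ?_, ?_⟩
  · rintro ⟨u, v⟩ ⟨hu, hv⟩ X
    rw [pairForm_apply]
    refine Submodule.add_mem _ (Submodule.smul_mem _ _
      (h.conj_mem_wedgeSpace hu hv hπp (hξ.mem u hu 1))) (Submodule.smul_mem _ _
      (Submodule.neg_mem _ (Submodule.subset_span ⟨_, (h.mem_fibre hu hv).2
        ⟨_, hpC u hu v hv, rfl⟩, _, ?_, rfl⟩)))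
    intro n hn
    obtain ⟨c, hc, rfl⟩ := (h.mem_fibre hu hv).1 hn
    change lieForm (G v c) (G v l) = 0
    rw [h.evol.orthogonal v hv, h.evol.apply_l]
  · rintro ⟨u, v⟩ ⟨hu, hv⟩ X Y
    refine pairForm_closed h.isOpen_prod hNs hRs ⟨hu, hv⟩
      (h.hasDerivAt_conjEnd hπE hπl hπp hξ1 hu hv (hskew u hu)) ?_ X Y
    have d1 := ((G v : R42 →L[ℝ] R42).comp E.subtypeL).hasFDerivAt.comp_hasDerivAt u (hpd u hu v hv)
    refine HasDerivAt.clm_of_apply ?_ fun z => ?_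
    · exact (hasDerivAt_fst_slice ((hRs.contDiffAt (h.isOpen_prod.mem_nhds
        (show ((u, v) : ℝ × ℝ) ∈ I₁ ×ˢ I₂ from ⟨hu, hv⟩))).differentiableAt
          (by simp))).differentiableAt
    have d2 := (((d1.lieForm (hasDerivAt_const u z)).smul_const (G v l)).sub
      (d1.const_smul (lieForm (G v l) z))).neg
    refine d2.congr_deriv ?_
    simp [wedge_apply]
    abel
  · rintro ⟨u, v⟩ ⟨hu, hv⟩ X Y
    have h1 : (N (u, v)).comp (R (u, v)) = 0 := by
      ext1 z
      obtain ⟨y, rfl⟩ := (G v).surjective z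
      rw [ContinuousLinearMap.comp_apply, hR u v hv, hNdef, conjEnd_apply, map_sub, map_smul,
        map_smul, hπl, hπE, map_sub, map_smul, hker u hu _ (hpC u hu v hv)]
      simp
    have h2 : (R (u, v)).comp (N (u, v)) = 0 := by
      ext1 z
      obtain ⟨y, rfl⟩ := (G v).surjective z
      have := hskew u hu (p (u, v)) (π y)
      rw [hker u hu _ (hpC u hu v hv)] at this
      rw [ContinuousLinearMap.comp_apply, hNdef, conjEnd_apply, hR u v hv, h.evol.l_apply]
      simp only [ZeroMemClass.coe_zero, map_zero, LinearMap.zero_apply, zero_eq_neg] at this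
      simp [this]
    simp only [pairForm_apply, ContinuousLinearMap.comp_add, ContinuousLinearMap.add_comp,
      ContinuousLinearMap.comp_smul, ContinuousLinearMap.smul_comp, h1, h2]
    module
  · obtain ⟨u, hu, X, Y, q, hq, hq0⟩ := hξ.quad_ne_zero
    exact ⟨(u, v₀), ⟨hu, h.evol.base_mem⟩, _, _, q, h.isQuadDiffValue_conjEnd hπE R hu hq, hq0⟩

end IsEvolvedSurface

/-! ### Potentials in an adapted frame -/

section FramePotential

variable {E : Submodule ℝ R42}

/-- A `1`-form on an interval is closed. -/
theorem clm_real_comm {F : Type*} [NormedAddCommGroup F] [NormedSpace ℝ F] (T : ℝ →L[ℝ] ℝ →L[ℝ] F)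
    (X Y : ℝ) : T X Y = T Y X := by
  have h : ∀ X Y : ℝ, T X Y = (X * Y) • T 1 1 := fun X Y => by
    have h1 : T X = X • T 1 := by rw [← map_smul, smul_eq_mul, mul_one]
    have h2 : T 1 Y = Y • T 1 1 := by rw [← map_smul, smul_eq_mul, mul_one]
    rw [h1, smul_apply, h2, smul_smul]
  rw [h X Y, h Y X, mul_comm]

theorem _root_.ContDiffOn.id_smulRight {F : Type*} [NormedAddCommGroup F] [NormedSpace ℝ F]
    {g : ℝ → F}
    {s : Set ℝ} (hg : ContDiffOn ℝ ∞ g s) :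
    ContDiffOn ℝ ∞ (fun u => (ContinuousLinearMap.id ℝ ℝ).smulRight (g u)) s :=
  (ContinuousLinearMap.smulRightL ℝ ℝ F (ContinuousLinearMap.id ℝ ℝ)).contDiff.comp_contDiffOn hg

/-- The form `(ρ h₂ ∧ k + κ h₁ ∧ h₂) du`. Every potential of the curve has this shape up to the
exact forms `d(τ h₁ ∧ h₂)`. -/
def framePotential (h₁ h₂ k : ℝ → E) (ρ κ : ℝ → ℝ) (u : ℝ) : ℝ →L[ℝ] E →L[ℝ] E :=
  (ContinuousLinearMap.id ℝ ℝ).smulRight (ρ u • wedge (lieForm.restrict E) (h₂ u) (k u) +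
    κ u • wedge (lieForm.restrict E) (h₁ u) (h₂ u))

theorem framePotential_apply (h₁ h₂ k : ℝ → E) (ρ κ : ℝ → ℝ) (u X : ℝ) (y : E) :
    framePotential h₁ h₂ k ρ κ u X y =
      X • (ρ u • (lieForm (h₂ u) y • k u - lieForm (k u) y • h₂ u) +
        κ u • (lieForm (h₁ u) y • h₂ u - lieForm (h₂ u) y • h₁ u)) := by
  simp [framePotential, wedge_apply]

end FramePotential

namespace IsEvolvedSurface

variable {I₁ I₂ : Set ℝ} {v₀ : ℝ} {E : Submodule ℝ R42} {l : R42} {G : ℝ → R42 ≃L[ℝ] R42}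
  {m : ℝ → E} {C : ℝ → Submodule ℝ E} {f : ℝ × ℝ → Submodule ℝ R42} {u v : ℝ}
  {h₁ h₂ k : ℝ → E} {φ : ℝ → ℝ}

/-- The quadratic differential of `framePotential` is `-ρ (k, k) du²`. -/
theorem isGaugePotential_framePotential (h : IsEvolvedSurface I₁ I₂ v₀ E l G m C f)
    (F : IsAdaptedFrame I₁ I₂ m C (m v₀) (deriv m v₀) h₁ h₂ k φ) {ρ κ : ℝ → ℝ}
    (hρ : ContDiffOn ℝ ∞ ρ I₁) (hκ : ContDiffOn ℝ ∞ κ I₁) (hρ0 : ∃ u ∈ I₁, ρ u ≠ 0) :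
    IsGaugePotential (lieForm.restrict E) I₁ C (framePotential h₁ h₂ k ρ κ) := by
  have hlin : ∀ u (X : ℝ), framePotential h₁ h₂ k ρ κ u X = X • framePotential h₁ h₂ k ρ κ u 1 := by
    intro u X
    rw [← map_smul, smul_eq_mul, mul_one]
  refine ⟨?_, ?_, ?_, ?_, ?_⟩
  · exact ContDiffOn.id_smulRight ((hρ.smul (ContDiffOn.wedge _ F.smooth₂ F.smooth_k)).add
      (hκ.smul (ContDiffOn.wedge _ F.smooth₁ F.smooth₂)))
  · intro u hu X
    refine Submodule.smul_mem _ _ (Submodule.add_mem _ (Submodule.smul_mem _ _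
      (Submodule.subset_span ⟨_, F.mem₂ u hu, _, F.orth_k u hu, rfl⟩)) (Submodule.smul_mem _ _
      (Submodule.subset_span ⟨_, F.mem₁ u hu, _, ?_, rfl⟩)))
    exact fun c hc => h.null hu hc (F.mem₂ u hu)
  · exact fun u _ X Y => clm_real_comm _ X Y
  · intro u _ X Y
    rw [hlin u X, hlin u Y]
    simp only [ContinuousLinearMap.smul_comp, ContinuousLinearMap.comp_smul]
    rw [smul_comm]
  · obtain ⟨u, hu, hρu⟩ := hρ0
    have hk := (F.k_pos u hu).ne'
    refine ⟨u, hu, 1, 1, -(ρ u * lieForm (k u) (k u)), ?_, neg_ne_zero.2 (mul_ne_zero hρu hk)⟩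
    -- on sections, `σ ↦ ξ σ'` is a multiple of `h₂`, as `σ'` is a multiple of `k` modulo `C`
    let g : E →ₗ[ℝ] ℝ := (φ u • lieForm (m v₀) - lieForm (deriv m v₀ : E)).comp E.subtype
    let M : C u →ₗ[ℝ] C u := (g.comp (C u).subtype).smulRight
      ((ρ u * lieForm (k u) (k u)) • ⟨h₂ u, F.mem₂ u hu⟩)
    have hM : ∀ c : C u, (M c : E) = (φ u * lieForm (m v₀) (c : E) -
        lieForm (deriv m v₀ : E) (c : E)) • (ρ u * lieForm (k u) (k u)) • h₂ u := fun c => rfl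
    refine ⟨M, fun σ hσ hσu => ?_, ?_⟩
    · have hσd := (hσ.self_of_nhds.1.differentiableAt (by simp)).hasDerivAt
      have hc := E.subtypeL.hasFDerivAt.comp_hasDerivAt u hσd
      have ha := (hasDerivAt_const u (m v₀ : R42)).lieForm hc
      have hb := (hasDerivAt_const u ((deriv m v₀ : E) : R42)).lieForm hc
      have h1 := (ha.smul (F.hasDerivAt₁ u hu)).add (hb.smul (F.hasDerivAt₂ u hu))
      have heq := (hσd.congr_of_eventuallyEq (by
        filter_upwards [hσ, h.isOpen.mem_nhds hu] with s hs hsI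
        exact (h.eq_dual_combination F.toIsDualFrame hsI hs.2).symm)).unique h1
      rw [hM, fderiv_eq_smul_deriv, one_smul, heq, framePotential_apply]
      have o1 := h.null hu (F.mem₁ u hu) (F.mem₁ u hu)
      have o2 := h.null hu (F.mem₁ u hu) (F.mem₂ u hu)
      have o3 := h.null hu (F.mem₂ u hu) (F.mem₁ u hu)
      have o4 := h.null hu (F.mem₂ u hu) (F.mem₂ u hu)
      have o5 := F.orth_k u hu _ (F.mem₁ u hu)
      have o6 := F.orth_k u hu _ (F.mem₂ u hu)
      have o7 := lieForm_comm (k u) (h₁ u)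
      have o8 := lieForm_comm (k u) (h₂ u)
      rw [o5] at o7
      rw [o6] at o8
      simp only [Submodule.coe_add, Submodule.coe_smul, map_add, map_smul, smul_eq_mul, o1, o2, o3,
        o4, o5, o6, o7, o8, Submodule.subtypeL_apply, Function.comp_apply]
      module
    · rw [trace_eq_of_dual (F.mem₁ u hu) (F.mem₂ u hu)
        (fun c hc => ⟨_, _, h.eq_dual_combination F.toIsDualFrame hu hc⟩)
        ((lieForm (m v₀)).comp E.subtype) ((lieForm (deriv m v₀ : E)).comp E.subtype)
        (F.dual₁₁ u hu) (F.dual₁₂ u hu) (F.dual₂₁ u hu) (F.dual₂₂ u hu)]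
      simp only [hM, LinearMap.comp_apply, Submodule.subtype_apply, map_smul,
        F.dual₁₁ u hu, F.dual₁₂ u hu, F.dual₂₁ u hu, F.dual₂₂ u hu, smul_eq_mul]
      ring

/-! ### Two families of spherical curvature lines -/

/-- **Joachimsthal's theorem.** If the `v`-parameter lines are spherical, the surface meets the
spheres at a constant angle along each of them. In Lie geometry: some non-zero vector of `E` is
orthogonal to `C u` and to all `m v`; up to a factor it is the normal `k u`. -/
theorem m_apply_k_eq_zero_of_spherical (h : IsEvolvedSurface I₁ I₂ v₀ E l G m C f)
    (F : IsAdaptedFrame I₁ I₂ m C (m v₀) (deriv m v₀) h₁ h₂ k φ)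
    (hs : HasSphericalCurvatureLines lieForm (I₁ ×ˢ I₂) f (0, 1)) (hu : u ∈ I₁) (hv : v ∈ I₂) :
    lieForm (m v) (k u) = 0 := by
  obtain ⟨-, p, ν, hp, hνs, hνn, hνc, hνf, -⟩ := hs
  have hv₀ := h.evol.base_mem
  obtain ⟨n, hnν, hn0⟩ : ∃ n ∈ ν (u, v₀), n ≠ 0 := by
    have h1 := finrank_of_isSmoothSubbundle_one hνs (x := (u, v₀)) ⟨hu, hv₀⟩
    have h2 : ν (u, v₀) ≠ ⊥ := by
      intro h0
      rw [h0, finrank_bot] at h1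
      exact zero_ne_one h1
    exact Submodule.exists_mem_ne_zero_of_ne_bot h2
  have hnn : lieForm n n = 0 := hνn (u, v₀) ⟨hu, hv₀⟩ n hnν
  have hnv : ∀ w ∈ I₂, n ∈ ν (u, w) := by
    intro w hw
    have := hνc (u, v₀) ⟨hu, hv₀⟩ (w - v₀) (by
      rintro x ⟨a, b, ha, hb, hab, rfl⟩
      constructor
      · have : u = a * u + b * u := by rw [← add_mul, hab, one_mul]
        simpa [← this] using hu
      · have : a * v₀ + b * w ∈ I₂ := h.evol.ordConnected.convex hv₀ hw ha hb hab
        simpa using this)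
    simp at this
    rw [this]
    exact hnν
  -- the functionals `p`, `n` and `m` on the plane `C u`, in the basis `h₁, h₂`
  set a := h₁ u
  set b := h₂ u
  have haC := F.mem₁ u hu
  have hbC := F.mem₂ u hu
  have hG : ∀ x : E, ∀ w ∈ I₂, ∀ y : R42, HasDerivAt (fun w => lieForm y (G w x))
      (-(lieForm (m w) x * lieForm y (G w l))) w := by
    intro x w hw y
    have := (hasDerivAt_const w y).lieForm (h.evol.hasDerivAt_apply_mem hw x)
    refine this.congr_deriv ?_
    simp
  -- the timelike vector `p` is not orthogonal to a null plane
  have hpf : ∀ w ∈ I₂, lieForm p (G w a) = 0 → lieForm p (G w b) = 0 → False := by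
    intro w hw h1 h2
    have hpos := lieForm_self_pos_of_orthogonal (f (u, w)) ?_ ?_ p ?_ ?_
    · rw [hp] at hpos; linarith
    · rw [h.fibre u hu w hw]
      rw [LinearEquiv.finrank_map_eq (G w).toLinearEquiv, Submodule.finrank_map_subtype_eq,
        h.finrank_curve hu]
    · exact h.legendre.null (u, w) ⟨hu, hw⟩
    · intro x hx
      obtain ⟨c, hc, rfl⟩ := (h.mem_fibre hu hw).1 hx
      rw [lieForm_comm, h.eq_dual_combination F.toIsDualFrame hu hc, Submodule.coe_add, map_add,
        Submodule.coe_smul, Submodule.coe_smul, map_smul, map_smul, map_add, map_smul, map_smul, h1,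
        h2]
      simp
    · intro hpf
      have := h.legendre.null (u, w) ⟨hu, hw⟩ p hpf p hpf
      rw [hp] at this
      norm_num at this
  have hprop : ∀ w ∈ I₂, lieForm p (G w b) * lieForm n (G w a) =
      lieForm p (G w a) * lieForm n (G w b) := by
    intro w hw
    have := hνf (u, w) ⟨hu, hw⟩ (G w (lieForm p (G w b) • a - lieForm p (G w a) • b : E))
      ((h.mem_fibre hu hw).2 ⟨_, (C u).sub_mem ((C u).smul_mem _ haC) ((C u).smul_mem _ hbC), rfl⟩)
      (by simp; ring) n (hnv w hw)
    simp at this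
    linarith
  set q : ℝ → ℝ := fun w => lieForm p (G w a) ^ 2 + lieForm p (G w b) ^ 2 with hq
  have hq0 : ∀ w ∈ I₂, q w ≠ 0 := by
    intro w hw h0
    refine hpf w hw ?_ ?_ <;> simp only [hq] at h0 <;> nlinarith [sq_nonneg (lieForm p (G w a)),
      sq_nonneg (lieForm p (G w b))]
  -- the proportionality factor of the functionals `n` and `p`
  set c : ℝ → ℝ := fun w => (lieForm n (G w a) * lieForm p (G w a) +
    lieForm n (G w b) * lieForm p (G w b)) / q w with hc
  have hca : ∀ w ∈ I₂, lieForm n (G w a) = c w * lieForm p (G w a) := by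
    intro w hw
    have := hprop w hw
    have := hq0 w hw
    simp only [hc]
    field_simp
    simp only [hq]
    linear_combination lieForm p (G w b) * hprop w hw
  have hcb : ∀ w ∈ I₂, lieForm n (G w b) = c w * lieForm p (G w b) := by
    intro w hw
    have := hprop w hw
    have := hq0 w hw
    simp only [hc]
    field_simp
    simp only [hq]
    linear_combination -lieForm p (G w a) * hprop w hw
  have hGs : ∀ (y : R42) (x : E), ContDiffOn ℝ ∞ (fun w => lieForm y (G w x)) I₂ := fun y x =>
    contDiffOn_const.lieForm (h.evol.smooth.clm_apply contDiffOn_const)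
  have hcs : ContDiffOn ℝ ∞ c I₂ :=
    (((hGs n a).mul (hGs p a)).add ((hGs n b).mul (hGs p b))).div
      (((hGs p a).pow 2).add ((hGs p b).pow 2)) hq0
  have hrel : ∀ x : E, (∀ w ∈ I₂, lieForm n (G w x) = c w * lieForm p (G w x)) → ∀ w ∈ I₂,
      deriv c w * lieForm p (G w x) =
        (c w * lieForm p (G w l) - lieForm n (G w l)) * lieForm (m w) x := by
    intro x hx w hw
    have h1 := (hcs.hasDerivAt h.evol.isOpen hw).mul (hG x w hw p)
    have h2 := ((hG x w hw n).congr_of_eventuallyEq (f₁ := fun w => c w * lieForm p (G w x)) (by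
      filter_upwards [h.evol.isOpen.mem_nhds hw] with w hw using (hx w hw).symm)).unique h1
    linarith
  -- where `c' ≠ 0`, the functionals `m` and `p` would be proportional on `C u`, and by
  -- differentiation so would `m'`, against the independence of `m` and `m'`
  have hc' : ∀ w ∈ I₂, deriv c w = 0 := by
    intro w hw
    by_contra hne
    have hev : ∀ᶠ t in 𝓝 w, t ∈ I₂ ∧ deriv c t ≠ 0 := by
      filter_upwards [h.evol.isOpen.mem_nhds hw, ((contDiffOn_deriv hcs
        h.evol.isOpen).continuousOn.continuousAt (h.evol.isOpen.mem_nhds hw)).eventually_ne hne]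
        with t ht1 ht2 using ⟨ht1, ht2⟩
    have hdet : ∀ t, t ∈ I₂ ∧ deriv c t ≠ 0 →
        lieForm (m t) a * lieForm p (G t b) - lieForm (m t) b * lieForm p (G t a) = 0 := by
      rintro t ⟨ht, hct⟩
      have h1 := hrel a hca t ht
      have h2 := hrel b hcb t ht
      have : deriv c t * (lieForm (m t) a * lieForm p (G t b) - lieForm (m t) b * lieForm p (G t a))
          = 0 := by
        linear_combination lieForm (m t) a * h2 - lieForm (m t) b * h1
      exact (mul_eq_zero.1 this).resolve_left hct
    have hma := (h.evol.hasDerivAt_m hw).lieForm (hasDerivAt_const w (a : R42))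
    have hmb := (h.evol.hasDerivAt_m hw).lieForm (hasDerivAt_const w (b : R42))
    have hd := (hma.mul (hG b w hw p)).sub (hmb.mul (hG a w hw p))
    have hd0 := (hd.congr_of_eventuallyEq (f₁ := fun _ => (0 : ℝ))
      (hev.mono fun t ht => (hdet t ht).symm)).unique (hasDerivAt_const w 0)
    have hz : lieForm p (G w b) • a - lieForm p (G w a) • b = 0 := by
      refine h.eq_zero_of_orthogonal hu hw ((C u).sub_mem ((C u).smul_mem _ haC)
        ((C u).smul_mem _ hbC)) ?_ ?_
      · simp
        linear_combination hdet w ⟨hw, hne⟩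
      · simp
        simp only [map_zero, add_zero] at hd0
        linear_combination hd0
    have h1 := congrArg (fun x : E => lieForm (m v₀) x) hz
    have h2 := congrArg (fun x : E => lieForm (deriv m v₀ : E) x) hz
    simp [a, b, F.dual₁₁ u hu, F.dual₁₂ u hu, F.dual₂₁ u hu, F.dual₂₂ u hu] at h1 h2
    exact hpf w hw h2 h1
  have hcc : ∀ w ∈ I₂, c w = c v₀ := fun w hw =>
    constant_of_hasDerivAt_zero h.evol.isOpen h.evol.ordConnected (fun t ht => by
      rw [← hc' t ht]; exact hcs.hasDerivAt h.evol.isOpen ht) hw hv₀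
  -- this vector is orthogonal to `C u` in the frame `G`, and turns out to be fixed by `G`
  set K : R42 := n - c v₀ • p with hK
  have hKl : ∀ w ∈ I₂, lieForm K (G w l) = 0 := by
    intro w hw
    by_contra hne
    have h1 := hrel a hca w hw
    have h2 := hrel b hcb w hw
    rw [hc' w hw, zero_mul, hcc w hw] at h1 h2
    have hne' : c v₀ * lieForm p (G w l) - lieForm n (G w l) ≠ 0 := by
      intro h0
      apply hne
      simp [hK]
      linarith
    refine h.m_ne_zero hu hw fun d hd => ?_
    rw [h.eq_dual_combination F.toIsDualFrame hu hd]
    have e1 := (mul_eq_zero.1 h1.symm).resolve_left hne'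
    have e2 := (mul_eq_zero.1 h2.symm).resolve_left hne'
    simp only [a, b] at e1 e2
    simp [e1, e2]
  have hKG : ∀ x : E, ∀ w ∈ I₂, lieForm K (G w x) = lieForm K x := by
    intro x w hw
    have := constant_of_hasDerivAt_zero h.evol.isOpen h.evol.ordConnected (fun t ht => by
      have := hG x t ht K
      rwa [hKl t ht, mul_zero, neg_zero] at this) hw hv₀
    rw [this, h.evol.base]
    simp
  have hKm : ∀ w ∈ I₂, lieForm (m w) K = 0 := by
    intro w hw
    have h1 := (hasDerivAt_const w K).lieForm (h.evol.hasDerivAt w hw l)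
    have h2 := (h1.congr_of_eventuallyEq (f₁ := fun _ => (0 : ℝ)) (by
      filter_upwards [h.evol.isOpen.mem_nhds hw] with t ht using (hKl t ht).symm)).unique
      (hasDerivAt_const w 0)
    rw [h.evol.unit, h.evol.apply_l, one_smul, zero_smul, sub_zero, hKG _ w hw] at h2
    rw [lieForm_comm]
    simpa using h2
  have hKE : K ∈ E := by
    rw [h.evol.mem_iff, lieForm_comm]
    simpa [h.evol.base] using hKl v₀ hv₀
  have hKC : ∀ d ∈ C u, lieForm d (⟨K, hKE⟩ : E) = 0 := by
    intro d hd
    have e1 : lieForm K a = 0 := by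
      rw [← hKG a v₀ hv₀]; simp [hK, hca v₀ hv₀]
    have e2 : lieForm K b = 0 := by
      rw [← hKG b v₀ hv₀]; simp [hK, hcb v₀ hv₀]
    rw [lieForm_comm, h.eq_dual_combination F.toIsDualFrame hu hd]
    simp only [a, b] at e1 e2
    simp [e1, e2]
  have hkC : k u ∉ C u := fun hk => (F.k_pos u hu).ne' (h.null hu hk hk)
  obtain ⟨d, hd, t, hdt⟩ := h.exists_eq_add_smul hu (F.orth_k u hu) hkC hKC
  have hK' : (K : R42) = (d : R42) + t • (k u : R42) := congrArg Subtype.val hdt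
  have hKm' : lieForm (deriv m v₀ : E) K = 0 := by
    have h1 := (h.evol.hasDerivAt_m hv₀).lieForm (hasDerivAt_const v₀ K)
    have h2 := (h1.congr_of_eventuallyEq (f₁ := fun _ => (0 : ℝ)) (by
      filter_upwards [h.evol.isOpen.mem_nhds hv₀] with t ht using (hKm t ht).symm)).unique
      (hasDerivAt_const v₀ 0)
    simpa using h2
  have hd0 : d = 0 := by
    refine h.eq_zero_of_orthogonal hu hv₀ hd ?_ ?_
    · have := hKm v₀ hv₀
      rw [hK'] at this
      simpa [F.a_k u hu] using this
    · rw [hK'] at hKm'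
      simpa [F.b_k u hu] using hKm'
  rw [hd0, ZeroMemClass.coe_zero, zero_add] at hK'
  -- otherwise `n` is a multiple of `p`, but `n` is null
  have ht0 : t ≠ 0 := by
    rintro rfl
    rw [zero_smul] at hK'
    have hnp : n = c v₀ • p := sub_eq_zero.1 hK'
    have := hnn
    rw [hnp] at this
    simp [hp] at this
    exact hn0 (by rw [hnp, this, zero_smul])
  have := hKm v hv
  rw [hK', map_smul, smul_eq_mul] at this
  exact (mul_eq_zero.1 this).resolve_left ht0

/-- As `(k, m) = 0`, the section `p = (h₂, m) h₂` satisfies `p' = (h₂, m) k = (h₂ ∧ k) m`. -/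
theorem isLieApplicable_of_spherical (h : IsEvolvedSurface I₁ I₂ v₀ E l G m C f)
    (hne : I₁.Nonempty) (hs : HasSphericalCurvatureLines lieForm (I₁ ×ˢ I₂) f (0, 1)) :
    IsLieApplicable lieForm (I₁ ×ˢ I₂) f := by
  obtain ⟨h₁, h₂, k, φ, F⟩ := h.exists_adaptedFrame
  have hmk := fun {u v} (hu : u ∈ I₁) (hv : v ∈ I₂) => h.m_apply_k_eq_zero_of_spherical F hs hu hv
  obtain ⟨u₁, hu₁⟩ := hne
  have hh₂ : ContDiffOn ℝ ∞ (fun x : ℝ × ℝ => h₂ x.1) (I₁ ×ˢ I₂) :=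
    F.smooth₂.comp contDiffOn_fst fun x hx => hx.1
  have hms : ContDiffOn ℝ ∞ (fun x : ℝ × ℝ => (m x.2 : R42)) (I₁ ×ˢ I₂) :=
    h.evol.smooth_coe_m.comp contDiffOn_snd fun x hx => hx.2
  refine h.isLieApplicable_of_potential (h.isGaugePotential_framePotential F (ρ := fun _ => -1)
    (κ := fun _ => 0) contDiffOn_const contDiffOn_const ⟨u₁, hu₁, by norm_num⟩)
    (p := fun x => lieForm (m x.2) (h₂ x.1) • h₂ x.1)
    ((hms.lieForm (E.subtypeL.contDiff.comp_contDiffOn hh₂)).smul hh₂)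
    (fun u hu v _ => (C u).smul_mem _ (F.mem₂ u hu)) (fun u hu v hv => ?_)
  have hd := F.hasDerivAt₂ u hu
  have h1 := ((hasDerivAt_const u (m v : R42)).lieForm
    (E.subtypeL.hasFDerivAt.comp_hasDerivAt u hd)).smul hd
  refine h1.congr_deriv ?_
  rw [framePotential_apply, lieForm_comm (k u), hmk hu hv, lieForm_comm (h₂ u) (m v)]
  simp [hmk hu hv]
  module

/-! ### Constrained elastic curves -/

theorem _root_.LieSphere.IsEvolution.eq_orthogonal {I : Set ℝ} (h : IsEvolution I v₀ E l G m) :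
    E = lieForm.orthogonal (Submodule.span ℝ {l}) := by
  ext x
  rw [h.mem_iff]
  refine ⟨fun hx n hn => ?_, fun hx => hx l (Submodule.mem_span_singleton_self l)⟩
  obtain ⟨t, rfl⟩ := Submodule.mem_span_singleton.1 hn
  change lieForm (t • l) x = 0
  rw [map_smul, LinearMap.smul_apply, hx, smul_zero]

theorem _root_.LieSphere.IsEvolution.restrict_nondegenerate {I : Set ℝ}
    (h : IsEvolution I v₀ E l G m) :
    (lieForm.restrict E).Nondegenerate := by
  rw [h.eq_orthogonal]
  exact LinearMap.BilinForm.restrict_nondegenerate_orthogonal_spanSingleton _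
    lieForm_nondegenerate lieForm_isSymm.isRefl (by rw [h.unit]; exact one_ne_zero)

theorem _root_.LieSphere.IsEvolution.finrank_eq {I : Set ℝ} (h : IsEvolution I v₀ E l G m) :
    Module.finrank ℝ E = 5 := by
  have hl : l ≠ 0 := by
    rintro rfl
    simpa using h.unit
  rw [h.eq_orthogonal, LinearMap.BilinForm.finrank_orthogonal lieForm_nondegenerate,
    finrank_span_singleton hl]
  simp

theorem restrict_isRefl (E : Submodule ℝ R42) : (lieForm.restrict E).IsRefl := fun x y hxy => by
  rw [restrict_comm]; exact hxy

/-- If `L = ⟨G l⟩` stays in `⟨l⟩ ⊕ W₀`, then `m` stays in `W₀`: for `n ∈ E` orthogonal to `W₀`,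
both `G n` and the constant `n` solve `y' = -(G m, y) G l`, so they agree. -/
theorem m_mem_of_line_le (h : IsEvolvedSurface I₁ I₂ v₀ E l G m C f) {W₀ : Submodule ℝ E}
    (hW : ∀ v ∈ I₂, G v l ∈ Submodule.span ℝ {l} ⊔ W₀.map E.subtype) (hv : v ∈ I₂) : m v ∈ W₀ := by
  rw [← LinearMap.BilinForm.orthogonal_orthogonal h.evol.restrict_nondegenerate
    (restrict_isRefl E) W₀]
  intro n hn
  change lieForm n (m v) = 0
  have hGl : ∀ w ∈ I₂, lieForm n (G w l) = 0 := by
    intro w hw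
    obtain ⟨x, hx, _, ⟨y, hy, rfl⟩, hxy⟩ := Submodule.mem_sup.1 (hW w hw)
    obtain ⟨t, rfl⟩ := Submodule.mem_span_singleton.1 hx
    have : lieForm y n = 0 := hn y hy
    rw [← hxy, map_add, map_smul, h.evol.apply_l, lieForm_comm]
    simpa using this
  have hGm : ∀ w ∈ I₂, lieForm n (G w (m w)) = 0 := by
    intro w hw
    have h1 := (hasDerivAt_const w (n : R42)).lieForm (h.evol.hasDerivAt w hw l)
    have h2 := (h1.congr_of_eventuallyEq (f₁ := fun _ => (0 : ℝ)) (by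
      filter_upwards [h.evol.isOpen.mem_nhds hw] with t ht using (hGl t ht).symm)).unique
      (hasDerivAt_const w 0)
    simpa [h.evol.unit, h.evol.apply_l] using h2
  have hfix : G v n - n = 0 := by
    refine eq_zero_of_linear_ode h.evol.isOpen h.evol.ordConnected
      (K := fun w => -(lieCLM (G w (m w))).smulRight (G w l)) ?_ (y := fun w => G w n - n)
      (fun w hw => ?_) h.evol.base_mem (by simp [h.evol.base]) v hv
    · have h1 : ContDiffOn ℝ ∞ (fun w => lieCLM (G w (m w))) I₂ :=
        lieCLM.contDiff.comp_contDiffOn (h.evol.smooth.clm_apply h.evol.smooth_coe_m)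
      exact (h1.smulRight (h.evol.smooth.clm_apply contDiffOn_const)).neg.continuousOn
    · refine ((h.evol.hasDerivAt_apply_mem hw n).sub_const (n : R42)).congr_deriv ?_
      rw [neg_apply, ContinuousLinearMap.smulRight_apply, lieCLM_apply, map_sub,
        h.evol.orthogonal w hw, lieForm_comm (G w (m w)) n, hGm w hw, sub_zero, neg_smul]
  rw [← h.evol.orthogonal v hv, sub_eq_zero.1 hfix, hGm v hv]

/-- Preimages in `W` of the elements of `W₀` can be chosen linearly. -/
theorem _root_.LieSphere.exists_linear_selection {V Q : Type*} [AddCommGroup V] [Module ℝ V]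
    [FiniteDimensional ℝ V] [AddCommGroup Q] [Module ℝ Q] (ev : Q →ₗ[ℝ] V) {W : Submodule ℝ Q}
    {W₀ : Submodule ℝ V} (h : ∀ w ∈ W₀, ∃ p ∈ W, ev p = w) :
    ∃ g : V →ₗ[ℝ] Q, (∀ x, g x ∈ W) ∧ ∀ w ∈ W₀, ev (g w) = w := by
  choose r hrW hr using fun w : W₀ => h w w.2
  let b := Module.finBasis ℝ W₀
  let J : W₀ →ₗ[ℝ] W := b.constr ℝ fun i => ⟨r (b i), hrW _⟩
  have hJ : ev.comp (W.subtype.comp J) = W₀.subtype := b.ext fun i => by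
    rw [LinearMap.comp_apply, LinearMap.comp_apply, b.constr_basis]
    exact hr _
  obtain ⟨g, hg⟩ := J.exists_extend
  refine ⟨W.subtype.comp g, fun x => (g x).2, fun w hw => ?_⟩
  rw [← hg] at hJ
  exact LinearMap.congr_fun hJ ⟨w, hw⟩

/-- If `w ↦ (w, p_w)` is a linear choice of conserved quantities with constant part `w ∈ W₀`, then
`p(u, v)` is the value at `u` of the top coefficient belonging to `w = m v`. -/
theorem isLieApplicable_of_constrainedElastic (h : IsEvolvedSurface I₁ I₂ v₀ E l G m C f)
    {W₀ : Submodule ℝ E} (hm : ∀ v ∈ I₂, m v ∈ W₀)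
    (hC : IsConstrainedElastic (lieForm.restrict E) I₁ C W₀) :
    IsLieApplicable lieForm (I₁ ×ˢ I₂) f := by
  obtain ⟨-, ξ, hξ, W, -, hW, hW₀⟩ := hC
  obtain ⟨u₁, hu₁, -⟩ := hξ.quad_ne_zero
  -- the cases `t = 0` and `t = 1` of the equation for conserved quantities
  have hp0 : ∀ p ∈ W, ∀ u ∈ I₁, p.1 u = p.1 u₁ := by
    intro p hp u hu
    refine constant_of_hasDerivAt_zero h.isOpen h.ordConnected (fun t ht => ?_) hu hu₁
    have h1 := (hW p hp).parallel 0 t ht 1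
    simp only [zero_smul, add_zero] at h1
    rw [fderiv_eq_smul_deriv, one_smul] at h1
    have := (hW p hp).smooth_zero.hasDerivAt h.isOpen ht
    have h1' : deriv p.1 t = 0 := h1
    rwa [h1'] at this
  have hp1 : ∀ p ∈ W, ∀ u ∈ I₁, HasDerivAt p.2 (-ξ u 1 (p.1 u₁)) u := by
    intro p hp u hu
    have h1 := (hW p hp).parallel 1 u hu 1
    have d0 := (hW p hp).smooth_zero.hasDerivAt h.isOpen hu
    have d1 := (hW p hp).smooth_one.hasDerivAt h.isOpen hu
    have d0' : HasDerivAt p.1 0 u := by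
      refine (hasDerivAt_const u (p.1 u₁)).congr_of_eventuallyEq ?_
      filter_upwards [h.isOpen.mem_nhds hu] with t ht using hp0 p hp t ht
    have hker : ξ u 1 (p.2 u) = 0 := apply_eq_zero_of_mem_wedgeSpace (restrict_comm E)
      (h.curve.null u hu) (hξ.mem u hu 1) ((hW p hp).top_mem u hu)
    simp only [one_smul] at h1
    rw [fderiv_eq_smul_deriv, one_smul,
      (show HasDerivAt (fun y => p.1 y + p.2 y) _ u from d0'.add d1).deriv,
      zero_add, map_add, hker, add_zero,
      hp0 p hp u hu] at h1
    rwa [eq_neg_of_add_eq_zero_left h1] at d1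
  obtain ⟨g, hgW, hgw⟩ := exists_linear_selection
    ((LinearMap.proj u₁).comp (LinearMap.fst ℝ (ℝ → E) (ℝ → E))) (W := W) (W₀ := W₀) fun w hw => by
      have : w ∈ (W₀ : Set E) := hw
      rwa [← hW₀ u₁ hu₁] at this
  let e := Module.finBasis ℝ E
  let p : ℝ × ℝ → E := fun x => (g (m x.2)).2 x.1
  have hpsum : ∀ x, p x = ∑ i, e.repr (m x.2) i • (g (e i)).2 x.1 := by
    intro x
    have h1 : g (m x.2) = ∑ i, e.repr (m x.2) i • g (e i) := by
      conv_lhs => rw [← e.sum_repr (m x.2), map_sum]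
      simp_rw [map_smul]
    simp only [p]
    rw [h1]
    simp [Prod.snd_sum, Finset.sum_apply]
  refine h.isLieApplicable_of_potential hξ (p := p) ?_ ?_ ?_
  · refine ContDiffOn.congr (f := fun x : ℝ × ℝ => ∑ i, e.repr (m x.2) i • (g (e i)).2 x.1)
      (ContDiffOn.sum fun i _ => ?_) fun x _ => hpsum x
    have h1 : ContDiff ℝ ∞ (fun y : E => e.repr y i) :=
      (LinearMap.toContinuousLinearMap (e.coord i)).contDiff
    have h2 : ContDiffOn ℝ ∞ (fun x : ℝ × ℝ => e.repr (m x.2) i) (I₁ ×ˢ I₂) :=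
      h1.comp_contDiffOn (h.evol.smooth_m.comp contDiffOn_snd fun x hx => hx.2)
    have h3 : ContDiffOn ℝ ∞ (fun x : ℝ × ℝ => (g (e i)).2 x.1) (I₁ ×ˢ I₂) :=
      (hW _ (hgW (e i))).smooth_one.comp contDiffOn_fst fun x hx => hx.1
    exact h2.smul h3
  · intro u hu v _
    exact (hW _ (hgW (m v))).top_mem u hu
  · intro u hu v hv
    have := hp1 _ (hgW (m v)) u hu
    rwa [show (g (m v)).1 u₁ = m v from hgw _ (hm v hv)] at this

end IsEvolvedSurface

/-! ### The coefficients of a gauge potential -/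

/-- The bilinear form `(η(X) G x, G y)`: the component of `η(X)`, read in the frame `G`, along
`x ∧ y`. -/
def gaugePairing (η : ℝ × ℝ → ℝ × ℝ →L[ℝ] R42 →L[ℝ] R42) (G : ℝ → R42 ≃L[ℝ] R42) (X p : ℝ × ℝ) :
    LinearMap.BilinForm ℝ R42 :=
  lieForm.comp ((η p X : R42 →ₗ[ℝ] R42) ∘ₗ ((G p.2).toLinearEquiv : R42 →ₗ[ℝ] R42))
    ((G p.2).toLinearEquiv : R42 →ₗ[ℝ] R42)

theorem gaugePairing_apply (η : ℝ × ℝ → ℝ × ℝ →L[ℝ] R42 →L[ℝ] R42) (G : ℝ → R42 ≃L[ℝ] R42)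
    (X p : ℝ × ℝ) (x y : R42) :
    gaugePairing η G X p x y = lieForm (η p X (G p.2 x)) (G p.2 y) := rfl

section Form

variable {F : Type*} [NormedAddCommGroup F] [NormedSpace ℝ F] {σ : ℝ × ℝ → ℝ × ℝ →L[ℝ] F}
  {s : Set (ℝ × ℝ)} {u v : ℝ}

theorem hasDerivAt_fst_form (hσ : ContDiffOn ℝ ∞ σ s) (hs : s ∈ 𝓝 (u, v)) (X : ℝ × ℝ) :
    HasDerivAt (fun t => σ (t, v) X) (fderiv ℝ σ (u, v) (1, 0) X) u := by
  have h := (hasDerivAt_fst_slice ((hσ.contDiffAt hs).differentiableAt (by simp))).clm_apply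
    (hasDerivAt_const u X)
  rwa [map_zero, add_zero] at h

theorem hasDerivAt_snd_form (hσ : ContDiffOn ℝ ∞ σ s) (hs : s ∈ 𝓝 (u, v)) (X : ℝ × ℝ) :
    HasDerivAt (fun t => σ (u, t) X) (fderiv ℝ σ (u, v) (0, 1) X) v := by
  have h := (hasDerivAt_snd_slice ((hσ.contDiffAt hs).differentiableAt (by simp))).clm_apply
    (hasDerivAt_const v X)
  rwa [map_zero, add_zero] at h

end Form

namespace IsEvolvedSurface

variable {I₁ I₂ : Set ℝ} {v₀ : ℝ} {E : Submodule ℝ R42} {l : R42} {G : ℝ → R42 ≃L[ℝ] R42}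
  {m : ℝ → E} {C : ℝ → Submodule ℝ E} {f : ℝ × ℝ → Submodule ℝ R42} {u v : ℝ}
  {h₁ h₂ k : ℝ → E} {φ : ℝ → ℝ} {η : ℝ × ℝ → ℝ × ℝ →L[ℝ] R42 →L[ℝ] R42} {X : ℝ × ℝ}

theorem gaugePairing_swap (hη : IsGaugePotential lieForm (I₁ ×ˢ I₂) f η) (hu : u ∈ I₁) (hv : v ∈ I₂)
    (x y : R42) : gaugePairing η G X (u, v) y x = -(gaugePairing η G X (u, v) x y) := by
  rw [gaugePairing_apply, gaugePairing_apply,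
    skew_of_mem_wedgeSpace lieForm_comm (hη.mem (u, v) ⟨hu, hv⟩ X), lieForm_comm]

theorem gaugePairing_self (hη : IsGaugePotential lieForm (I₁ ×ˢ I₂) f η) (hu : u ∈ I₁)
    (hv : v ∈ I₂) (x : R42) : gaugePairing η G X (u, v) x x = 0 := by
  have := gaugePairing_swap (G := G) (X := X) hη hu hv x x
  linarith

theorem gaugePairing_left (h : IsEvolvedSurface I₁ I₂ v₀ E l G m C f)
    (hη : IsGaugePotential lieForm (I₁ ×ˢ I₂) f η) (hu : u ∈ I₁) (hv : v ∈ I₂)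
    {c : E} (hc : c ∈ C u) (y : R42) : gaugePairing η G X (u, v) c y = 0 := by
  rw [gaugePairing_apply, apply_eq_zero_of_mem_wedgeSpace lieForm_comm
    (h.legendre.null (u, v) ⟨hu, hv⟩) (hη.mem (u, v) ⟨hu, hv⟩ X)
    ((h.mem_fibre hu hv).2 ⟨c, hc, rfl⟩), map_zero, LinearMap.zero_apply]

theorem gaugePairing_orthogonal (h : IsEvolvedSurface I₁ I₂ v₀ E l G m C f)
    (hη : IsGaugePotential lieForm (I₁ ×ˢ I₂) f η) (hu : u ∈ I₁) (hv : v ∈ I₂) {x y : R42}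
    (hx : ∀ c ∈ C u, lieForm c x = 0) (hy : ∀ c ∈ C u, lieForm c y = 0) :
    gaugePairing η G X (u, v) x y = 0 := by
  have hG : ∀ z : R42, (∀ c ∈ C u, lieForm c z = 0) → G v z ∈ lieForm.orthogonal (f (u, v)) := by
    intro z hz n hn
    obtain ⟨c, hc, rfl⟩ := (h.mem_fibre hu hv).1 hn
    change lieForm (G v c) (G v z) = 0
    rw [h.evol.orthogonal v hv, hz c hc]
  exact hG y hy _ (apply_mem_of_mem_wedgeSpace (hη.mem (u, v) ⟨hu, hv⟩ X) (hG x hx))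

theorem gaugePairing_eq (η : ℝ × ℝ → ℝ × ℝ →L[ℝ] R42 →L[ℝ] R42) (G : ℝ → R42 ≃L[ℝ] R42)
    (X p : ℝ × ℝ) (x y : R42) : gaugePairing η G X p x y =
      X.1 * gaugePairing η G (1, 0) p x y + X.2 * gaugePairing η G (0, 1) p x y := by
  simp only [gaugePairing_apply]
  rw [clm_prod_apply (η p) X]
  simp

theorem contDiffOn_gaugePairing (h : IsEvolvedSurface I₁ I₂ v₀ E l G m C f)
    (hη : IsGaugePotential lieForm (I₁ ×ˢ I₂) f η) {x y : ℝ → R42} (hx : ContDiffOn ℝ ∞ x I₁)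
    (hy : ContDiffOn ℝ ∞ y I₁) :
    ContDiffOn ℝ ∞ (fun p => gaugePairing η G X p (x p.1) (y p.1)) (I₁ ×ˢ I₂) := by
  have hG : ContDiffOn ℝ ∞ (fun x : ℝ × ℝ => (G x.2 : R42 →L[ℝ] R42)) (I₁ ×ˢ I₂) :=
    h.evol.smooth.comp contDiffOn_snd fun x hx => hx.2
  have h1 : ∀ {z : ℝ → R42}, ContDiffOn ℝ ∞ z I₁ →
      ContDiffOn ℝ ∞ (fun p : ℝ × ℝ => G p.2 (z p.1)) (I₁ ×ˢ I₂) := fun hz =>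
    hG.clm_apply (hz.comp contDiffOn_fst fun x hx => hx.1)
  exact ((hη.smooth.clm_apply contDiffOn_const).clm_apply (h1 hx)).lieForm (h1 hy)

/-- The closedness of a gauge potential in the frame `G`. -/
theorem gaugePairing_closed (h : IsEvolvedSurface I₁ I₂ v₀ E l G m C f)
    (hη : IsGaugePotential lieForm (I₁ ×ˢ I₂) f η) (hu : u ∈ I₁) (hv : v ∈ I₂)
    {x y : ℝ → R42} {x' y' : R42} (hx : HasDerivAt x x' u) (hy : HasDerivAt y y' u) {r r' : ℝ}
    (hr : HasDerivAt (fun s => gaugePairing η G (0, 1) (s, v) (x s) (y s)) r u)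
    (hr' : HasDerivAt (fun t => gaugePairing η G (1, 0) (u, t) (x u) (y u)) r' v) :
    r - r' = gaugePairing η G (0, 1) (u, v) x' (y u) + gaugePairing η G (0, 1) (u, v) (x u) y' -
      gaugePairing η G (1, 0) (u, v)
        (lieForm l (x u) • (m v : R42) - lieForm (m v) (x u) • l) (y u) -
      gaugePairing η G (1, 0) (u, v) (x u)
        (lieForm l (y u) • (m v : R42) - lieForm (m v) (y u) • l) := by
  have hx₀ : ((u, v) : ℝ × ℝ) ∈ I₁ ×ˢ I₂ := ⟨hu, hv⟩
  have hGv : ∀ {z : ℝ → R42} {z' : R42}, HasDerivAt z z' u →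
      HasDerivAt (fun s => G v (z s)) (G v z') u := fun hz =>
    (G v : R42 →L[ℝ] R42).hasFDerivAt.comp_hasDerivAt u hz
  have d1 := hasDerivAt_fst_form hη.smooth (h.isOpen_prod.mem_nhds hx₀) (0, 1)
  have d2 := hasDerivAt_snd_form hη.smooth (h.isOpen_prod.mem_nhds hx₀) (1, 0)
  have e1 := (d1.clm_apply (hGv hx)).lieForm (hGv hy)
  have e2 := (d2.clm_apply (h.evol.hasDerivAt v hv (x u))).lieForm (h.evol.hasDerivAt v hv (y u))
  have e3 : r = _ := HasDerivAt.unique (f := fun s =>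
    lieForm (η (s, v) (0, 1) (G v (x s))) (G v (y s))) hr e1
  have e4 : r' = _ := HasDerivAt.unique (f := fun t =>
    lieForm (η (u, t) (1, 0) (G t (x u))) (G t (y u))) hr' e2
  rw [e3, e4, hη.closed (u, v) ⟨hu, hv⟩ (1, 0) (0, 1)]
  simp only [gaugePairing_apply]
  generalize fderiv ℝ η (u, v) (0, 1) (1, 0) = T
  simp only [map_add, map_sub, map_smul, LinearMap.add_apply, LinearMap.sub_apply,
    LinearMap.smul_apply]
  ring

end IsEvolvedSurface

/-- The equations satisfied by the coefficients of a gauge potential in the frame given by `G` and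
an adapted frame with dual vectors `m₁, m₂`. They are
`a_j = -η_u(k, m_j) / (k, k)`, `γ = η_u(m₁, m₂)`, `δ = η_v(m₁, m₂)` and `P_j = η_v(l, m_j)`; all
other components vanish. -/
structure IsPotentialCoefficients {E : Submodule ℝ R42} (I₁ I₂ : Set ℝ) (m h₁ h₂ k : ℝ → E)
    (φ : ℝ → ℝ) (a₁ a₂ γ δ P₁ P₂ : ℝ × ℝ → ℝ) : Prop where
  smooth_a₁ : ContDiffOn ℝ ∞ a₁ (I₁ ×ˢ I₂)
  smooth_a₂ : ContDiffOn ℝ ∞ a₂ (I₁ ×ˢ I₂)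
  smooth_γ : ContDiffOn ℝ ∞ γ (I₁ ×ˢ I₂)
  hasDerivAt_a₁ : ∀ u ∈ I₁, ∀ v ∈ I₂, HasDerivAt (fun t => a₁ (u, t)) (δ (u, v)) v
  hasDerivAt_a₂ : ∀ u ∈ I₁, ∀ v ∈ I₂, HasDerivAt (fun t => a₂ (u, t)) (φ u * δ (u, v)) v
  closed : ∀ u ∈ I₁, ∀ v ∈ I₂, ∃ r, HasDerivAt (fun s => δ (s, v)) r u ∧
    HasDerivAt (fun t => γ (u, t)) r v
  hasDerivAt_P₁ : ∀ u ∈ I₁, ∀ v ∈ I₂, HasDerivAt (fun s => P₁ (s, v))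
    (lieForm (m v) (h₂ u) * γ (u, v) + lieForm (m v) (k u) * a₁ (u, v)) u
  hasDerivAt_P₂ : ∀ u ∈ I₁, ∀ v ∈ I₂, HasDerivAt (fun s => P₂ (s, v))
    (lieForm (m v) (k u) * a₂ (u, v) - lieForm (m v) (h₁ u) * γ (u, v)) u
  relation : ∀ u ∈ I₁, ∀ v ∈ I₂, φ u * P₁ (u, v) - P₂ (u, v) =
    a₁ (u, v) * lieForm (m v) (h₁ u) + a₂ (u, v) * lieForm (m v) (h₂ u)
  ne_zero : ∃ u ∈ I₁, ∃ v ∈ I₂, a₂ (u, v) - φ u * a₁ (u, v) ≠ 0 ∨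
    lieForm (m v) (h₁ u) * P₁ (u, v) + lieForm (m v) (h₂ u) * P₂ (u, v) ≠ 0

namespace IsEvolvedSurface

variable {I₁ I₂ : Set ℝ} {v₀ : ℝ} {E : Submodule ℝ R42} {l : R42} {G : ℝ → R42 ≃L[ℝ] R42}
  {m : ℝ → E} {C : ℝ → Submodule ℝ E} {f : ℝ × ℝ → Submodule ℝ R42} {u v : ℝ}
  {h₁ h₂ k : ℝ → E} {φ : ℝ → ℝ} {η : ℝ × ℝ → ℝ × ℝ →L[ℝ] R42 →L[ℝ] R42} {X : ℝ × ℝ}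

/-- The vectors `m₁, m₂, k` span `E` modulo `C u`. -/
theorem exists_expansion (h : IsEvolvedSurface I₁ I₂ v₀ E l G m C f)
    (F : IsAdaptedFrame I₁ I₂ m C (m v₀) (deriv m v₀) h₁ h₂ k φ) (hu : u ∈ I₁) (y : E) :
    ∃ c ∈ C u, y = lieForm y (h₁ u) • m v₀ + lieForm y (h₂ u) • deriv m v₀ +
      (lieForm y (k u) / lieForm (k u) (k u)) • k u + c := by
  have hkC : k u ∉ C u := fun hk => (F.k_pos u hu).ne' (h.null hu hk hk)
  have hz1 : lieForm (y - lieForm y (h₁ u) • m v₀ - lieForm y (h₂ u) • deriv m v₀ : E) (h₁ u) =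
      0 := by
    simp [F.dual₁₁ u hu, F.dual₂₁ u hu]
  have hz2 : lieForm (y - lieForm y (h₁ u) • m v₀ - lieForm y (h₂ u) • deriv m v₀ : E) (h₂ u) =
      0 := by
    simp [F.dual₁₂ u hu, F.dual₂₂ u hu]
  have hzk : lieForm (y - lieForm y (h₁ u) • m v₀ - lieForm y (h₂ u) • deriv m v₀ : E) (k u) =
      lieForm y (k u) := by
    simp [F.a_k u hu, F.b_k u hu]
  obtain ⟨c, hc, t, hct⟩ := h.exists_eq_add_smul hu (F.orth_k u hu) hkC
    (z := y - lieForm y (h₁ u) • m v₀ - lieForm y (h₂ u) • deriv m v₀) (fun c hc => by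
      rw [lieForm_comm, h.eq_dual_combination F.toIsDualFrame hu hc, Submodule.coe_add, map_add,
        Submodule.coe_smul, Submodule.coe_smul, map_smul, map_smul, hz1, hz2]
      simp)
  rw [hct] at hzk
  have ht : t = lieForm y (k u) / lieForm (k u) (k u) := by
    rw [eq_div_iff (F.k_pos u hu).ne']
    simpa [F.orth_k u hu c hc] using hzk
  refine ⟨c, hc, ?_⟩
  rw [← ht, ← sub_eq_zero]
  rw [← sub_eq_zero] at hct
  rw [← hct]
  abel

theorem gaugePairing_expand (h : IsEvolvedSurface I₁ I₂ v₀ E l G m C f)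
    (F : IsAdaptedFrame I₁ I₂ m C (m v₀) (deriv m v₀) h₁ h₂ k φ)
    (hη : IsGaugePotential lieForm (I₁ ×ˢ I₂) f η) (hu : u ∈ I₁) (hv : v ∈ I₂) (y : E) (z : R42) :
    gaugePairing η G X (u, v) y z = lieForm y (h₁ u) * gaugePairing η G X (u, v) (m v₀) z +
      lieForm y (h₂ u) * gaugePairing η G X (u, v) (deriv m v₀ : E) z +
      lieForm y (k u) / lieForm (k u) (k u) * gaugePairing η G X (u, v) (k u) z := by
  obtain ⟨c, hc, hy⟩ := h.exists_expansion F hu y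
  have := h.gaugePairing_left (X := X) hη hu hv hc z
  conv_lhs => rw [hy]
  simp [this]

theorem gaugePairing_k_l (h : IsEvolvedSurface I₁ I₂ v₀ E l G m C f)
    (F : IsAdaptedFrame I₁ I₂ m C (m v₀) (deriv m v₀) h₁ h₂ k φ)
    (hη : IsGaugePotential lieForm (I₁ ×ˢ I₂) f η) (hu : u ∈ I₁) (hv : v ∈ I₂) :
    gaugePairing η G X (u, v) (k u) l = 0 :=
  h.gaugePairing_orthogonal hη hu hv (F.orth_k u hu) fun c _ => h.evol.apply_l c

theorem gaugePairing_l_k (h : IsEvolvedSurface I₁ I₂ v₀ E l G m C f)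
    (F : IsAdaptedFrame I₁ I₂ m C (m v₀) (deriv m v₀) h₁ h₂ k φ)
    (hη : IsGaugePotential lieForm (I₁ ×ˢ I₂) f η) (hu : u ∈ I₁) (hv : v ∈ I₂) :
    gaugePairing η G X (u, v) l (k u) = 0 :=
  h.gaugePairing_orthogonal hη hu hv (fun c _ => h.evol.apply_l c) (F.orth_k u hu)

/-- The components along `l ∧ m_j` and `k ∧ m_j` are aligned with the two families of curvature
lines. -/
theorem gaugePairing_mixed_eq_zero (h : IsEvolvedSurface I₁ I₂ v₀ E l G m C f)
    (F : IsAdaptedFrame I₁ I₂ m C (m v₀) (deriv m v₀) h₁ h₂ k φ)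
    (hη : IsGaugePotential lieForm (I₁ ×ˢ I₂) f η) (hu : u ∈ I₁) (hv : v ∈ I₂) (z : E) :
    gaugePairing η G (1, 0) (u, v) l z = 0 ∧ gaugePairing η G (0, 1) (u, v) (k u) z = 0 := by
  have key : ∀ (g : ℝ → E) (g' : E), (∀ u ∈ I₁, g u ∈ C u) → HasDerivAt g g' u →
      gaugePairing η G (0, 1) (u, v) g' z +
        lieForm (m v) (g u) * gaugePairing η G (1, 0) (u, v) l z = 0 := by
    intro g g' hg hgd
    have hr : HasDerivAt (fun s => gaugePairing η G (0, 1) (s, v) (g s) z) 0 u := by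
      refine (hasDerivAt_const u (0 : ℝ)).congr_of_eventuallyEq ?_
      filter_upwards [h.isOpen.mem_nhds hu] with s hs
      exact h.gaugePairing_left hη hs hv (hg s hs) z
    have hr' : HasDerivAt (fun t => gaugePairing η G (1, 0) (u, t) (g u) z) 0 v := by
      refine (hasDerivAt_const v (0 : ℝ)).congr_of_eventuallyEq ?_
      filter_upwards [h.evol.isOpen.mem_nhds hv] with t ht
      exact h.gaugePairing_left hη hu ht (hg u hu) z
    have := h.gaugePairing_closed hη hu hv (x := fun s => (g s : R42)) (y := fun _ => (z : R42))
      (E.subtypeL.hasFDerivAt.comp_hasDerivAt u hgd) (hasDerivAt_const u (z : R42)) hr hr'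
    simp only [h.gaugePairing_left hη hu hv (hg u hu), h.evol.l_apply, zero_smul, zero_sub,
      map_neg, map_smul, LinearMap.neg_apply, LinearMap.smul_apply, smul_eq_mul] at this
    simp only [Submodule.subtypeL_apply] at this
    linarith
  have e1 := key h₁ _ F.mem₁ (F.hasDerivAt₁ u hu)
  have e2 := key h₂ _ F.mem₂ (F.hasDerivAt₂ u hu)
  rw [Submodule.coe_smul, map_smul, LinearMap.smul_apply, smul_eq_mul] at e1
  have h0 : lieForm (m v) (h₁ u + φ u • h₂ u : E) * gaugePairing η G (1, 0) (u, v) l z = 0 := by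
    rw [Submodule.coe_add, Submodule.coe_smul, map_add, map_smul, smul_eq_mul]
    linear_combination e1 + φ u * e2
  have h1 := (mul_eq_zero.1 h0).resolve_left (F.m_apply_ne u hu v hv)
  rw [h1, mul_zero, add_zero] at e2
  exact ⟨h1, e2⟩

/-- The quadratic differential, computed with the sections `G h₁, G h₂` and the functionals dual to
them. -/
theorem isQuadDiffValue_eq (h : IsEvolvedSurface I₁ I₂ v₀ E l G m C f)
    (F : IsAdaptedFrame I₁ I₂ m C (m v₀) (deriv m v₀) h₁ h₂ k φ)
    (hη : IsGaugePotential lieForm (I₁ ×ˢ I₂) f η) (hu : u ∈ I₁) (hv : v ∈ I₂) {Y : ℝ × ℝ} {q : ℝ}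
    (hq : IsQuadDiffValue f η (u, v) X Y q) :
    q = X.1 * Y.1 * (gaugePairing η G (1, 0) (u, v) (k u) (deriv m v₀ : E) -
        φ u * gaugePairing η G (1, 0) (u, v) (k u) (m v₀)) -
      X.2 * Y.2 * (lieForm (m v) (h₁ u) * gaugePairing η G (0, 1) (u, v) l (m v₀) +
        lieForm (m v) (h₂ u) * gaugePairing η G (0, 1) (u, v) l (deriv m v₀ : E)) := by
  obtain ⟨M, hM, rfl⟩ := hq
  have hpull : ∀ z : E, ∃ α : R42 →ₗ[ℝ] ℝ, (∀ y, α (G v y) = lieForm z y) ∧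
      ∀ y, α y = lieForm y (G v z) := by
    intro z
    refine ⟨(lieForm (G v z)), fun y => h.evol.orthogonal v hv _ _, fun y => lieForm_comm _ _⟩
  obtain ⟨α, hα, hα'⟩ := hpull (m v₀)
  obtain ⟨β, hβ, hβ'⟩ := hpull (deriv m v₀)
  have hm1 := (h.mem_fibre hu hv).2 ⟨_, F.mem₁ u hu, rfl⟩
  have hm2 := (h.mem_fibre hu hv).2 ⟨_, F.mem₂ u hu, rfl⟩
  rw [trace_eq_of_dual hm1 hm2 (fun x hx => by
      obtain ⟨c, hc, rfl⟩ := (h.mem_fibre hu hv).1 hx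
      refine ⟨lieForm (m v₀) c, lieForm (deriv m v₀ : E) c, ?_⟩
      conv_lhs => rw [h.eq_dual_combination F.toIsDualFrame hu hc]
      simp) α β (by rw [hα, F.dual₁₁ u hu]) (by rw [hα, F.dual₁₂ u hu]) (by rw [hβ, F.dual₂₁ u hu])
      (by rw [hβ, F.dual₂₂ u hu])]
  have e1 : (M ⟨G v (h₁ u), hm1⟩ : R42) = _ :=
    hM _ (h.isSectionNear_evolve F.smooth₁ F.mem₁ hu hv) hm1
  have e2 : (M ⟨G v (h₂ u), hm2⟩ : R42) = _ :=
    hM _ (h.isSectionNear_evolve F.smooth₂ F.mem₂ hu hv) hm2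
  have z1 := fun z => (h.gaugePairing_mixed_eq_zero F hη hu hv z).1
  have z2 := fun z => (h.gaugePairing_mixed_eq_zero F hη hu hv z).2
  rw [e1, e2, h.fderiv_evolve F.smooth₁ hu hv, h.fderiv_evolve F.smooth₂ hu hv,
    (F.hasDerivAt₁ u hu).deriv, (F.hasDerivAt₂ u hu).deriv, hα', hβ', ← gaugePairing_apply,
    ← gaugePairing_apply, gaugePairing_eq, gaugePairing_eq η G X]
  simp only [Submodule.coe_smul, map_add, map_smul, LinearMap.add_apply, LinearMap.smul_apply,
    smul_eq_mul, z1, z2]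
  ring

/-- The equations are the closedness of `η` evaluated on the pairs `(k, m_j)`, `(m₁, m₂)`,
`(l, m_j)` and `(l, k)`. -/
theorem exists_potentialCoefficients (h : IsEvolvedSurface I₁ I₂ v₀ E l G m C f)
    (F : IsAdaptedFrame I₁ I₂ m C (m v₀) (deriv m v₀) h₁ h₂ k φ)
    (hη : IsGaugePotential lieForm (I₁ ×ˢ I₂) f η) :
    ∃ a₁ a₂ γ δ P₁ P₂, IsPotentialCoefficients I₁ I₂ m h₁ h₂ k φ a₁ a₂ γ δ P₁ P₂ := by
  set m₁ : R42 := ((m v₀ : E) : R42) with hm₁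
  set m₂ : R42 := ((deriv m v₀ : E) : R42) with hm₂
  have hks : ContDiffOn ℝ ∞ (fun u => (k u : R42)) I₁ :=
    E.subtypeL.contDiff.comp_contDiffOn F.smooth_k
  have hμs : ContDiffOn ℝ ∞ (fun p : ℝ × ℝ => lieForm (k p.1) (k p.1)) (I₁ ×ˢ I₂) :=
    (hks.lieForm hks).comp contDiffOn_fst fun p hp => hp.1
  have hc : ∀ z : R42, ContDiffOn ℝ ∞ (fun _ : ℝ => z) I₁ := fun z => contDiffOn_const
  have hμ : ∀ u ∈ I₁, lieForm (k u) (k u) ≠ 0 := fun u hu => (F.k_pos u hu).ne'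
  have z1 := fun {u v} (hu : u ∈ I₁) (hv : v ∈ I₂) (z : E) =>
    (h.gaugePairing_mixed_eq_zero F hη hu hv z).1
  have z1' : ∀ {u v} (hu : u ∈ I₁) (hv : v ∈ I₂) (z : E),
      gaugePairing η G (1, 0) (u, v) z l = 0 := fun hu hv z => by
    rw [gaugePairing_swap hη hu hv, z1 hu hv, neg_zero]
  have z2 := fun {u v} (hu : u ∈ I₁) (hv : v ∈ I₂) (z : E) =>
    (h.gaugePairing_mixed_eq_zero F hη hu hv z).2
  have hkd : ∀ u ∈ I₁, HasDerivAt (fun s => (k s : R42)) (deriv k u : E) u := fun u hu =>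
    E.subtypeL.hasFDerivAt.comp_hasDerivAt u (F.smooth_k.hasDerivAt h.isOpen hu)
  have hd1 : ∀ u ∈ I₁, HasDerivAt (fun s => (h₁ s : R42)) (-φ u • k u : E) u := fun u hu =>
    E.subtypeL.hasFDerivAt.comp_hasDerivAt u (F.hasDerivAt₁ u hu)
  have hd2 : ∀ u ∈ I₁, HasDerivAt (fun s => (h₂ s : R42)) (k u) u := fun u hu =>
    E.subtypeL.hasFDerivAt.comp_hasDerivAt u (F.hasDerivAt₂ u hu)
  have zero_deriv : ∀ (g : ℝ → ℝ) (g' u : ℝ), u ∈ I₁ → (∀ s ∈ I₁, g s = 0) → HasDerivAt g g' u →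
      g' = 0 := fun g g' u hu hg hg' => by
    refine (hg'.congr_of_eventuallyEq (f₁ := fun _ => (0 : ℝ)) ?_).unique (hasDerivAt_const u 0)
    filter_upwards [h.isOpen.mem_nhds hu] with s hs using (hg s hs).symm
  -- the components of `k'` along `m₁` and `m₂`
  have hkh1 : ∀ u ∈ I₁, lieForm (deriv k u : E) (h₁ u) = φ u * lieForm (k u) (k u) := by
    intro u hu
    have := zero_deriv _ _ u hu (fun s hs => by
      rw [lieForm_comm]; exact F.orth_k s hs _ (F.mem₁ s hs)) ((hkd u hu).lieForm (hd1 u hu))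
    simp at this
    linarith
  have hkh2 : ∀ u ∈ I₁, lieForm (deriv k u : E) (h₂ u) = -(lieForm (k u) (k u)) := by
    intro u hu
    have := zero_deriv _ _ u hu (fun s hs => by
      rw [lieForm_comm]; exact F.orth_k s hs _ (F.mem₂ s hs)) ((hkd u hu).lieForm (hd2 u hu))
    linarith
  have hslice : ∀ (x y : ℝ → R42), ContDiffOn ℝ ∞ x I₁ → ContDiffOn ℝ ∞ y I₁ → ∀ u ∈ I₁, ∀ v ∈ I₂,
      (∃ r, HasDerivAt (fun s => gaugePairing η G (0, 1) (s, v) (x s) (y s)) r u) ∧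
      ∃ r, HasDerivAt (fun t => gaugePairing η G (1, 0) (u, t) (x u) (y u)) r v := by
    intro x y hx hy u hu v hv
    have hn := h.isOpen_prod.mem_nhds (show ((u, v) : ℝ × ℝ) ∈ I₁ ×ˢ I₂ from ⟨hu, hv⟩)
    exact ⟨⟨_, hasDerivAt_fst_slice (((h.contDiffOn_gaugePairing (X := (0, 1)) hη hx hy).contDiffAt
      hn).differentiableAt (by simp))⟩, ⟨_, hasDerivAt_snd_slice
      (((h.contDiffOn_gaugePairing (X := (1, 0)) hη hx hy).contDiffAt hn).differentiableAt
      (by simp))⟩⟩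
  -- the derivative of `η_u(k, z)` along `v`
  have hkz : ∀ (z : E), ∀ u ∈ I₁, ∀ v ∈ I₂, HasDerivAt
      (fun t => -(gaugePairing η G (1, 0) (u, t) (k u) z) / lieForm (k u) (k u))
      (φ u * gaugePairing η G (0, 1) (u, v) m₁ z - gaugePairing η G (0, 1) (u, v) m₂ z) v := by
    intro z u hu v hv
    obtain ⟨-, r', hr'⟩ := hslice (fun s => (k s : R42)) (fun _ => z) hks (hc z) u hu v hv
    have hr : HasDerivAt (fun s => gaugePairing η G (0, 1) (s, v) (k s) z) 0 u := by
      refine (hasDerivAt_const u (0 : ℝ)).congr_of_eventuallyEq ?_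
      filter_upwards [h.isOpen.mem_nhds hu] with s hs using z2 hs hv z
    have := h.gaugePairing_closed hη hu hv (hkd u hu) (hasDerivAt_const u (z : R42)) hr hr'
    simp only [h.evol.l_apply, zero_smul, zero_sub, map_neg, map_smul, LinearMap.neg_apply,
      LinearMap.smul_apply, smul_eq_mul, z1 hu hv, h.gaugePairing_k_l F hη hu hv, mul_zero,
      neg_zero, map_zero, add_zero, sub_zero] at this
    rw [h.gaugePairing_expand F hη hu hv, hkh1 u hu, hkh2 u hu, z2 hu hv, ← hm₁, ← hm₂] at this
    refine (hr'.neg.div_const _).congr_deriv ?_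
    have hμu := hμ u hu
    field_simp
    linear_combination this
  have hlz : ∀ (z : E), ∀ u ∈ I₁, ∀ v ∈ I₂, HasDerivAt
      (fun s => gaugePairing η G (0, 1) (s, v) l z)
      (-(gaugePairing η G (1, 0) (u, v) (m v) z)) u := by
    intro z u hu v hv
    obtain ⟨⟨r, hr⟩, -⟩ := hslice (fun s => l) (fun _ => z) (hc l) (hc z) u hu v hv
    have hr' : HasDerivAt (fun t => gaugePairing η G (1, 0) (u, t) l z) 0 v := by
      refine (hasDerivAt_const v (0 : ℝ)).congr_of_eventuallyEq ?_
      filter_upwards [h.evol.isOpen.mem_nhds hv] with t ht using z1 hu ht z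
    have := h.gaugePairing_closed hη hu hv (hasDerivAt_const u l) (hasDerivAt_const u (z : R42))
      hr hr'
    simp only [h.evol.l_apply, h.evol.unit, h.evol.apply_l, zero_smul, one_smul, zero_sub, map_neg,
      map_smul, smul_eq_mul, gaugePairing_self hη hu hv l, mul_zero, neg_zero,
      map_zero, add_zero, sub_zero, LinearMap.zero_apply] at this
    rw [← this]
    exact hr
  have hks' : ∀ z : R42, ContDiffOn ℝ ∞
      (fun p : ℝ × ℝ => -(gaugePairing η G (1, 0) p (k p.1) z) / lieForm (k p.1) (k p.1))
      (I₁ ×ˢ I₂) := fun z => by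
    have e1 := h.contDiffOn_gaugePairing (X := (1, 0)) (x := fun s => (k s : R42))
      (y := fun _ => z) hη hks (hc z)
    exact ContDiffOn.div e1.neg hμs fun p hp => hμ p.1 hp.1
  refine ⟨fun p => -(gaugePairing η G (1, 0) p (k p.1) m₁) / lieForm (k p.1) (k p.1),
    fun p => -(gaugePairing η G (1, 0) p (k p.1) m₂) / lieForm (k p.1) (k p.1),
    fun p => gaugePairing η G (1, 0) p m₁ m₂, fun p => gaugePairing η G (0, 1) p m₁ m₂,
    fun p => gaugePairing η G (0, 1) p l m₁, fun p => gaugePairing η G (0, 1) p l m₂,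
    ?_, ?_, ?_, ?_, ?_, ?_, ?_, ?_, ?_, ?_⟩
  · exact hks' m₁
  · exact hks' m₂
  · exact h.contDiffOn_gaugePairing (x := fun _ => m₁) (y := fun _ => m₂) hη (hc _) (hc _)
  · intro u hu v hv
    refine (hkz (m v₀) u hu v hv).congr_deriv ?_
    rw [← hm₁, gaugePairing_self hη hu hv, gaugePairing_swap hη hu hv m₁ m₂]
    ring
  · intro u hu v hv
    refine (hkz (deriv m v₀) u hu v hv).congr_deriv ?_
    rw [← hm₂, gaugePairing_self hη hu hv]
    ring
  · intro u hu v hv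
    obtain ⟨⟨r, hr⟩, r', hr'⟩ := hslice (fun _ => m₁) (fun _ => m₂) (hc _) (hc _) u hu v hv
    have := h.gaugePairing_closed hη hu hv (hasDerivAt_const u m₁) (hasDerivAt_const u m₂) hr hr'
    simp only [hm₁, hm₂, h.evol.l_apply, zero_smul, zero_sub, map_neg, map_smul,
      LinearMap.neg_apply, LinearMap.smul_apply, smul_eq_mul, z1 hu hv, z1' hu hv, mul_zero, neg_zero, map_zero,
      LinearMap.zero_apply, add_zero, sub_zero] at this
    rw [← sub_eq_zero.1 this] at hr'
    exact ⟨r, hr, hr'⟩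
  · intro u hu v hv
    refine (hlz (m v₀) u hu v hv).congr_deriv ?_
    rw [h.gaugePairing_expand F hη hu hv, ← hm₁, ← hm₂, gaugePairing_self hη hu hv,
      gaugePairing_swap hη hu hv m₁ m₂]
    ring
  · intro u hu v hv
    refine (hlz (deriv m v₀) u hu v hv).congr_deriv ?_
    rw [h.gaugePairing_expand F hη hu hv, ← hm₁, ← hm₂, gaugePairing_self hη hu hv]
    ring
  · intro u hu v hv
    have hr : HasDerivAt (fun s => gaugePairing η G (0, 1) (s, v) l (k s)) 0 u := by
      refine (hasDerivAt_const u (0 : ℝ)).congr_of_eventuallyEq ?_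
      filter_upwards [h.isOpen.mem_nhds hu] with s hs using h.gaugePairing_l_k F hη hs hv
    have hr' : HasDerivAt (fun t => gaugePairing η G (1, 0) (u, t) l (k u)) 0 v := by
      refine (hasDerivAt_const v (0 : ℝ)).congr_of_eventuallyEq ?_
      filter_upwards [h.evol.isOpen.mem_nhds hv] with t ht using h.gaugePairing_l_k F hη hu ht
    have := h.gaugePairing_closed hη hu hv (hasDerivAt_const u l) (hkd u hu) hr hr'
    rw [gaugePairing_swap hη hu hv (deriv k u : E) l] at this
    simp only [h.evol.l_apply, h.evol.unit, h.evol.apply_l, zero_smul, one_smul, zero_sub, map_neg,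
      map_smul, smul_eq_mul, gaugePairing_self hη hu hv l, mul_zero, neg_zero,
      map_zero, sub_zero, zero_add, LinearMap.zero_apply] at this
    rw [h.gaugePairing_expand F hη hu hv, h.gaugePairing_expand F hη hu hv (m v), hkh1 u hu,
      hkh2 u hu, ← hm₁, ← hm₂, gaugePairing_self hη hu hv, h.gaugePairing_k_l F hη hu hv,
      gaugePairing_swap hη hu hv (k u : R42) m₁, gaugePairing_swap hη hu hv (k u : R42) m₂,
      gaugePairing_swap hη hu hv l m₁, gaugePairing_swap hη hu hv l m₂] at this
    have hμu := hμ u hu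
    field_simp
    linear_combination -this
  · obtain ⟨⟨u, v⟩, ⟨hu, hv⟩, X, Y, q, hq, hq0⟩ := hη.quad_ne_zero
    refine ⟨u, hu, v, hv, ?_⟩
    by_contra! hcon
    obtain ⟨c1, c2⟩ := hcon
    apply hq0
    rw [h.isQuadDiffValue_eq F hη hu hv hq, ← hm₁, ← hm₂]
    have hμu := hμ u hu
    field_simp at c1
    rw [c2]
    linear_combination -X.1 * Y.1 * c1

end IsEvolvedSurface

/-! ### The potential of the curve induced by a gauge potential of the surface -/

/-- The data on the curve that a gauge potential of the surface gives rise to: the coefficients of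
the form `(ρ h₂ ∧ k + κ h₁ ∧ h₂) du`, and the vectors `D` for which
`(m v, D) = η_v(l, m v₀) - a₁ (m v, h₂)`, where `a₁` is a coefficient of the potential. -/
structure IsCurveData {E : Submodule ℝ R42} (I₁ I₂ : Set ℝ) (m h₁ h₂ k : ℝ → E) (φ ρ κ : ℝ → ℝ)
    (D : ℝ → E) : Prop where
  smooth_ρ : ContDiffOn ℝ ∞ ρ I₁
  smooth_κ : ContDiffOn ℝ ∞ κ I₁
  smooth_D : ContDiffOn ℝ ∞ D I₁
  smul_D : ∀ u ∈ I₁, deriv φ u • D u =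
    (2 * ρ u) • k u + deriv ρ u • h₂ u - κ u • (h₁ u + φ u • h₂ u)
  m_apply : ∀ u ∈ I₁, ∀ v ∈ I₂, lieForm (m v) (deriv D u - κ u • h₂ u : E) = 0
  ne_zero : ∃ u ∈ I₁, ρ u ≠ 0

theorem exists_forall_eq_smul_of_finrank_le_one {V : Type*} [AddCommGroup V] [Module ℝ V]
    [FiniteDimensional ℝ V] {S : Submodule ℝ V} (hS : Module.finrank ℝ S ≤ 1) :
    ∃ a : V, ∀ x ∈ S, ∃ t : ℝ, t • a = x := by
  obtain ⟨a, ha⟩ := finrank_le_one_iff.1 hS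
  exact ⟨a, fun x hx => (ha ⟨x, hx⟩).imp fun t ht => congrArg Subtype.val ht⟩

theorem IsEvolution.deriv_m_apply_eq_zero {I : Set ℝ} {v₀ : ℝ} {E : Submodule ℝ R42} {l : R42}
    {G : ℝ → R42 ≃L[ℝ] R42} {m : ℝ → E} (h : IsEvolution I v₀ E l G m) {x : R42}
    (hx : ∀ v ∈ I, lieForm (m v) x = 0) {v : ℝ} (hv : v ∈ I) : lieForm (deriv m v : E) x = 0 := by
  have h1 := (h.hasDerivAt_m hv).lieForm (hasDerivAt_const v x)
  have h2 := (h1.congr_of_eventuallyEq (f₁ := fun _ => (0 : ℝ)) (by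
    filter_upwards [h.isOpen.mem_nhds hv] with t ht using (hx t ht).symm)).unique
    (hasDerivAt_const v 0)
  simpa using h2

namespace IsEvolvedSurface

variable {I₁ I₂ : Set ℝ} {v₀ : ℝ} {E : Submodule ℝ R42} {l : R42} {G : ℝ → R42 ≃L[ℝ] R42}
  {m : ℝ → E} {C : ℝ → Submodule ℝ E} {f : ℝ × ℝ → Submodule ℝ R42} {u v : ℝ}
  {h₁ h₂ k : ℝ → E} {φ : ℝ → ℝ} {η : ℝ × ℝ → ℝ × ℝ →L[ℝ] R42 →L[ℝ] R42} {X : ℝ × ℝ}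
  {a₁ a₂ γ δ P₁ P₂ : ℝ × ℝ → ℝ}

/-- With `Q₁ = P₁ - a₁ (m, h₂)` and `Q₂ = P₂ + a₁ (m, h₁)` the relation between the coefficients
reads `φ Q₁ - Q₂ = ρ (m, h₂)`; its derivative in `u` expresses `Q₁` as `(m, D)`, and the derivative
of that shows that `D' - κ h₂` is orthogonal to `m`. -/
theorem exists_curveData (h : IsEvolvedSurface I₁ I₂ v₀ E l G m C f)
    (F : IsAdaptedFrame I₁ I₂ m C (m v₀) (deriv m v₀) h₁ h₂ k φ)
    (hP : IsPotentialCoefficients I₁ I₂ m h₁ h₂ k φ a₁ a₂ γ δ P₁ P₂) :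
    ∃ ρ κ D, IsCurveData I₁ I₂ m h₁ h₂ k φ ρ κ D := by
  have hv₀ := h.evol.base_mem
  have hΩ := h.isOpen_prod
  have hnhds : ∀ {u v}, u ∈ I₁ → v ∈ I₂ → I₁ ×ˢ I₂ ∈ 𝓝 ((u, v) : ℝ × ℝ) := fun hu hv =>
    hΩ.mem_nhds ⟨hu, hv⟩
  have hdiff : ∀ {g : ℝ × ℝ → ℝ}, ContDiffOn ℝ ∞ g (I₁ ×ˢ I₂) → ∀ {u v}, u ∈ I₁ → v ∈ I₂ →
      DifferentiableAt ℝ g (u, v) := fun hg _ _ hu hv =>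
    (hg.contDiffAt (hnhds hu hv)).differentiableAt (by simp)
  have hs₁ : ContDiffOn ℝ ∞ (fun p => fderiv ℝ a₁ p (1, 0)) (I₁ ×ˢ I₂) :=
    (hP.smooth_a₁.fderiv_of_isOpen hΩ (m := ∞) (by simp)).clm_apply contDiffOn_const
  have hinc : ContDiffOn ℝ ∞ (fun u : ℝ => (u, v₀)) I₁ := contDiffOn_id.prodMk contDiffOn_const
  have hincm : Set.MapsTo (fun u : ℝ => (u, v₀)) I₁ (I₁ ×ˢ I₂) := fun u hu => ⟨hu, hv₀⟩
  -- `a₂ - φ a₁` and `γ - ∂a₁/∂u` do not depend on `v`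
  set ρ : ℝ → ℝ := fun u => a₂ (u, v₀) - φ u * a₁ (u, v₀) with hρdef
  set κ : ℝ → ℝ := fun u => γ (u, v₀) - fderiv ℝ a₁ (u, v₀) (1, 0) with hκdef
  have hρ : ∀ u ∈ I₁, ∀ v ∈ I₂, a₂ (u, v) - φ u * a₁ (u, v) = ρ u := by
    intro u hu v hv
    refine constant_of_hasDerivAt_zero h.evol.isOpen h.evol.ordConnected
      (y := fun v => a₂ (u, v) - φ u * a₁ (u, v)) (fun t ht => ?_) hv hv₀
    exact ((hP.hasDerivAt_a₂ u hu t ht).sub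
      ((hP.hasDerivAt_a₁ u hu t ht).const_mul (φ u))).congr_deriv (by ring)
  have hκ : ∀ u ∈ I₁, ∀ v ∈ I₂, γ (u, v) - fderiv ℝ a₁ (u, v) (1, 0) = κ u := by
    intro u hu v hv
    refine constant_of_hasDerivAt_zero h.evol.isOpen h.evol.ordConnected
      (y := fun v => γ (u, v) - fderiv ℝ a₁ (u, v) (1, 0)) (fun t ht => ?_) hv hv₀
    obtain ⟨r, hr, hr'⟩ := hP.closed u hu t ht
    have e1 := hasDerivAt_snd_slice (hdiff hs₁ hu ht)
    rw [fderiv_fderiv_comm hΩ hP.smooth_a₁ (show ((u, t) : ℝ × ℝ) ∈ I₁ ×ˢ I₂ from ⟨hu, ht⟩)] at e1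
    have hs₂ : ContDiffOn ℝ ∞ (fun p => fderiv ℝ a₁ p (0, 1)) (I₁ ×ˢ I₂) :=
      (hP.smooth_a₁.fderiv_of_isOpen hΩ (m := ∞) (by simp)).clm_apply contDiffOn_const
    have e2 := (hasDerivAt_fst_slice (hdiff hs₂ hu ht)).unique (hr.congr_of_eventuallyEq (by
      filter_upwards [h.isOpen.mem_nhds hu] with s hs
      exact (hasDerivAt_snd_slice (hdiff hP.smooth_a₁ hs ht)).unique (hP.hasDerivAt_a₁ s hs t ht)))
    rw [e2] at e1
    exact (hr'.sub e1).congr_deriv (sub_self r)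
  have hρs : ContDiffOn ℝ ∞ ρ I₁ := (hP.smooth_a₂.comp hinc hincm).sub
    (F.smooth_φ.mul (hP.smooth_a₁.comp hinc hincm))
  have hκs : ContDiffOn ℝ ∞ κ I₁ := (hP.smooth_γ.comp hinc hincm).sub (hs₁.comp hinc hincm)
  have hm : ∀ {u : ℝ} {y : ℝ → E} {y' : E} (v : ℝ), HasDerivAt y y' u →
      HasDerivAt (fun s => lieForm (m v) (y s)) (lieForm (m v) y') u := fun v hy =>
    ((hasDerivAt_const _ (m v : R42)).lieForm
      (E.subtypeL.hasFDerivAt.comp_hasDerivAt _ hy)).congr_deriv (by simp)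
  have ha₁ : ∀ u ∈ I₁, ∀ v ∈ I₂, HasDerivAt (fun s => a₁ (s, v)) (γ (u, v) - κ u) u := by
    intro u hu v hv
    refine (hasDerivAt_fst_slice (hdiff hP.smooth_a₁ hu hv)).congr_deriv ?_
    rw [← hκ u hu v hv]
    ring
  have hQ₁ : ∀ u ∈ I₁, ∀ v ∈ I₂, HasDerivAt (fun s => P₁ (s, v) - a₁ (s, v) * lieForm (m v) (h₂ s))
      (κ u * lieForm (m v) (h₂ u)) u := by
    intro u hu v hv
    refine ((hP.hasDerivAt_P₁ u hu v hv).sub ((ha₁ u hu v hv).mul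
      (hm v (F.hasDerivAt₂ u hu)))).congr_deriv ?_
    ring
  have hQ₂ : ∀ u ∈ I₁, ∀ v ∈ I₂, HasDerivAt (fun s => P₂ (s, v) + a₁ (s, v) * lieForm (m v) (h₁ s))
      (ρ u * lieForm (m v) (k u) - κ u * lieForm (m v) (h₁ u)) u := by
    intro u hu v hv
    refine ((hP.hasDerivAt_P₂ u hu v hv).add ((ha₁ u hu v hv).mul
      (hm v (F.hasDerivAt₁ u hu)))).congr_deriv ?_
    rw [← hρ u hu v hv, Submodule.coe_smul, map_smul, smul_eq_mul]
    ring
  have hQ : ∀ u ∈ I₁, ∀ v ∈ I₂, φ u * (P₁ (u, v) - a₁ (u, v) * lieForm (m v) (h₂ u)) -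
      (P₂ (u, v) + a₁ (u, v) * lieForm (m v) (h₁ u)) = ρ u * lieForm (m v) (h₂ u) := by
    intro u hu v hv
    rw [← hρ u hu v hv]
    linear_combination hP.relation u hu v hv
  set D : ℝ → E := fun u => (deriv φ u)⁻¹ • ((2 * ρ u) • k u + deriv ρ u • h₂ u -
    κ u • (h₁ u + φ u • h₂ u)) with hD
  have hDs : ContDiffOn ℝ ∞ D I₁ :=
    ((contDiffOn_deriv F.smooth_φ h.isOpen).inv F.deriv_φ_ne).smul
      ((((contDiffOn_const.mul hρs).smul F.smooth_k).add
        ((contDiffOn_deriv hρs h.isOpen).smul F.smooth₂)).sub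
        (hκs.smul (F.smooth₁.add (F.smooth_φ.smul F.smooth₂))))
  have hDφ : ∀ u ∈ I₁, deriv φ u • D u =
      (2 * ρ u) • k u + deriv ρ u • h₂ u - κ u • (h₁ u + φ u • h₂ u) := fun u hu => by
    rw [hD, smul_smul, mul_inv_cancel₀ (F.deriv_φ_ne u hu), one_smul]
  -- the derivative of the relation between `P₁` and `P₂`
  have hDm : ∀ u ∈ I₁, ∀ v ∈ I₂,
      lieForm (m v) (D u) = P₁ (u, v) - a₁ (u, v) * lieForm (m v) (h₂ u) := by
    intro u hu v hv
    have e1 := ((F.smooth_φ.hasDerivAt h.isOpen hu).mul (hQ₁ u hu v hv)).sub (hQ₂ u hu v hv)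
    have e2 := ((hρs.hasDerivAt h.isOpen hu).mul (hm v (F.hasDerivAt₂ u hu)))
    have e3 := (e1.congr_of_eventuallyEq (f₁ := fun s => ρ s * lieForm (m v) (h₂ s)) (by
      filter_upwards [h.isOpen.mem_nhds hu] with s hs using (hQ s hs v hv).symm)).unique e2
    have e4 := congrArg (fun x : E => lieForm (m v) x) (hDφ u hu)
    simp only [Submodule.coe_add, Submodule.coe_sub, Submodule.coe_smul, map_add, map_sub, map_smul,
      smul_eq_mul] at e4
    refine mul_left_cancel₀ (F.deriv_φ_ne u hu) ?_
    linear_combination e4 - e3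
  have hmD : ∀ u ∈ I₁, ∀ v ∈ I₂, lieForm (m v) (deriv D u - κ u • h₂ u : E) = 0 := by
    intro u hu v hv
    have e1 := (hm v (hDs.hasDerivAt h.isOpen hu)).unique ((hQ₁ u hu v hv).congr_of_eventuallyEq (by
      filter_upwards [h.isOpen.mem_nhds hu] with s hs using hDm s hs v hv))
    simp [e1]
  refine ⟨ρ, κ, D, hρs, hκs, hDs, hDφ, hmD, ?_⟩
  -- if `ρ = 0`, then `(m₂, D) = φ (m₁, D)`, whose derivative gives `κ = 0`, and then all
  -- coefficients in the quadratic differential vanish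
  by_contra! hρ0
  have hρ'0 : ∀ u ∈ I₁, deriv ρ u = 0 := fun u hu => by
    refine ((hρs.hasDerivAt h.isOpen hu).congr_of_eventuallyEq (f₁ := fun _ => (0 : ℝ)) ?_).unique
      (hasDerivAt_const u 0)
    filter_upwards [h.isOpen.mem_nhds hu] with s hs using (hρ0 s hs).symm
  have hDc : ∀ u ∈ I₁, deriv φ u • D u = -κ u • (h₁ u + φ u • h₂ u) := fun u hu => by
    rw [hDφ u hu, hρ0 u hu, hρ'0 u hu]; module
  have hDm₁ : ∀ u ∈ I₁, deriv φ u * lieForm (m v₀) (D u) = -κ u := fun u hu => by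
    have := congrArg (fun x : E => lieForm (m v₀) x) (hDc u hu)
    simpa [F.dual₁₁ u hu, F.dual₁₂ u hu] using this
  have hDm₂ : ∀ u ∈ I₁, lieForm (deriv m v₀ : E) (D u) =
      φ u * lieForm (m v₀) (D u) := fun u hu => by
    have := congrArg (fun x : E => lieForm (deriv m v₀ : E) x) (hDc u hu)
    simp [F.dual₂₁ u hu, F.dual₂₂ u hu] at this
    refine mul_left_cancel₀ (F.deriv_φ_ne u hu) ?_
    linear_combination this - φ u * hDm₁ u hu
  have hκ0 : ∀ u ∈ I₁, κ u = 0 := by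
    intro u hu
    have hd := hDs.hasDerivAt h.isOpen hu
    have e1 := (hasDerivAt_const u ((deriv m v₀ : E) : R42)).lieForm
      (E.subtypeL.hasFDerivAt.comp_hasDerivAt u hd)
    have e2 := e1.unique (((F.smooth_φ.hasDerivAt h.isOpen hu).mul
      (hm v₀ hd)).congr_of_eventuallyEq (by
      filter_upwards [h.isOpen.mem_nhds hu] with s hs using hDm₂ s hs))
    have e3 := hmD u hu v₀ hv₀
    have e4 := h.evol.deriv_m_apply_eq_zero (hmD u hu) hv₀
    simp [F.dual₁₂ u hu] at e3
    simp [F.dual₂₂ u hu] at e4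
    simp at e2
    rw [e3] at e2
    have := hDm₁ u hu
    linarith
  obtain ⟨u, hu, v, hv, hne⟩ := hP.ne_zero
  have hD0 : D u = 0 := by simp [hD, hρ0 u hu, hρ'0 u hu, hκ0 u hu]
  have e1 := hDm u hu v hv
  have e2 := hQ u hu v hv
  rw [hρ u hu v hv] at hne
  rw [hD0] at e1
  rw [hρ0 u hu] at e2 hne
  simp only [ZeroMemClass.coe_zero, map_zero] at e1
  refine hne.elim (fun h0 => h0 rfl) fun h0 => h0 ?_
  linear_combination -lieForm (m v) (h₁ u) * e1 - lieForm (m v) (h₂ u) * e2 -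
    lieForm (m v) (h₂ u) * φ u * e1

/-- The vectors `D' - κ h₂`, orthogonal to all `m v`, do not stay in a line: if they were multiples
of a fixed vector, then that vector, being orthogonal to `c = h₁ + φ h₂`, would be orthogonal to
`c' = φ' h₂`, but `D' - κ h₂` is not where `ρ ≠ 0`. -/
theorem finrank_span_le_three (h : IsEvolvedSurface I₁ I₂ v₀ E l G m C f)
    (F : IsAdaptedFrame I₁ I₂ m C (m v₀) (deriv m v₀) h₁ h₂ k φ) {ρ κ : ℝ → ℝ} {D : ℝ → E}
    (hD : IsCurveData I₁ I₂ m h₁ h₂ k φ ρ κ D) :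
    Module.finrank ℝ (Submodule.span ℝ (m '' I₂)) ≤ 3 := by
  set M : Submodule ℝ E := Submodule.span ℝ (m '' I₂)
  have hEdim := h.evol.finrank_eq
  have hfr := LinearMap.BilinForm.finrank_orthogonal h.evol.restrict_nondegenerate M
  by_contra! hM
  have hN : Module.finrank ℝ ((lieForm.restrict E).orthogonal M) ≤ 1 := by omega
  obtain ⟨u₁, hu₁, hρ₁⟩ := hD.ne_zero
  have hd1 : ∀ u ∈ I₁, HasDerivAt (fun s => (h₁ s : R42)) (-φ u • k u : E) u := fun u hu =>
    E.subtypeL.hasFDerivAt.comp_hasDerivAt u (F.hasDerivAt₁ u hu)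
  have hd2 : ∀ u ∈ I₁, HasDerivAt (fun s => (h₂ s : R42)) (k u) u := fun u hu =>
    E.subtypeL.hasFDerivAt.comp_hasDerivAt u (F.hasDerivAt₂ u hu)
  have hDd : ∀ u ∈ I₁, HasDerivAt (fun s => (D s : R42)) (deriv D u : E) u := fun u hu =>
    E.subtypeL.hasFDerivAt.comp_hasDerivAt u (hD.smooth_D.hasDerivAt h.isOpen hu)
  have hcd : ∀ u ∈ I₁, HasDerivAt (fun s => (h₁ s : R42) + φ s • (h₂ s : R42))
      (deriv φ u • (h₂ u : R42)) u := fun u hu => by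
    refine ((hd1 u hu).add ((F.smooth_φ.hasDerivAt h.isOpen hu).smul (hd2 u hu))).congr_deriv ?_
    simp
  have zero_deriv : ∀ (g : ℝ → ℝ) (g' u : ℝ), u ∈ I₁ → (∀ᶠ s in 𝓝 u, g s = 0) →
      HasDerivAt g g' u → g' = 0 := fun g g' u hu hg hg' =>
    (hg'.congr_of_eventuallyEq (f₁ := fun _ => (0 : ℝ)) (hg.mono fun s hs => hs.symm)).unique
      (hasDerivAt_const u 0)
  have hDC : ∀ u ∈ I₁, ∀ c ∈ C u, lieForm (D u) c = 0 := by
    intro u hu c hc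
    have e := congrArg (fun x : E => lieForm x c) (hD.smul_D u hu)
    have o1 := h.null hu (F.mem₁ u hu) hc
    have o2 := h.null hu (F.mem₂ u hu) hc
    have o3 := F.orth_k u hu c hc
    rw [lieForm_comm] at o3
    simp [o1, o2, o3] at e
    exact e.resolve_left (F.deriv_φ_ne u hu)
  set w : ℝ → E := fun u => deriv D u - κ u • h₂ u with hw
  have hwc : ∀ u ∈ I₁, lieForm (w u) ((h₁ u : R42) + φ u • (h₂ u : R42)) = 0 := by
    intro u hu
    have e := zero_deriv _ _ u hu (by
      filter_upwards [h.isOpen.mem_nhds hu] with s hs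
      exact hDC s hs (h₁ s + φ s • h₂ s) ((C s).add_mem (F.mem₁ s hs)
        ((C s).smul_mem _ (F.mem₂ s hs)))) ((hDd u hu).lieForm (hcd u hu))
    have o1 := h.null hu (F.mem₂ u hu) (F.mem₁ u hu)
    have o2 := h.null hu (F.mem₂ u hu) (F.mem₂ u hu)
    have o3 := hDC u hu _ (F.mem₂ u hu)
    simp [o3] at e
    simp [hw, o1, o2]
    linarith
  have hwh : ∀ u ∈ I₁, deriv φ u * lieForm (w u) (h₂ u) = -(2 * ρ u * lieForm (k u) (k u)) := by
    intro u hu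
    have e := zero_deriv _ _ u hu (by
      filter_upwards [h.isOpen.mem_nhds hu] with s hs
      exact hDC s hs _ (F.mem₂ s hs)) ((hDd u hu).lieForm (hd2 u hu))
    have e2 := congrArg (fun x : E => lieForm x (k u)) (hD.smul_D u hu)
    have o1 := F.orth_k u hu _ (F.mem₁ u hu)
    have o2 := F.orth_k u hu _ (F.mem₂ u hu)
    have o3 := h.null hu (F.mem₂ u hu) (F.mem₂ u hu)
    simp [o1, o2] at e2
    simp [hw, o3]
    linear_combination deriv φ u * e - e2
  have hwM : ∀ u ∈ I₁, w u ∈ (lieForm.restrict E).orthogonal M := by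
    intro u hu n hn
    change lieForm n (w u) = 0
    induction hn using Submodule.span_induction with
    | mem n hn => obtain ⟨v, hv, rfl⟩ := hn; exact hD.m_apply u hu v hv
    | zero => simp
    | add a b _ _ ha hb => rw [Submodule.coe_add, map_add, LinearMap.add_apply, ha, hb, add_zero]
    | smul t a _ ha => rw [Submodule.coe_smul, map_smul, LinearMap.smul_apply, ha, smul_zero]
  have hw0 : lieForm (w u₁) (h₂ u₁) ≠ 0 := by
    intro h0
    have := hwh u₁ hu₁
    rw [h0, mul_zero] at this
    exact mul_ne_zero (mul_ne_zero two_ne_zero hρ₁) (F.k_pos u₁ hu₁).ne' (neg_eq_zero.1 this.symm)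
  -- near `u₁` the vector `w u` is a non-zero multiple of the fixed vector `w u₁`
  have hprop : ∀ᶠ u in 𝓝 u₁, u ∈ I₁ ∧ ∃ t : ℝ, t ≠ 0 ∧ w u = t • w u₁ := by
    filter_upwards [h.isOpen.mem_nhds hu₁,
      (hD.smooth_ρ.continuousOn.continuousAt (h.isOpen.mem_nhds hu₁)).eventually_ne hρ₁]
      with u hu hρu
    refine ⟨hu, ?_⟩
    obtain ⟨a, hspan⟩ := exists_forall_eq_smul_of_finrank_le_one hN
    obtain ⟨t₁, ht₁'⟩ := hspan _ (hwM u₁ hu₁)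
    obtain ⟨t, ht'⟩ := hspan _ (hwM u hu)
    have ht₁0 : t₁ ≠ 0 := by
      rintro rfl
      rw [zero_smul] at ht₁'
      rw [← ht₁'] at hw0
      simp at hw0
    have ht0 : t ≠ 0 := by
      rintro rfl
      rw [zero_smul] at ht'
      have := hwh u hu
      rw [← ht'] at this
      simp at this
      exact this.elim hρu fun h0 => (F.k_pos u hu).ne' h0
    refine ⟨t / t₁, div_ne_zero ht0 ht₁0, ?_⟩
    rw [← ht₁', ← ht', smul_smul, div_mul_cancel₀ _ ht₁0]
  have hfin := zero_deriv (fun s => lieForm (w u₁) ((h₁ s : R42) + φ s • (h₂ s : R42))) _ u₁ hu₁ (by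
    filter_upwards [hprop] with s hs
    obtain ⟨hs, t, ht, hwt⟩ := hs
    have := hwc s hs
    rw [hwt, Submodule.coe_smul, map_smul, LinearMap.smul_apply, smul_eq_mul] at this
    exact (mul_eq_zero.1 this).resolve_left ht)
    ((hasDerivAt_const u₁ (w u₁ : R42)).lieForm (hcd u₁ hu₁))
  simp only [map_zero, LinearMap.zero_apply, zero_add, map_smul, smul_eq_mul] at hfin
  exact (mul_ne_zero (F.deriv_φ_ne u₁ hu₁) hw0) hfin

end IsEvolvedSurface

/-! ### The two kinds of Lie applicable evolved surfaces -/

namespace IsEvolvedSurface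

variable {I₁ I₂ : Set ℝ} {v₀ : ℝ} {E : Submodule ℝ R42} {l : R42} {G : ℝ → R42 ≃L[ℝ] R42}
  {m : ℝ → E} {C : ℝ → Submodule ℝ E} {f : ℝ × ℝ → Submodule ℝ R42} {u v : ℝ}
  {h₁ h₂ k : ℝ → E} {φ ρ κ : ℝ → ℝ} {D : ℝ → E}

/-- If the normals `k u` are orthogonal to all `m v`, then they are fixed by `G`, and the sphere
congruence `k` serves for every choice of the point sphere complex. -/
theorem hasSphericalCurvatureLines_of_m_apply_k (h : IsEvolvedSurface I₁ I₂ v₀ E l G m C f)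
    (F : IsAdaptedFrame I₁ I₂ m C (m v₀) (deriv m v₀) h₁ h₂ k φ)
    (hmk : ∀ u ∈ I₁, ∀ v ∈ I₂, lieForm (m v) (k u) = 0) :
    HasSphericalCurvatureLines lieForm (I₁ ×ˢ I₂) f (0, 1) := by
  set p : R42 := Pi.single 4 1 with hp
  have hpp : lieForm p p = -1 := by simp [lieForm_apply, hp]
  -- the positive root of `(k + t p, k + t p) = 0`
  set t : ℝ → ℝ := fun u => lieForm (k u) p + √(lieForm (k u) p ^ 2 + lieForm (k u) (k u)) with ht
  have hpos : ∀ u ∈ I₁, 0 < lieForm (k u) p ^ 2 + lieForm (k u) (k u) := fun u hu =>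
    add_pos_of_nonneg_of_pos (sq_nonneg _) (F.k_pos u hu)
  have hroot : ∀ u ∈ I₁, lieForm (k u) (k u) + 2 * t u * lieForm (k u) p - t u ^ 2 = 0 := by
    intro u hu
    have := Real.sq_sqrt (hpos u hu).le
    simp only [ht]
    linear_combination -this
  have hks : ContDiffOn ℝ ∞ (fun u => (k u : R42)) I₁ :=
    E.subtypeL.contDiff.comp_contDiffOn F.smooth_k
  have hts : ContDiffOn ℝ ∞ t I₁ := by
    have h1 : ContDiffOn ℝ ∞ (fun u => lieForm (k u) p) I₁ := hks.lieForm contDiffOn_const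
    exact h1.add (((h1.pow 2).add (hks.lieForm hks)).sqrt fun u hu => (hpos u hu).ne')
  have hfk : ∀ u ∈ I₁, ∀ v ∈ I₂, ∀ a ∈ f (u, v), lieForm (k u) a = 0 := by
    intro u hu v hv a ha
    obtain ⟨c, hc, rfl⟩ := (h.mem_fibre hu hv).1 ha
    rw [← h.evol.apply_eq_self (hmk u hu) hv, h.evol.orthogonal v hv, lieForm_comm,
      F.orth_k u hu c hc]
  refine ⟨fun x hx => h.isCurvatureDirection_v hx.1 hx.2, p,
    fun x => Submodule.span ℝ {(k x.1 : R42) + t x.1 • p}, hpp, ?_, ?_, ?_, ?_, ?_⟩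
  · intro x hx
    refine ⟨fun _ x => (k x.1 : R42) + t x.1 • p, ?_⟩
    filter_upwards [h.isOpen_prod.mem_nhds hx] with y hy
    refine ⟨fun _ => ?_, ?_, by rw [Set.range_const]⟩
    · have h1 : ContDiffOn ℝ ∞ (fun x : ℝ × ℝ => (k x.1 : R42)) (I₁ ×ˢ I₂) :=
        hks.comp contDiffOn_fst fun x hx => hx.1
      have h2 : ContDiffOn ℝ ∞ (fun x : ℝ × ℝ => t x.1) (I₁ ×ˢ I₂) :=
        hts.comp contDiffOn_fst fun x hx => hx.1
      exact (h1.add (h2.smul contDiffOn_const)).contDiffAt (h.isOpen_prod.mem_nhds hy)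
    · refine LinearIndependent.of_subsingleton 0 fun h0 => ?_
      have e1 := congrArg (fun x => lieForm x x) (eq_neg_of_add_eq_zero_left h0)
      have := F.k_pos y.1 hy.1
      simp [hpp] at e1
      nlinarith [mul_self_nonneg (t y.1)]
  · rintro x hx n hn
    obtain ⟨r, rfl⟩ := Submodule.mem_span_singleton.1 hn
    have := hroot x.1 hx.1
    simp [hpp, lieForm_comm p]
    linear_combination r ^ 2 * this
  · intro x hx s hs
    simp
  · rintro ⟨u, v⟩ ⟨hu, hv⟩ a ha hpa n hn
    obtain ⟨r, rfl⟩ := Submodule.mem_span_singleton.1 hn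
    simp [hpa, hfk u hu v hv a ha]
  · rintro ⟨u, v⟩ ⟨hu, hv⟩
    rw [eq_bot_iff]
    rintro x ⟨hx, hxf⟩
    obtain ⟨y, hy, z, hz, rfl⟩ := Submodule.mem_sup.1 hx
    obtain ⟨r, rfl⟩ := Submodule.mem_span_singleton.1 hy
    obtain ⟨s, rfl⟩ := Submodule.mem_span_singleton.1 hz
    have e1 := hfk u hu v hv _ hxf
    have e2 := h.legendre.null (u, v) ⟨hu, hv⟩ _ hxf _ hxf
    have e3 := F.k_pos u hu
    have e4 := hpos u hu
    have hx' : r • ((k u : R42) + t u • p) + s • p =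
        r • (k u : R42) + (r * t u + s) • p := by module
    rw [hx'] at e1 e2 ⊢
    set q := r * t u + s
    simp only [map_add, map_smul, LinearMap.add_apply, LinearMap.smul_apply, smul_eq_mul, hpp,
      lieForm_comm p (k u)] at e1 e2
    have e5 : q * (r * lieForm (k u) p - q) = 0 := by linear_combination e2 - r * e1
    have hr : r = 0 := by
      rcases mul_eq_zero.1 e5 with hq | hq
      · rw [hq, zero_mul, add_zero] at e1
        exact (mul_eq_zero.1 e1).resolve_right e3.ne'
      · have : r * (lieForm (k u) p ^ 2 + lieForm (k u) (k u)) = 0 := by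
          linear_combination e1 + lieForm (k u) p * hq
        exact (mul_eq_zero.1 this).resolve_right e4.ne'
    have hq : q = 0 := by
      rw [hr] at e5
      simpa using e5
    rw [hr, hq]
    simp

theorem m_mem_span (hv : v ∈ I₂) : m v ∈ Submodule.span ℝ (m '' I₂) :=
  Submodule.subset_span ⟨v, hv, rfl⟩

/-- If the span of `m` is a plane, then it is spanned by `m v₀` and `m' v₀`. -/
theorem m_apply_k_eq_zero_of_finrank (h : IsEvolvedSurface I₁ I₂ v₀ E l G m C f)
    (F : IsAdaptedFrame I₁ I₂ m C (m v₀) (deriv m v₀) h₁ h₂ k φ)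
    (hM : Module.finrank ℝ (Submodule.span ℝ (m '' I₂)) ≤ 2) (hu : u ∈ I₁) (hv : v ∈ I₂) :
    lieForm (m v) (k u) = 0 := by
  have hv₀ := h.evol.base_mem
  have hli : LinearIndependent ℝ ![m v₀, deriv m v₀] := by
    rw [LinearIndependent.pair_iff]
    intro s t hst
    have e1 := congrArg (fun x : E => lieForm x (h₁ u)) hst
    have e2 := congrArg (fun x : E => lieForm x (h₂ u)) hst
    simp [F.dual₁₁ u hu, F.dual₂₁ u hu] at e1
    simp [F.dual₁₂ u hu, F.dual₂₂ u hu] at e2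
    exact ⟨e1, e2⟩
  have hm' : deriv m v₀ ∈ Submodule.span ℝ (m '' I₂) := by
    refine mem_of_hasDerivAt (h.evol.smooth_m.hasDerivAt h.evol.isOpen hv₀) ?_
    filter_upwards [h.evol.isOpen.mem_nhds hv₀] with t ht using m_mem_span ht
  have hle : Submodule.span ℝ (Set.range ![m v₀, deriv m v₀]) ≤ Submodule.span ℝ (m '' I₂) := by
    rw [Submodule.span_le]
    rintro _ ⟨i, rfl⟩
    fin_cases i
    · exact m_mem_span hv₀
    · exact hm'
  have heq := Submodule.eq_of_le_of_finrank_le hle (by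
    rw [finrank_span_eq_card hli]
    simpa using hM)
  have hmv : m v ∈ Submodule.span ℝ (Set.range ![m v₀, deriv m v₀]) := heq ▸ m_mem_span hv
  rw [Matrix.range_cons, Matrix.range_cons, Matrix.range_empty, Set.union_empty,
    Set.singleton_union, Submodule.mem_span_pair] at hmv
  obtain ⟨s, t, hst⟩ := hmv
  rw [← hst]
  simp [F.a_k u hu, F.b_k u hu]

/-- A vector orthogonal to `l` and to all `m v` is fixed by `G`, hence orthogonal to `G l`. -/
theorem line_le_span (h : IsEvolvedSurface I₁ I₂ v₀ E l G m C f) (hv : v ∈ I₂) :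
    G v l ∈ Submodule.span ℝ {l} ⊔ (Submodule.span ℝ (m '' I₂)).map E.subtype := by
  rw [← LinearMap.BilinForm.orthogonal_orthogonal lieForm_nondegenerate lieForm_isSymm.isRefl
    (Submodule.span ℝ {l} ⊔ (Submodule.span ℝ (m '' I₂)).map E.subtype)]
  intro n hn
  have hnl : lieForm l n = 0 := hn l (Submodule.mem_sup_left (Submodule.mem_span_singleton_self l))
  have hnE : n ∈ E := (h.evol.mem_iff n).2 hnl
  have hfix : G v n = n := h.evol.apply_eq_self (x := ⟨n, hnE⟩) (fun w hw =>
    hn _ (Submodule.mem_sup_right ⟨m w, m_mem_span hw, rfl⟩)) hv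
  change lieForm n (G v l) = 0
  rw [← hfix, h.evol.orthogonal v hv, lieForm_comm, hnl]

/-- The conserved quantity with constant part `w` has top coefficient
`(D, w) h₁ + (φ D - ρ h₂, w) h₂`. -/
theorem isConstrainedElastic_of_curveData (h : IsEvolvedSurface I₁ I₂ v₀ E l G m C f)
    (F : IsAdaptedFrame I₁ I₂ m C (m v₀) (deriv m v₀) h₁ h₂ k φ)
    (hD : IsCurveData I₁ I₂ m h₁ h₂ k φ ρ κ D)
    (hM : Module.finrank ℝ (Submodule.span ℝ (m '' I₂)) = 3) :
    IsConstrainedElastic (lieForm.restrict E) I₁ C (Submodule.span ℝ (m '' I₂)) := by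
  have hξ := h.isGaugePotential_framePotential F hD.smooth_ρ hD.smooth_κ hD.ne_zero
  let top : E →ₗ[ℝ] (ℝ → E) := LinearMap.pi fun u =>
    ((lieForm (D u)).comp E.subtype).smulRight (h₁ u) +
      ((φ u • lieForm (D u) - ρ u • lieForm (h₂ u)).comp E.subtype).smulRight (h₂ u)
  have htop : ∀ w u, top w u = lieForm (D u) w • h₁ u +
      (φ u * lieForm (D u) w - ρ u * lieForm (h₂ u) w) • h₂ u := fun w u => rfl
  let Φ : E →ₗ[ℝ] (ℝ → E) × (ℝ → E) := (LinearMap.pi fun _ => LinearMap.id).prod top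
  have hΦ : ∀ w, Φ w = (fun _ => w, top w) := fun w => rfl
  have hΦi : Function.Injective Φ := fun x y hxy => congrFun (congrArg Prod.fst hxy) 0
  have htopC : ∀ w, ∀ u ∈ I₁, top w u ∈ C u := fun w u hu => by
    rw [htop]
    exact (C u).add_mem ((C u).smul_mem _ (F.mem₁ u hu)) ((C u).smul_mem _ (F.mem₂ u hu))
  have hsc : ∀ {y : ℝ → E}, ContDiffOn ℝ ∞ y I₁ → ∀ w : E,
      ContDiffOn ℝ ∞ (fun u => lieForm (y u) w) I₁ := fun hy w =>
    (E.subtypeL.contDiff.comp_contDiffOn hy).lieForm contDiffOn_const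
  have hder : ∀ {y : ℝ → E} {y' : E} {u : ℝ}, HasDerivAt y y' u → ∀ w : E,
      HasDerivAt (fun u => lieForm (y u) w) (lieForm y' w) u := fun hy w =>
    ((E.subtypeL.hasFDerivAt.comp_hasDerivAt _ hy).lieForm
      (hasDerivAt_const _ (w : R42))).congr_deriv (by simp)
  have hperp : ∀ u ∈ I₁, ∀ w ∈ Submodule.span ℝ (m '' I₂),
      lieForm (deriv D u : E) w = κ u * lieForm (h₂ u) w := by
    intro u hu w hw
    have : lieForm w (deriv D u - κ u • h₂ u : E) = 0 := by
      induction hw using Submodule.span_induction with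
      | mem n hn => obtain ⟨v, hv, rfl⟩ := hn; exact hD.m_apply u hu v hv
      | zero => simp
      | add a b _ _ ha hb => rw [Submodule.coe_add, map_add, LinearMap.add_apply, ha, hb, add_zero]
      | smul t a _ ha => rw [Submodule.coe_smul, map_smul, LinearMap.smul_apply, ha, smul_zero]
    rw [lieForm_comm] at this
    simp at this
    linarith
  have htopd : ∀ w ∈ Submodule.span ℝ (m '' I₂), ∀ u ∈ I₁,
      HasDerivAt (top w) (-framePotential h₁ h₂ k ρ κ u 1 w) u := by
    intro w hw u hu
    have d1 := hder (hD.smooth_D.hasDerivAt h.isOpen hu) w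
    have d2 := hder (F.hasDerivAt₂ u hu) w
    have dφ := F.smooth_φ.hasDerivAt h.isOpen hu
    have dρ := hD.smooth_ρ.hasDerivAt h.isOpen hu
    have e := congrArg (fun x : E => lieForm x w) (hD.smul_D u hu)
    simp only [Submodule.coe_add, Submodule.coe_sub, Submodule.coe_smul, map_add, map_sub, map_smul,
      LinearMap.add_apply, LinearMap.sub_apply, LinearMap.smul_apply, smul_eq_mul] at e
    refine ((d1.smul (F.hasDerivAt₁ u hu)).add (((dφ.mul d1).sub (dρ.mul d2)).smul
      (F.hasDerivAt₂ u hu))).congr_deriv ?_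
    rw [framePotential_apply, hperp u hu w hw]
    have e' : deriv φ u * lieForm (D u) w + φ u * (κ u * lieForm (h₂ u) w) -
        (deriv ρ u * lieForm (h₂ u) w + ρ u * lieForm (k u) w) =
        ρ u * lieForm (k u) w - κ u * lieForm (h₁ u) w := by linear_combination e
    rw [e']
    simp only [Pi.sub_apply, Pi.mul_apply]
    module
  refine ⟨hM, framePotential h₁ h₂ k ρ κ, hξ, (Submodule.span ℝ (m '' I₂)).map Φ, ?_, ?_, ?_⟩
  · rw [← hM]
    exact (Submodule.equivMapOfInjective Φ hΦi _).finrank_eq.symm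
  · rintro _ ⟨w, hw, rfl⟩
    rw [hΦ]
    refine ⟨contDiffOn_const, ?_, fun t u hu X => ?_, htopC w⟩
    · exact ((hsc hD.smooth_D w).smul F.smooth₁).add (((F.smooth_φ.mul (hsc hD.smooth_D w)).sub
        (hD.smooth_ρ.mul (hsc F.smooth₂ w))).smul F.smooth₂)
    · have hker := apply_eq_zero_of_mem_wedgeSpace (restrict_comm E) (h.curve.null u hu)
        (hξ.mem u hu X) (htopC w u hu)
      have hd : HasDerivAt (fun y => w + t • top w y) _ u :=
        ((htopd w hw u hu).const_smul t).const_add w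
      rw [fderiv_eq_smul_deriv, hd.deriv, map_add, map_smul, hker, smul_zero, add_zero,
        framePotential_apply, framePotential_apply]
      module
  · intro u _
    ext w
    constructor
    · rintro ⟨_, ⟨w, hw, rfl⟩, rfl⟩
      exact hw
    · exact fun hw => ⟨Φ w, ⟨w, hw, rfl⟩, rfl⟩

theorem isLieApplicable_iff (h : IsEvolvedSurface I₁ I₂ v₀ E l G m C f) (hne : I₁.Nonempty) :
    IsLieApplicable lieForm (I₁ ×ˢ I₂) f ↔
      (HasSphericalCurvatureLines lieForm (I₁ ×ˢ I₂) f (0, 1) ∨ ∃ W₀ : Submodule ℝ E,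
        (∀ v ∈ I₂, G v l ∈ Submodule.span ℝ {l} ⊔ W₀.map E.subtype) ∧
        IsConstrainedElastic (lieForm.restrict E) I₁ C W₀) := by
  constructor
  · rintro ⟨η, hη⟩
    obtain ⟨h₁, h₂, k, φ, F⟩ := h.exists_adaptedFrame
    obtain ⟨a₁, a₂, γ, δ, P₁, P₂, hP⟩ := h.exists_potentialCoefficients F hη
    obtain ⟨ρ, κ, D, hD⟩ := h.exists_curveData F hP
    have hle := h.finrank_span_le_three F hD
    rcases hle.lt_or_eq with hM | hM
    · exact Or.inl (h.hasSphericalCurvatureLines_of_m_apply_k F fun u hu v hv =>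
        h.m_apply_k_eq_zero_of_finrank F (Nat.lt_succ_iff.1 hM) hu hv)
    · exact Or.inr ⟨_, fun v hv => h.line_le_span hv, h.isConstrainedElastic_of_curveData F hD hM⟩
  · rintro (hs | ⟨W₀, hW, hC⟩)
    · exact h.isLieApplicable_of_spherical hne hs
    · exact h.isLieApplicable_of_constrainedElastic (fun v hv => h.m_mem_of_line_le hW hv) hC

end IsEvolvedSurface

end

end LieSphere

theorem mainTheorem1
    (I₁ I₂ : Set ℝ)
    (hI₁ : IsOpen I₁) (hI₁' : I₁.OrdConnected) (hI₁ne : I₁.Nonempty)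
    (hI₂ : IsOpen I₂) (hI₂' : I₂.OrdConnected)
    (v₀ : ℝ) (hv₀ : v₀ ∈ I₂)
    (L : ℝ → Submodule ℝ LieSphere.R42) (hL : LieSphere.IsSpacelikeLineCurve I₂ L)
    (A : ℝ → LieSphere.R42 ≃L[ℝ] LieSphere.R42)
    (hA : LieSphere.IsSphericalEvolutionMap LieSphere.lieForm I₂ L v₀ A)
    (C : ℝ → Submodule ℝ (LieSphere.lieForm.orthogonal (L v₀)))
    (hC : LieSphere.IsLegendreMap
      (LieSphere.lieForm.restrict (LieSphere.lieForm.orthogonal (L v₀))) I₁ C)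
    (f : ℝ × ℝ → Submodule ℝ LieSphere.R42)
    (hfAC : ∀ u ∈ I₁, ∀ v ∈ I₂, f (u, v) =
      ((C u).map (LieSphere.lieForm.orthogonal (L v₀)).subtype).map
        ((A v).symm.toLinearEquiv : LieSphere.R42 →ₗ[ℝ] LieSphere.R42))
    (hf : LieSphere.IsLegendreMap LieSphere.lieForm (I₁ ×ˢ I₂) f)
    (hf_umb : LieSphere.IsUmbilicFree (I₁ ×ˢ I₂) f)
    (hf_reg : LieSphere.IsRegular (I₁ ×ˢ I₂) f) :
    LieSphere.IsLieApplicable LieSphere.lieForm (I₁ ×ˢ I₂) f ↔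
      (LieSphere.HasSphericalCurvatureLines LieSphere.lieForm (I₁ ×ˢ I₂) f (0, 1) ∨
        ∃ W₀ : Submodule ℝ (LieSphere.lieForm.orthogonal (L v₀)),
          (∀ v ∈ I₂, L v ≤ L v₀ ⊔ W₀.map (LieSphere.lieForm.orthogonal (L v₀)).subtype) ∧
          LieSphere.IsConstrainedElastic
            (LieSphere.lieForm.restrict (LieSphere.lieForm.orthogonal (L v₀))) I₁ C W₀) := by
  obtain ⟨l, m, hevol, hl⟩ := LieSphere.exists_isEvolution hI₂ hI₂' hv₀ hL hA
  have h : LieSphere.IsEvolvedSurface I₁ I₂ v₀ _ l _ m C f :=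
    ⟨hevol, hI₁, hI₁', hC, hfAC, hf, hf_umb, hf_reg⟩
  have hl₀ : L v₀ = Submodule.span ℝ {l} := by
    rw [hl v₀ hv₀, hA.base]
    rfl
  rw [h.isLieApplicable_iff hI₁ne]
  refine or_congr Iff.rfl (exists_congr fun W₀ => and_congr ?_ Iff.rfl)
  refine forall₂_congr fun v hv => ?_
  rw [hl v hv, Submodule.span_singleton_le_iff_mem]
  generalize W₀.map (LieSphere.lieForm.orthogonal (L v₀)).subtype = S
  rw [hl₀]
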